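/- Fix $d\ge 1$. For each $n$ let $\alpha\in\mathbb R^n$ and $Z_{12}\in\mathbb R^{n\times d}$ (with rows $z_{1,12},\dots,z_{n,12}$) be non-random, all possibly depending on $n$, such that the columns of $Z_{12}$ sum to zero and such that $P=\alpha 1_n^T+1_n\alpha^T+Z_{12}Z_{12}^T$ has entries in $[0,1]$, is positive semidefinite, and satisfies $\max_i\sum_jP_{ij}>(\log n)^{4+a}$ for all large $n$, for some $a>0$. Let $P=XX^T$ with $X\in\mathbb R^{n\times d}$ (rows $x_1,\dots,x_n$), oriented such that $JX=Z_{12}$, where $J=I-n^{-1}1_n1_n^T$. Let $A$ be a symmetric random matrix with zero diagonal whose entries $A_{ij}$, $i<j$, are independent Bernoulli$(P_{ij})$ variables. Fix $i$ and assume that the limits $$\overline M_X=\lim_{n\to\infty}\frac{X^TX}{n}\ \text{(invertible)},\qquad Q_i=\lim_{n\to\infty}\frac1n\sum_{j\ne i}(x_i^Tx_j)(1-x_i^Tx_j)\,x_jx_j^T$$ exist. Let $\hat X=U_AS_A^{1/2}W$, where $S_A$ is the diagonal matrix of the $d$ largest singular values of $A$ in descending order, $U_A$ is the $n\times d$ matrix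 of corresponding orthonormal left singular vectors in a singular value decomposition of $A$, and $W$ is a (possibly data-dependent, measurable) $d\times d$ orthogonal matrix that resolves the rotation indeterminacy in one of the following two ways, almost surely for all large $n$: (a) $\hat X$ is closest to $X$ in Frobenius norm among all $\hat XO$ with $O$ orthogonal; or (b) $Z_{12}^TZ_{12}/n$ is diagonal for all large $n$, with diagonal elements whose pairwise differences are bounded away from zero; $(J\hat X)^TJ\hat X$ is diagonal as well, with diagonal elements in the same order as those of $Z_{12}^TZ_{12}$; and the column signs are fixed either by requiring that each column of $\hat X$ has non-negative inner product with the same column of $X$, or, when all entries of the first row of $Z_{12}$ are positive and bounded away from zero, by requiring that all entries of the first row of $J\hat X$ are non-negative. Let $\hat Z_{12}=J\hat X$, with rows $\hat z_{1,12},\dots,\hat z_{n,12}$. Then, as $n\to\infty$, $$\sqrt n\,(\hat z_{i,12}-z_{i,12})\ \longrightarrow\ \mathcal N\bigl(0,\ \overline M_X^{-1}Q_i\overline M_X^{-1}\bigr)\quad\text{in distribution.}$$ -/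

import Mathlib

open MeasureTheory ProbabilityTheory Filter Topology
open scoped Matrix

noncomputable section

/-- The matrix `P = α 1ᵀ + 1 αᵀ + Z Zᵀ` of connection probabilities. -/
def linkProb {n d : ℕ} (α : Fin n → ℝ) (Z : Matrix (Fin n) (Fin d) ℝ) :
    Matrix (Fin n) (Fin n) ℝ :=
  Matrix.of fun i j => α i + α j + ∑ a, Z i a * Z j a

/-- The centering matrix `I - 1 1ᵀ / n`. -/
def centering (n : ℕ) : Matrix (Fin n) (Fin n) ℝ :=
  1 - (n : ℝ)⁻¹ • Matrix.of fun _ _ => (1 : ℝ)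

/-- `A` is the random adjacency matrix of an undirected graph without self-loops whose edges are
independent, the edge `{i, j}` being present with probability `P i j`. -/
structure IsBernoulliNetwork {Ω : Type*} [MeasurableSpace Ω] (μ : Measure Ω) {n : ℕ}
    (P : Matrix (Fin n) (Fin n) ℝ) (A : Ω → Matrix (Fin n) (Fin n) ℝ) : Prop where
  measurable_entry : ∀ i j, Measurable fun ω => A ω i j
  symm : ∀ ω i j, A ω i j = A ω j i
  diag_eq_zero : ∀ ω i, A ω i i = 0
  binary : ∀ ω i j, A ω i j = 0 ∨ A ω i j = 1
  prob_edge : ∀ i j, i ≠ j → μ {ω | A ω i j = 1} = ENNReal.ofReal (P i j)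
  indep : iIndepFun (fun (e : {e : Fin n × Fin n // e.1 < e.2}) ω => A ω e.1.1 e.1.2) μ

/-- `Xhat = U_A S_A^{1/2}` is a `d`-dimensional adjacency spectral embedding of `A`: in some
singular value decomposition `A = U diag(σ) Vᵀ` with `σ` in descending order, `Xhat` consists of
the first `d` columns of `U`, each scaled by the square root of its singular value. -/
def IsASE {n d : ℕ} (A : Matrix (Fin n) (Fin n) ℝ) (Xhat : Matrix (Fin n) (Fin d) ℝ) : Prop :=
  ∃ (hd : d ≤ n) (U V : Matrix (Fin n) (Fin n) ℝ) (σ : Fin n → ℝ),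
    U ∈ Matrix.orthogonalGroup (Fin n) ℝ ∧ V ∈ Matrix.orthogonalGroup (Fin n) ℝ ∧
    (∀ k, 0 ≤ σ k) ∧ Antitone σ ∧ A = U * Matrix.diagonal σ * Vᵀ ∧
    ∀ i a, Xhat i a = U i (Fin.castLE hd a) * √(σ (Fin.castLE hd a))

/-- `Xhat` is an adjacency spectral embedding of `A` followed by an orthogonal transformation
of `ℝ^d` (a rotation, possibly with sign changes of the columns). -/
def IsRotatedASE {n d : ℕ} (A : Matrix (Fin n) (Fin n) ℝ) (Xhat : Matrix (Fin n) (Fin d) ℝ) :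
    Prop :=
  ∃ (X₀ : Matrix (Fin n) (Fin d) ℝ) (W : Matrix (Fin d) (Fin d) ℝ),
    IsASE A X₀ ∧ W ∈ Matrix.orthogonalGroup (Fin d) ℝ ∧ Xhat = X₀ * W

/-- Among all `Xhat * W` with `W` orthogonal, `Xhat` itself is closest to `X` in Frobenius norm. -/
def IsNearestRotation {n d : ℕ} (Xhat X : Matrix (Fin n) (Fin d) ℝ) : Prop :=
  ∀ W ∈ Matrix.orthogonalGroup (Fin d) ℝ,
    ∑ i, ∑ a, (Xhat i a - X i a) ^ 2 ≤ ∑ i, ∑ a, ((Xhat * W) i a - X i a) ^ 2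

/-- The second moment matrix `Mᵀ M / n` of the rows of `M`. -/
def secondMoment {n d : ℕ} (M : Matrix (Fin n) (Fin d) ℝ) : Matrix (Fin d) (Fin d) ℝ :=
  (n : ℝ)⁻¹ • (Mᵀ * M)

/-- `Zᵀ Z / n` is diagonal for all large `n`, with distinct diagonal elements whose
differences stay away from zero. -/
def HasSeparatedDiagonalGram {d : ℕ} (Z : ∀ n : ℕ, Matrix (Fin n) (Fin d) ℝ) : Prop :=
  ∃ c : ℝ, 0 < c ∧ ∀ᶠ n in atTop, (secondMoment (Z n)).IsDiag ∧
    ∀ a b, a ≠ b → c ≤ |secondMoment (Z n) a a - secondMoment (Z n) b b|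

/-- `Zhatᵀ Zhat` is diagonal, with diagonal elements arranged in the same order as those
of `Zᵀ Z`. -/
def HasMatchingDiagonalGram {n d : ℕ} (Zhat Z : Matrix (Fin n) (Fin d) ℝ) : Prop :=
  (secondMoment Zhat).IsDiag ∧
    ∀ a b, secondMoment Z a a < secondMoment Z b b →
      secondMoment Zhat a a ≤ secondMoment Zhat b b

/-- The row of `M` with (zero-based) index `i`, as a Euclidean vector; it is `0` when `M` has no
such row, which happens only for the finitely many `n ≤ i`. -/
def rowVec {n d : ℕ} (M : Matrix (Fin n) (Fin d) ℝ) (i : ℕ) : EuclideanSpace ℝ (Fin d) :=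
  if h : i < n then WithLp.toLp 2 (M ⟨i, h⟩) else 0

/-- `∑_{j ≠ i} (x_iᵀ x_j) (1 - x_iᵀ x_j) x_j x_jᵀ / n`, where `x_j` are the rows of `X`. -/
def scoreCov {n d : ℕ} (X : Matrix (Fin n) (Fin d) ℝ) (i : ℕ) : Matrix (Fin d) (Fin d) ℝ :=
  (n : ℝ)⁻¹ • ∑ j : Fin n, if (j : ℕ) = i then 0 else
    (inner ℝ (rowVec X i) (rowVec X j) * (1 - inner ℝ (rowVec X i) (rowVec X j))) •
      Matrix.vecMulVec (X j) (X j)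

end

/-! Write `A = X Xᵀ + E`, where `E` is the centered off-diagonal noise minus the diagonal of `P`.
For every `ε` there is a constant `b` such that, for large `n`, with probability at least `1 - ε`,
the norms of `E` and of its products with `X`, with the vector of ones and with a unit row vector
are bounded as in `IsTameNoise` and `IsTameRow`. Second moments and Markov's inequality suffice for
this (`IsSymmetricNoise.measure_not_tame_le`). On that event the argument is deterministic.

The top `d` singular vectors of `A` are then eigenvectors, so an embedding `Y` satisfies `A Y = Y G`
with `G = Yᵀ Y`. Hence `Y = X K + V` with `K = Xᵀ Y G⁻¹` and `V = E Y G⁻¹`. Substituting gives `V =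
E X K G⁻¹ + E V G⁻¹`, a contraction in `V`, so `V` is bounded although `Y` has norm of order `√n`.
If `Y` is the rotation nearest to `X`, then `Xᵀ Y` is symmetric and positive semidefinite; this
forces `Xᵀ Y - Yᵀ Y = O(1)` (`AlignedEmbedding.norm_cross_sub_gram`) and therefore `K = 1 + O(1/n)`.
Row `i` of `Y - X` thus equals row `i` of `E X (Xᵀ X)⁻¹` up to `O(1/n)`, and centering changes it
only by the mean of the rows of `Y - X`, again `O(1/n)`.

Under the second convention, `Y` differs from the aligned embedding by an orthogonal matrix `W`. The
centered second moment matrices of `X` and of the aligned embedding agree up to `O(1/n)`, so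
separated diagonal entries make `W` nearly diagonal, the order excludes permutations and the sign
convention excludes reflections. Thus `W = 1 + O(1/n)` and the same expansion holds
(`exists_norm_unitRow_centering_sub_expansion_le`).

Finally, `√n` times the leading term, projected on a fixed vector, is a sum of independent bounded
centered variables. Its characteristic function is compared factor by factor with a Gaussian one
(`tendsto_charFun_leadingTerm`), and Lévy's continuity theorem concludes. -/

set_option linter.unusedSectionVars false

/-! ### Bounds for the Euclidean operator norm. -/

section OperatorNorm

open scoped Matrix.Norms.L2Operator

variable {m n k : Type*} [Fintype m] [Fintype n] [Fintype k] [DecidableEq m] [DecidableEq n]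
  [DecidableEq k]

namespace Matrix

theorem norm_toLp_sq (v : n → ℝ) : ‖WithLp.toLp 2 v‖ ^ 2 = v ⬝ᵥ v := by
  rw [EuclideanSpace.norm_sq_eq, dotProduct]
  exact Finset.sum_congr rfl fun i _ => by rw [Real.norm_eq_abs, sq_abs, sq]

theorem dotProduct_self_nonneg' (v : n → ℝ) : 0 ≤ v ⬝ᵥ v := by
  rw [← norm_toLp_sq]; positivity

theorem dotProduct_self_pos {v : n → ℝ} (hv : v ≠ 0) : 0 < v ⬝ᵥ v :=
  lt_of_le_of_ne (dotProduct_self_nonneg' v) fun h => hv (dotProduct_self_eq_zero.1 h.symm)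

theorem l2_opNorm_transpose (M : Matrix m n ℝ) : ‖Mᵀ‖ = ‖M‖ := by
  rw [← conjTranspose_eq_transpose_of_trivial, l2_opNorm_conjTranspose]

theorem l2_opNorm_transpose_mul_self (M : Matrix m n ℝ) : ‖Mᵀ * M‖ = ‖M‖ ^ 2 := by
  rw [← conjTranspose_eq_transpose_of_trivial, l2_opNorm_conjTranspose_mul_self, sq]

theorem dotProduct_mulVec_self_le (M : Matrix m n ℝ) (v : n → ℝ) :
    (M *ᵥ v) ⬝ᵥ (M *ᵥ v) ≤ ‖M‖ ^ 2 * (v ⬝ᵥ v) := by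
  rw [← norm_toLp_sq, ← norm_toLp_sq, ← mul_pow]
  exact pow_le_pow_left₀ (norm_nonneg _) (l2_opNorm_mulVec M (WithLp.toLp 2 v)) 2

theorem l2_opNorm_le_of_dotProduct {M : Matrix m n ℝ} {C : ℝ} (hC : 0 ≤ C)
    (h : ∀ v, (M *ᵥ v) ⬝ᵥ (M *ᵥ v) ≤ C ^ 2 * (v ⬝ᵥ v)) : ‖M‖ ≤ C := by
  rw [l2_opNorm_def]
  refine ContinuousLinearMap.opNorm_le_bound _ hC fun x => ?_
  refine le_of_sq_le_sq ?_ (by positivity)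
  have := h x.ofLp
  rw [← norm_toLp_sq, ← norm_toLp_sq, ← mul_pow] at this
  exact this

theorem abs_dotProduct_mulVec_le (M : Matrix m n ℝ) (u : m → ℝ) (v : n → ℝ) :
    |u ⬝ᵥ M *ᵥ v| ≤ ‖WithLp.toLp 2 u‖ * (‖M‖ * ‖WithLp.toLp 2 v‖) := by
  have h := abs_real_inner_le_norm (WithLp.toLp 2 (M *ᵥ v)) (WithLp.toLp 2 u)
  rw [EuclideanSpace.inner_toLp_toLp] at h
  simp only [star_trivial] at h
  refine h.trans ?_
  rw [mul_comm]
  gcongr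
  exact l2_opNorm_mulVec M (WithLp.toLp 2 v)

theorem abs_dotProduct_mulVec_self_le (M : Matrix n n ℝ) (v : n → ℝ) :
    |v ⬝ᵥ M *ᵥ v| ≤ ‖M‖ * (v ⬝ᵥ v) := by
  refine (abs_dotProduct_mulVec_le M v v).trans_eq ?_
  rw [← norm_toLp_sq]; ring

theorem abs_entry_le_l2_opNorm (M : Matrix m n ℝ) (i : m) (j : n) : |M i j| ≤ ‖M‖ := by
  have h := abs_dotProduct_mulVec_le M (Pi.single i 1) (Pi.single j 1)
  simpa using h

theorem l2_opNorm_sq_le_sum_sq (M : Matrix m n ℝ) : ‖M‖ ^ 2 ≤ ∑ i, ∑ j, M i j ^ 2 := by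
  have h0 : 0 ≤ ∑ i, ∑ j, M i j ^ 2 := by positivity
  rw [← Real.sq_sqrt h0]
  refine pow_le_pow_left₀ (norm_nonneg _) (l2_opNorm_le_of_dotProduct (Real.sqrt_nonneg _) ?_) 2
  intro v
  rw [Real.sq_sqrt h0, Finset.sum_mul, dotProduct]
  refine Finset.sum_le_sum fun i _ => ?_
  rw [← sq, mulVec, dotProduct, dotProduct]
  refine (Finset.sum_mul_sq_le_sq_mul_sq _ _ _).trans_eq ?_
  simp only [sq]

theorem l2_opNorm_le_of_sum_sq_le {M : Matrix m n ℝ} {C : ℝ} (hC : 0 ≤ C)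
    (h : ∑ i, ∑ j, M i j ^ 2 ≤ C ^ 2) : ‖M‖ ≤ C :=
  le_of_sq_le_sq ((l2_opNorm_sq_le_sum_sq M).trans h) hC

theorem abs_trace_le (M : Matrix n n ℝ) : |M.trace| ≤ Fintype.card n * ‖M‖ := by
  rw [trace]
  refine (Finset.abs_sum_le_sum_abs _ _).trans ?_
  refine (Finset.sum_le_card_nsmul _ _ ‖M‖ fun i _ => abs_entry_le_l2_opNorm M i i).trans_eq ?_
  rw [nsmul_eq_mul, Finset.card_univ]

theorem l2_opNorm_le_one_of_mem_orthogonalGroup {W : Matrix n n ℝ}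
    (hW : W ∈ orthogonalGroup n ℝ) : ‖W‖ ≤ 1 := by
  refine l2_opNorm_le_of_dotProduct zero_le_one fun v => le_of_eq ?_
  rw [dotProduct_mulVec, vecMul_mulVec, ← dotProduct_mulVec]
  have : Wᵀ * W = 1 := by
    have := (mem_orthogonalGroup_iff' n ℝ).1 hW
    simpa [star_eq_conjTranspose] using this
  rw [this]; simp

theorem isUnit_det_of_coercive {M : Matrix n n ℝ} {c : ℝ} (hc : 0 < c)
    (h : ∀ v, c * (v ⬝ᵥ v) ≤ v ⬝ᵥ M *ᵥ v) : IsUnit M.det := by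
  rw [isUnit_iff_ne_zero]
  intro h0
  obtain ⟨v, hv, hMv⟩ := exists_mulVec_eq_zero_iff.2 h0
  have := h v
  rw [hMv, dotProduct_zero] at this
  have := dotProduct_self_pos hv
  nlinarith

theorem l2_opNorm_inv_le_of_coercive {M : Matrix n n ℝ} {c : ℝ} (hc : 0 < c)
    (h : ∀ v, c * (v ⬝ᵥ v) ≤ v ⬝ᵥ M *ᵥ v) : ‖M⁻¹‖ ≤ c⁻¹ := by
  refine l2_opNorm_le_of_dotProduct (by positivity) fun v => ?_
  set w := M⁻¹ *ᵥ v with hw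
  have hMw : M *ᵥ w = v := by
    rw [hw, mulVec_mulVec, mul_nonsing_inv _ (isUnit_det_of_coercive hc h), one_mulVec]
  have h1 := h w
  rw [hMw] at h1
  have h2 : w ⬝ᵥ v ≤ ‖WithLp.toLp 2 w‖ * ‖WithLp.toLp 2 v‖ := by
    have h := real_inner_le_norm (WithLp.toLp 2 v) (WithLp.toLp 2 w)
    rw [EuclideanSpace.inner_toLp_toLp] at h
    simp only [star_trivial] at h
    linarith
  rw [← norm_toLp_sq] at h1
  rw [← norm_toLp_sq, ← norm_toLp_sq, ← mul_pow]
  refine pow_le_pow_left₀ (norm_nonneg _) ?_ 2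
  rw [inv_mul_eq_div, le_div_iff₀ hc]
  rcases (norm_nonneg (WithLp.toLp 2 w)).eq_or_lt with h0 | h0
  · rw [← h0]; simp
  · refine le_of_mul_le_mul_left ?_ h0
    nlinarith

theorem l2_opNorm_mul_le_of_le {A : Matrix m n ℝ} {B : Matrix n k ℝ} {a b : ℝ}
    (hA : ‖A‖ ≤ a) (hB : ‖B‖ ≤ b) : ‖A * B‖ ≤ a * b :=
  (l2_opNorm_mul A B).trans (mul_le_mul hA hB (norm_nonneg _) ((norm_nonneg _).trans hA))

end Matrix

end OperatorNorm

/-! ### Spectral embeddings of perturbed low-rank matrices. -/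

section SpectralEmbedding

open scoped Matrix.Norms.L2Operator
open Matrix

variable {n d : ℕ} {X Y : Matrix (Fin n) (Fin d) ℝ} {A E U V : Matrix (Fin n) (Fin n) ℝ}
  {σ : Fin n → ℝ} {γ : ℝ}

theorem Matrix.transpose_mul_self_of_mem_orthogonalGroup {m : Type*} [Fintype m] [DecidableEq m]
    {W : Matrix m m ℝ} (hW : W ∈ orthogonalGroup m ℝ) : Wᵀ * W = 1 := by
  simpa [star_eq_conjTranspose] using (mem_orthogonalGroup_iff' m ℝ).1 hW

theorem Matrix.mul_transpose_self_of_mem_orthogonalGroup {m : Type*} [Fintype m] [DecidableEq m]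
    {W : Matrix m m ℝ} (hW : W ∈ orthogonalGroup m ℝ) : W * Wᵀ = 1 := by
  simpa [star_eq_conjTranspose] using (mem_orthogonalGroup_iff m ℝ).1 hW

theorem Matrix.mem_orthogonalGroup_of_transpose_mul {m : Type*} [Fintype m] [DecidableEq m]
    {W : Matrix m m ℝ} (hW : Wᵀ * W = 1) : W ∈ orthogonalGroup m ℝ := by
  rw [mem_orthogonalGroup_iff']
  simpa [star_eq_conjTranspose] using hW

theorem Matrix.dotProduct_mulVec_mulVec {m n : Type*} [Fintype m] [Fintype n]
    (M N : Matrix m n ℝ) (u v : n → ℝ) : (M *ᵥ u) ⬝ᵥ (N *ᵥ v) = u ⬝ᵥ (Mᵀ * N) *ᵥ v := by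
  rw [dotProduct_mulVec, vecMul_mulVec, ← dotProduct_mulVec]

theorem Matrix.dotProduct_mulVec_orthogonal {m : Type*} [Fintype m] [DecidableEq m]
    {W : Matrix m m ℝ} (hW : W ∈ orthogonalGroup m ℝ) (v : m → ℝ) :
    (W *ᵥ v) ⬝ᵥ (W *ᵥ v) = v ⬝ᵥ v := by
  rw [dotProduct_mulVec_mulVec, transpose_mul_self_of_mem_orthogonalGroup hW, one_mulVec]

/-- The top `d` singular values of a small perturbation of `X * Xᵀ` are bounded below. -/
theorem le_singularValue_of_factor (hγ : 0 < γ)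
    (hX : ∀ v, γ * (v ⬝ᵥ v) ≤ (X *ᵥ v) ⬝ᵥ (X *ᵥ v)) (hE : ‖E‖ ≤ γ / 4)
    (hA : A = X * Xᵀ + E) (hAs : Aᵀ = A) (hU : U ∈ orthogonalGroup (Fin n) ℝ)
    (hV : V ∈ orthogonalGroup (Fin n) ℝ) (hσ : ∀ k, 0 ≤ σ k) (hmono : Antitone σ)
    (hsvd : A = U * diagonal σ * Vᵀ) (k : Fin n) (hk : (k : ℕ) < d) : 3 * γ / 4 ≤ σ k := by
  -- Since `k < d`, some nonzero `y` makes `X y` orthogonal to the `k` left singular vectors that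
  -- precede the one with index `k`; on such vectors `A` has norm at most `σ k`.
  let T : (Fin d → ℝ) →ₗ[ℝ] (Fin (k : ℕ) → ℝ) :=
    (LinearMap.funLeft ℝ ℝ (Fin.castLE k.2.le)).comp (Matrix.mulVecLin (Uᵀ * X))
  obtain ⟨y, hyT, hy⟩ : ∃ y, T y = 0 ∧ y ≠ 0 := by
    have := LinearMap.ker_ne_bot_of_finrank_lt (f := T) (by simpa using hk)
    obtain ⟨y, hy, hy0⟩ := Submodule.exists_mem_ne_zero_of_ne_bot this
    exact ⟨y, hy, hy0⟩
  set w := X *ᵥ y with hw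
  have hyy := dotProduct_self_pos hy
  have hww : 0 < w ⬝ᵥ w := lt_of_lt_of_le (by positivity) (hX y)
  have hUw : ∀ l, l < k → (Uᵀ *ᵥ w) l = 0 := by
    intro l hl
    have := congrFun hyT ⟨l, hl⟩
    rw [hw, mulVec_mulVec]
    exact this
  have hAw : (A *ᵥ w) ⬝ᵥ (A *ᵥ w) ≤ σ k ^ 2 * (w ⬝ᵥ w) := by
    have h1 : A *ᵥ w = V *ᵥ (diagonal σ *ᵥ (Uᵀ *ᵥ w)) := by
      have h0 : A = V * diagonal σ * Uᵀ := by
        rw [← hAs, hsvd]; simp [transpose_mul, Matrix.mul_assoc]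
      rw [h0, ← mulVec_mulVec, ← mulVec_mulVec]
    have hUt : Uᵀ ∈ orthogonalGroup (Fin n) ℝ :=
      mem_orthogonalGroup_of_transpose_mul
        (by rw [transpose_transpose, mul_transpose_self_of_mem_orthogonalGroup hU])
    rw [h1, dotProduct_mulVec_orthogonal hV, ← dotProduct_mulVec_orthogonal hUt w, dotProduct,
      dotProduct, Finset.mul_sum]
    refine Finset.sum_le_sum fun l _ => ?_
    rw [mulVec_diagonal]
    rcases lt_or_ge l k with hl | hl
    · rw [hUw l hl]; simp
    · have := hmono hl
      have h2 : σ l ^ 2 ≤ σ k ^ 2 := pow_le_pow_left₀ (hσ l) this 2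
      nlinarith [mul_self_nonneg ((Uᵀ *ᵥ w) l)]
  -- `X * Xᵀ` is bounded below by `γ` on the range of `X`: combine `|w|² = ⟨y, Xᵀ w⟩ ≤ |y| |Xᵀ w|`
  -- with `γ |y|² ≤ |w|²`.
  have hXw : γ * (w ⬝ᵥ w) ≤ (Xᵀ *ᵥ w) ⬝ᵥ (Xᵀ *ᵥ w) := by
    have h1 : w ⬝ᵥ w = y ⬝ᵥ Xᵀ *ᵥ w := by
      rw [hw, dotProduct_mulVec_mulVec, mulVec_mulVec]
    have h2 : (w ⬝ᵥ w) ^ 2 ≤ (y ⬝ᵥ y) * ((Xᵀ *ᵥ w) ⬝ᵥ (Xᵀ *ᵥ w)) := by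
      conv_lhs => rw [h1]
      simp only [dotProduct, ← sq]
      exact Finset.sum_mul_sq_le_sq_mul_sq _ _ _
    have h3 := hX y
    rw [← hw] at h3
    have h4 := dotProduct_self_nonneg' (Xᵀ *ᵥ w)
    refine le_of_mul_le_mul_left ?_ hyy
    nlinarith
  have hquad : 3 * γ / 4 * (w ⬝ᵥ w) ≤ w ⬝ᵥ A *ᵥ w := by
    have h1 : w ⬝ᵥ A *ᵥ w = (Xᵀ *ᵥ w) ⬝ᵥ (Xᵀ *ᵥ w) + w ⬝ᵥ E *ᵥ w := by
      rw [hA, add_mulVec, dotProduct_add, dotProduct_mulVec_mulVec, transpose_transpose]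
    have h2 := (abs_le.1 (abs_dotProduct_mulVec_self_le E w)).1
    nlinarith
  have hcs : (w ⬝ᵥ A *ᵥ w) ^ 2 ≤ (w ⬝ᵥ w) * ((A *ᵥ w) ⬝ᵥ (A *ᵥ w)) := by
    simp only [dotProduct, ← sq]
    exact Finset.sum_mul_sq_le_sq_mul_sq _ _ _
  have hsq : (3 * γ / 4) ^ 2 ≤ σ k ^ 2 := by
    have h1 : (3 * γ / 4 * (w ⬝ᵥ w)) ^ 2 ≤ (w ⬝ᵥ A *ᵥ w) ^ 2 :=
      pow_le_pow_left₀ (by positivity) hquad 2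
    have h2 : (w ⬝ᵥ w) * ((A *ᵥ w) ⬝ᵥ (A *ᵥ w)) ≤ (w ⬝ᵥ w) * (σ k ^ 2 * (w ⬝ᵥ w)) :=
      mul_le_mul_of_nonneg_left hAw hww.le
    have h3 : (w ⬝ᵥ w) ^ 2 * (3 * γ / 4) ^ 2 ≤ (w ⬝ᵥ w) ^ 2 * σ k ^ 2 := by nlinarith
    exact le_of_mul_le_mul_left h3 (by positivity)
  exact le_of_sq_le_sq hsq (hσ k)

/-- The top `d` left singular vectors of a small perturbation of `X * Xᵀ` are eigenvectors. -/
theorem mulVec_singularVector (hγ : 0 < γ)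
    (hX : ∀ v, γ * (v ⬝ᵥ v) ≤ (X *ᵥ v) ⬝ᵥ (X *ᵥ v)) (hE : ‖E‖ ≤ γ / 4)
    (hA : A = X * Xᵀ + E) (hAs : Aᵀ = A) (hU : U ∈ orthogonalGroup (Fin n) ℝ)
    (hV : V ∈ orthogonalGroup (Fin n) ℝ) (hσ : ∀ k, 0 ≤ σ k) (hmono : Antitone σ)
    (hsvd : A = U * diagonal σ * Vᵀ) (k : Fin n) (hk : (k : ℕ) < d) :
    A *ᵥ (fun i => U i k) = σ k • fun i => U i k := by
  have hσk := le_singularValue_of_factor hγ hX hE hA hAs hU hV hσ hmono hsvd k hk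
  set u : Fin n → ℝ := fun i => U i k with hu
  have hAA : A * A * U = U * diagonal (fun l => σ l ^ 2) := by
    have h1 : A = V * diagonal σ * Uᵀ := by
      rw [← hAs, hsvd]; simp [transpose_mul, Matrix.mul_assoc]
    calc A * A * U = (U * diagonal σ * Vᵀ) * (V * diagonal σ * Uᵀ) * U := by
          rw [← h1, ← hsvd]
      _ = U * diagonal σ * (Vᵀ * V) * diagonal σ * (Uᵀ * U) := by simp only [Matrix.mul_assoc]
      _ = U * diagonal (fun l => σ l ^ 2) := by
          rw [transpose_mul_self_of_mem_orthogonalGroup hV,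
            transpose_mul_self_of_mem_orthogonalGroup hU, Matrix.mul_one, Matrix.mul_one,
            Matrix.mul_assoc, diagonal_mul_diagonal]
          simp only [sq]
  have hAAu : A *ᵥ (A *ᵥ u) = σ k ^ 2 • u := by
    rw [mulVec_mulVec]
    ext i
    have := congrFun (congrFun hAA i) k
    rw [mul_diagonal, mul_apply] at this
    rw [mulVec, dotProduct, Pi.smul_apply, smul_eq_mul, hu, this, mul_comm]
  -- This `w` satisfies `A w = -σ k w`. It must vanish, because the quadratic form of `A` is at
  -- least `-γ / 4` while `σ k ≥ 3 * γ / 4`.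
  set w := A *ᵥ u - σ k • u with hw
  have hAw : A *ᵥ w = -σ k • w := by
    rw [hw, mulVec_sub, mulVec_smul, hAAu, smul_sub, smul_smul, neg_smul, neg_mul, neg_smul, ← sq]
    abel
  have h1 : w ⬝ᵥ A *ᵥ w = (Xᵀ *ᵥ w) ⬝ᵥ (Xᵀ *ᵥ w) + w ⬝ᵥ E *ᵥ w := by
    rw [hA, add_mulVec, dotProduct_add, dotProduct_mulVec_mulVec, transpose_transpose]
  have h2 := (abs_le.1 (abs_dotProduct_mulVec_self_le E w)).1
  rw [hAw, dotProduct_smul, smul_eq_mul] at h1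
  have h3 := dotProduct_self_nonneg' (Xᵀ *ᵥ w)
  have h4 : w = 0 := by
    by_contra h
    have := dotProduct_self_pos h
    nlinarith
  exact sub_eq_zero.1 h4

/-- An adjacency spectral embedding of a small perturbation of `X * Xᵀ` spans an invariant
subspace, on which the matrix is well conditioned. -/
theorem IsRotatedASE.mul_eq_and_coercive (hγ : 0 < γ)
    (hX : ∀ v, γ * (v ⬝ᵥ v) ≤ (X *ᵥ v) ⬝ᵥ (X *ᵥ v)) (hE : ‖E‖ ≤ γ / 4)
    (hA : A = X * Xᵀ + E) (hAs : Aᵀ = A) (hY : IsRotatedASE A Y) :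
    A * Y = Y * (Yᵀ * Y) ∧ ∀ v, 3 * γ / 4 * (v ⬝ᵥ v) ≤ v ⬝ᵥ (Yᵀ * Y) *ᵥ v := by
  obtain ⟨Y₀, W, ⟨hd, U, V, σ, hU, hV, hσ, hmono, hsvd, hY₀⟩, hW, rfl⟩ := hY
  set τ : Fin d → ℝ := fun a => σ (Fin.castLE hd a) with hτ
  have hgram : Y₀ᵀ * Y₀ = diagonal τ := by
    ext a b
    have h := congrFun (congrFun (transpose_mul_self_of_mem_orthogonalGroup hU)
      (Fin.castLE hd a)) (Fin.castLE hd b)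
    rw [mul_apply] at h
    simp only [transpose_apply, one_apply, Fin.castLE_inj] at h
    rw [mul_apply, diagonal_apply]
    simp only [transpose_apply, hY₀]
    calc ∑ j, U j (Fin.castLE hd a) * √(σ (Fin.castLE hd a)) *
          (U j (Fin.castLE hd b) * √(σ (Fin.castLE hd b)))
        = (∑ j, U j (Fin.castLE hd a) * U j (Fin.castLE hd b)) *
          (√(σ (Fin.castLE hd a)) * √(σ (Fin.castLE hd b))) := by
          rw [Finset.sum_mul]; exact Finset.sum_congr rfl fun j _ => by ring
      _ = _ := by
          rw [h]
          split_ifs with hab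
          · subst hab
            rw [one_mul, Real.mul_self_sqrt (hσ _)]
          · simp
  have hAY₀ : A * Y₀ = Y₀ * diagonal τ := by
    ext i a
    have h := congrFun (mulVec_singularVector hγ hX hE hA hAs hU hV hσ hmono hsvd
      (Fin.castLE hd a) a.2) i
    rw [mulVec, dotProduct, Pi.smul_apply, smul_eq_mul] at h
    rw [mul_apply, mul_diagonal]
    simp only [hY₀, ← mul_assoc]
    rw [← Finset.sum_mul, h]
    ring
  have hWW := mul_transpose_self_of_mem_orthogonalGroup hW
  constructor
  · calc A * (Y₀ * W) = Y₀ * (Y₀ᵀ * Y₀) * W := by rw [← Matrix.mul_assoc, hAY₀, hgram]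
      _ = Y₀ * (W * Wᵀ) * (Y₀ᵀ * Y₀) * W := by rw [hWW, Matrix.mul_one]
      _ = _ := by simp only [transpose_mul, Matrix.mul_assoc]
  · intro v
    have h : v ⬝ᵥ ((Y₀ * W)ᵀ * (Y₀ * W)) *ᵥ v = (W *ᵥ v) ⬝ᵥ (diagonal τ *ᵥ (W *ᵥ v)) := by
      rw [← hgram, ← dotProduct_mulVec_mulVec, ← dotProduct_mulVec_mulVec]
      simp only [mulVec_mulVec]
    rw [h, ← dotProduct_mulVec_orthogonal hW v, dotProduct, dotProduct, Finset.mul_sum]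
    refine Finset.sum_le_sum fun a _ => ?_
    rw [mulVec_diagonal]
    have := le_singularValue_of_factor hγ hX hE hA hAs hU hV hσ hmono hsvd
      (Fin.castLE hd a) a.2
    nlinarith [mul_self_nonneg ((W *ᵥ v) a)]

/-- With `G = Yᵀ Y` of norm `‖Y‖ ^ 2`, the equation gives `G² = Yᵀ A Y`, hence `‖Y‖ ^ 4 ≤ ‖A‖ * ‖Y‖
^ 2`. -/
theorem norm_sq_le_of_mul_eq (h : A * Y = Y * (Yᵀ * Y)) : ‖Y‖ ^ 2 ≤ ‖A‖ := by
  rcases (norm_nonneg Y).eq_or_lt with h0 | h0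
  · rw [← h0]; simp
  have h1 : ‖Yᵀ * Y‖ ^ 2 = ‖Yᵀ * (A * Y)‖ := by
    rw [h, ← Matrix.mul_assoc, ← l2_opNorm_transpose_mul_self]
    simp
  have h2 : ‖Yᵀ * (A * Y)‖ ≤ ‖Y‖ * (‖A‖ * ‖Y‖) :=
    l2_opNorm_mul_le_of_le (l2_opNorm_transpose Y).le (l2_opNorm_mul _ _)
  rw [l2_opNorm_transpose_mul_self] at h1
  refine le_of_mul_le_mul_left ?_ (pow_pos h0 2)
  nlinarith

end SpectralEmbedding

/-! ### Nearest rotations and the symmetry of the cross moment matrix. -/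

section Procrustes

open scoped Matrix.Norms.L2Operator
open Matrix

variable {n d : ℕ} {X Y : Matrix (Fin n) (Fin d) ℝ}

theorem Matrix.sum_sq_eq_trace {m k : Type*} [Fintype m] [Fintype k] (M : Matrix m k ℝ) :
    ∑ i, ∑ a, M i a ^ 2 = (Mᵀ * M).trace := by
  rw [Finset.sum_comm]
  simp [trace, mul_apply, sq]

/-- Orthogonal factors preserve the Frobenius norm of `Y`, so only the cross term of the squared
distance depends on `W`. -/
theorem isNearestRotation_iff_trace :
    IsNearestRotation Y X ↔ ∀ W ∈ orthogonalGroup (Fin d) ℝ,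
      (Xᵀ * Y * W).trace ≤ (Xᵀ * Y).trace := by
  refine forall₂_congr fun W hW => ?_
  have key : ∀ M : Matrix (Fin n) (Fin d) ℝ, ∑ i, ∑ a, (M i a - X i a) ^ 2 =
      (Mᵀ * M).trace - 2 * (Xᵀ * M).trace + (Xᵀ * X).trace := by
    intro M
    have h1 := sum_sq_eq_trace (M - X)
    simp only [Matrix.sub_apply] at h1
    have h2 : (Mᵀ * X).trace = (Xᵀ * M).trace := by
      rw [← trace_transpose, transpose_mul, transpose_transpose]
    rw [h1, transpose_sub, Matrix.sub_mul, Matrix.mul_sub, Matrix.mul_sub, trace_sub, trace_sub,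
      trace_sub, h2]
    ring
  have h3 : ((Y * W)ᵀ * (Y * W)).trace = (Yᵀ * Y).trace := by
    calc ((Y * W)ᵀ * (Y * W)).trace = (Wᵀ * (Yᵀ * Y * W)).trace := by
          simp only [transpose_mul, Matrix.mul_assoc]
      _ = (Yᵀ * Y * (W * Wᵀ)).trace := by rw [trace_mul_comm, Matrix.mul_assoc]
      _ = _ := by rw [mul_transpose_self_of_mem_orthogonalGroup hW, Matrix.mul_one]
  rw [key, key, h3, ← Matrix.mul_assoc]
  constructor <;> intro h <;> linarith

/-- The reflection along `v`. -/
noncomputable def Matrix.reflectionMatrix {m : Type*} [Fintype m] [DecidableEq m] (v : m → ℝ) :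
    Matrix m m ℝ :=
  1 - (2 / (v ⬝ᵥ v)) • vecMulVec v v

theorem Matrix.reflectionMatrix_mem_orthogonalGroup {m : Type*} [Fintype m] [DecidableEq m]
    {v : m → ℝ} (hv : v ≠ 0) : reflectionMatrix v ∈ orthogonalGroup m ℝ := by
  apply mem_orthogonalGroup_of_transpose_mul
  have h := (dotProduct_self_pos hv).ne'
  have ht : (reflectionMatrix v)ᵀ = reflectionMatrix v := by
    rw [reflectionMatrix, transpose_sub, transpose_one, transpose_smul, transpose_vecMulVec]
  have hvv : vecMulVec v v * vecMulVec v v = (v ⬝ᵥ v) • vecMulVec v v := by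
    ext i j
    simp [vecMulVec_mul_vecMulVec, vecMulVec_apply]; ring
  rw [ht, reflectionMatrix, Matrix.sub_mul, Matrix.mul_sub, Matrix.mul_sub, Matrix.one_mul,
    Matrix.one_mul, Matrix.mul_one, Matrix.smul_mul, Matrix.mul_smul, hvv, smul_smul, smul_smul]
  have : 2 / (v ⬝ᵥ v) * (2 / (v ⬝ᵥ v)) * (v ⬝ᵥ v) = 2 / (v ⬝ᵥ v) + 2 / (v ⬝ᵥ v) := by
    field_simp; norm_num
  rw [this, add_smul]
  abel

theorem Matrix.trace_mul_vecMulVec' {m : Type*} [Fintype m] (H : Matrix m m ℝ) (u v : m → ℝ) :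
    (H * vecMulVec u v).trace = v ⬝ᵥ H *ᵥ u := by
  rw [mul_vecMulVec, trace_vecMulVec, dotProduct_comm]

/-- A matrix whose trace cannot be increased by an orthogonal factor is symmetric and positive
semidefinite. -/
theorem Matrix.posSemidef_of_trace_mul_le {m : Type*} [Fintype m] [DecidableEq m]
    {H : Matrix m m ℝ} (h : ∀ W ∈ orthogonalGroup m ℝ, (H * W).trace ≤ H.trace) :
    H.PosSemidef := by
  have hquad : ∀ v, 0 ≤ v ⬝ᵥ H *ᵥ v := by
    intro v
    by_cases hv : v = 0
    · simp [hv]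
    -- Multiplying by the reflection along `v` lowers the trace by `2 vᵀ H v / |v|²`.
    have h1 := h _ (reflectionMatrix_mem_orthogonalGroup hv)
    have hvv := dotProduct_self_pos hv
    rw [reflectionMatrix, Matrix.mul_sub, Matrix.mul_one, Matrix.mul_smul, trace_sub, trace_smul,
      trace_mul_vecMulVec', smul_eq_mul] at h1
    have h2 : 0 ≤ 2 / (v ⬝ᵥ v) * (v ⬝ᵥ H *ᵥ v) := by linarith
    exact nonneg_of_mul_nonneg_right h2 (by positivity)
  -- The product of the reflections along `e_a` and `e_a + t e_b` is a rotation of the coordinate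
  -- plane of `a` and `b`. To first order in `t`, the change of the trace is the antisymmetric part
  -- of `H`.
  have hle : ∀ a b, a ≠ b → ∀ t : ℝ, t * (H a b - H b a) ≤ t ^ 2 * (H a a + H b b) := by
    intro a b hab t
    set u : m → ℝ := Pi.single a 1 with hu
    set v : m → ℝ := Pi.single a 1 + t • Pi.single b 1 with hv
    have huu : u ⬝ᵥ u = 1 := by simp [hu]
    have hvv : v ⬝ᵥ v = 1 + t ^ 2 := by
      simp [hv, hab, hab.symm]; ring
    have huv : u ⬝ᵥ v = 1 := by simp [hu, hv, hab.symm]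
    have hu0 : u ≠ 0 := by intro h0; rw [h0] at huu; simp at huu
    have hv0 : v ≠ 0 := by intro h0; rw [h0] at huv; simp at huv
    have h1 := h _ (mul_mem (reflectionMatrix_mem_orthogonalGroup hv0)
      (reflectionMatrix_mem_orthogonalGroup hu0))
    have h2 : v ⬝ᵥ H *ᵥ v = H a a + t * H a b + t * H b a + t ^ 2 * H b b := by
      simp [hv, mulVec_add, mulVec_smul, dotProduct_add, add_dotProduct]; ring
    have h3 : u ⬝ᵥ H *ᵥ u = H a a := by simp [hu]
    have h4 : u ⬝ᵥ H *ᵥ v = H a a + t * H a b := by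
      simp [hu, hv, mulVec_add, mulVec_smul, dotProduct_add]
    have h5 : H * (reflectionMatrix v * reflectionMatrix u) = H - (2 / (v ⬝ᵥ v)) •
        (H * vecMulVec v v) - (2 / (u ⬝ᵥ u)) • (H * vecMulVec u u) +
        (2 / (u ⬝ᵥ u) * (2 / (v ⬝ᵥ v) * (v ⬝ᵥ u))) • (H * vecMulVec v u) := by
      have h6 : vecMulVec v v * vecMulVec u u = (v ⬝ᵥ u) • vecMulVec v u := by
        ext i j
        simp [vecMulVec_mul_vecMulVec, vecMulVec_apply]; ring
      rw [reflectionMatrix, reflectionMatrix, Matrix.sub_mul, Matrix.mul_sub, Matrix.mul_sub,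
        Matrix.one_mul]
      simp only [Matrix.mul_sub, Matrix.mul_one, Matrix.one_mul, Matrix.smul_mul, Matrix.mul_smul,
        h6, smul_smul]
      abel
    rw [h5, trace_add, trace_sub, trace_sub, trace_smul, trace_smul, trace_smul,
      trace_mul_vecMulVec', trace_mul_vecMulVec', trace_mul_vecMulVec', h2, h3, h4, huu, hvv,
      dotProduct_comm v u, huv] at h1
    simp only [smul_eq_mul, div_one, mul_one] at h1
    have ht : 0 < 1 + t ^ 2 := by positivity
    have h7 : 0 ≤ (2 / (1 + t ^ 2) * (H a a + t * H a b + t * H b a + t ^ 2 * H b b) +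
        2 * H a a - 2 * (2 / (1 + t ^ 2)) * (H a a + t * H a b)) * (1 + t ^ 2) :=
      mul_nonneg (by linarith) ht.le
    have h8 : (2 / (1 + t ^ 2) * (H a a + t * H a b + t * H b a + t ^ 2 * H b b) +
        2 * H a a - 2 * (2 / (1 + t ^ 2)) * (H a a + t * H a b)) * (1 + t ^ 2) =
        2 * (t ^ 2 * (H a a + H b b) - t * (H a b - H b a)) := by
      field_simp; ring
    linarith
  refine PosSemidef.of_dotProduct_mulVec_nonneg ?_ fun v => by simpa using hquad v
  have hle' : ∀ a b, a ≠ b → H a b ≤ H b a := by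
    intro a b hab
    by_contra! hlt
    set δ := H a b - H b a
    have hδ : 0 < δ := sub_pos.2 hlt
    set s := |H a a + H b b| + 1
    have hs : 0 < s := by positivity
    -- A value of `t` so small that the linear term beats the quadratic one.
    have h1 := hle a b hab (δ / s)
    have h2 : (δ / s) ^ 2 * (H a a + H b b) < (δ / s) ^ 2 * s := by
      gcongr
      exact (le_abs_self _).trans_lt (lt_add_one _)
    have h3 : (δ / s) ^ 2 * s = δ / s * δ := by field_simp
    linarith
  ext a b
  rw [conjTranspose_apply, star_trivial]
  by_cases hab : a = b
  · rw [hab]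
  · exact le_antisymm (hle' _ _ (Ne.symm hab)) (hle' _ _ hab)

theorem IsNearestRotation.posSemidef (h : IsNearestRotation Y X) : (Xᵀ * Y).PosSemidef :=
  posSemidef_of_trace_mul_le (isNearestRotation_iff_trace.1 h)

/-- The orthogonal group is compact. Under the second identifiability convention this supplies the
aligned embedding with which the given one is compared. -/
theorem exists_isNearestRotation (X Y : Matrix (Fin n) (Fin d) ℝ) :
    ∃ W ∈ orthogonalGroup (Fin d) ℝ, IsNearestRotation (Y * W) X := by
  have hcompact : IsCompact {W : Matrix (Fin d) (Fin d) ℝ | Wᵀ * W = 1} := by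
    refine Metric.isCompact_of_isClosed_isBounded ?_ ?_
    · exact isClosed_eq (by fun_prop) continuous_const
    · refine (Metric.isBounded_closedBall (x := 0) (r := 1)).subset fun W hW => ?_
      rw [mem_closedBall_zero_iff]
      exact l2_opNorm_le_one_of_mem_orthogonalGroup (mem_orthogonalGroup_of_transpose_mul hW)
  obtain ⟨W, hW, hmax⟩ := hcompact.exists_isMaxOn ⟨1, by simp⟩
    (f := fun W => (Xᵀ * Y * W).trace) (Continuous.continuousOn (by fun_prop))
  have hW' := mem_orthogonalGroup_of_transpose_mul hW
  refine ⟨W, hW', isNearestRotation_iff_trace.2 fun W' h' => ?_⟩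
  have := hmax (transpose_mul_self_of_mem_orthogonalGroup (mul_mem hW' h'))
  simpa only [Set.mem_ofPred_eq, Matrix.mul_assoc] using this

theorem IsRotatedASE.mul_orthogonal {A : Matrix (Fin n) (Fin n) ℝ} (h : IsRotatedASE A Y)
    {W : Matrix (Fin d) (Fin d) ℝ} (hW : W ∈ orthogonalGroup (Fin d) ℝ) :
    IsRotatedASE A (Y * W) := by
  obtain ⟨X₀, W₀, h₀, hW₀, rfl⟩ := h
  exact ⟨X₀, W₀ * W, h₀, mul_mem hW₀ hW, Matrix.mul_assoc _ _ _⟩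

end Procrustes

/-! ### Deterministic first-order expansion of an aligned embedding. -/

section Perturbation

open scoped Matrix.Norms.L2Operator
open Matrix

/-- `Y` is a spectral embedding of `X * Xᵀ + E`, aligned with `X`, where the factor `X` is well
conditioned and the noise `E` acts on it as independent centered noise does. -/
structure AlignedEmbedding {n d : ℕ} (b : ℝ) (X : Matrix (Fin n) (Fin d) ℝ)
    (E : Matrix (Fin n) (Fin n) ℝ) (Y : Matrix (Fin n) (Fin d) ℝ) : Prop where
  one_le : 1 ≤ b
  card_le : (d : ℝ) ≤ b
  pos : 0 < n
  coercive : ∀ v, n / b * (v ⬝ᵥ v) ≤ (X *ᵥ v) ⬝ᵥ (X *ᵥ v)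
  norm_factor_sq : ‖X‖ ^ 2 ≤ n
  norm_noise : ‖E‖ ≤ n / b / 4
  norm_noise_mul : ‖E * X‖ ≤ b * n
  norm_mul_noise_mul : ‖Xᵀ * (E * X)‖ ≤ b * n
  noise_symm : Eᵀ = E
  isRotatedASE : IsRotatedASE (X * Xᵀ + E) Y
  aligned : (Xᵀ * Y).PosSemidef

/-- The coefficient `K` of `X` in the decomposition `Y = X K + V`. -/
noncomputable def signalCoeff {n d : ℕ} (X Y : Matrix (Fin n) (Fin d) ℝ) :
    Matrix (Fin d) (Fin d) ℝ :=
  Xᵀ * Y * (Yᵀ * Y)⁻¹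

/-- The noise part `V` in the decomposition `Y = X K + V`. -/
noncomputable def noisePart {n d : ℕ} (E : Matrix (Fin n) (Fin n) ℝ)
    (Y : Matrix (Fin n) (Fin d) ℝ) : Matrix (Fin n) (Fin d) ℝ :=
  E * Y * (Yᵀ * Y)⁻¹

namespace AlignedEmbedding

variable {n d : ℕ} {b : ℝ} {X Y : Matrix (Fin n) (Fin d) ℝ} {E : Matrix (Fin n) (Fin n) ℝ}
  {m : Type*} [Fintype m] [DecidableEq m]

local notation "K" => signalCoeff X Y
local notation "V" => noisePart E Y
local notation "G" => Yᵀ * Y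
local notation "S" => Xᵀ * X

theorem cast_pos (h : AlignedEmbedding b X E Y) : (0 : ℝ) < n := Nat.cast_pos.2 h.pos

theorem one_le_cast (h : AlignedEmbedding b X E Y) : (1 : ℝ) ≤ n := Nat.one_le_cast.2 h.pos

theorem b_pos (h : AlignedEmbedding b X E Y) : 0 < b := zero_lt_one.trans_le h.one_le

theorem sqrt_pos (h : AlignedEmbedding b X E Y) : 0 < √(n : ℝ) := Real.sqrt_pos.2 h.cast_pos

theorem sqrt_mul_sqrt (h : AlignedEmbedding b X E Y) : √(n : ℝ) * √(n : ℝ) = n :=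
  Real.mul_self_sqrt h.cast_pos.le

theorem one_le_sqrt (h : AlignedEmbedding b X E Y) : 1 ≤ √(n : ℝ) :=
  Real.one_le_sqrt.2 h.one_le_cast

theorem pow_le (h : AlignedEmbedding b X E Y) {i j : ℕ} (hij : i ≤ j) : b ^ i ≤ b ^ j :=
  pow_le_pow_right₀ h.one_le hij

theorem eigen (h : AlignedEmbedding b X E Y) : (X * Xᵀ + E) * Y = Y * G ∧
    ∀ v, 3 * (n / b) / 4 * (v ⬝ᵥ v) ≤ v ⬝ᵥ G *ᵥ v := by
  refine h.isRotatedASE.mul_eq_and_coercive (div_pos h.cast_pos h.b_pos) h.coercive h.norm_noise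
    rfl ?_
  rw [transpose_add, transpose_mul, transpose_transpose, h.noise_symm]

theorem coercive_gram (h : AlignedEmbedding b X E Y) (v : Fin d → ℝ) :
    n / (2 * b) * (v ⬝ᵥ v) ≤ v ⬝ᵥ G *ᵥ v := by
  refine le_trans ?_ (h.eigen.2 v)
  refine mul_le_mul_of_nonneg_right ?_ (dotProduct_self_nonneg' v)
  have := div_pos h.cast_pos h.b_pos
  have h2 : (n : ℝ) / (2 * b) = n / b / 2 := by rw [mul_comm, div_div]
  rw [h2]; linarith

theorem isUnit_gram (h : AlignedEmbedding b X E Y) : IsUnit (G).det :=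
  isUnit_det_of_coercive (div_pos h.cast_pos (mul_pos two_pos h.b_pos)) h.coercive_gram

theorem norm_gram_inv (h : AlignedEmbedding b X E Y) : ‖(G)⁻¹‖ ≤ 2 * b / n := by
  refine (l2_opNorm_inv_le_of_coercive (div_pos h.cast_pos (mul_pos two_pos h.b_pos))
    h.coercive_gram).trans_eq ?_
  rw [inv_div]

theorem coercive' (h : AlignedEmbedding b X E Y) (v : Fin d → ℝ) :
    n / b * (v ⬝ᵥ v) ≤ v ⬝ᵥ S *ᵥ v := by
  rw [← dotProduct_mulVec_mulVec]; exact h.coercive v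

theorem isUnit_factor (h : AlignedEmbedding b X E Y) : IsUnit (S).det :=
  isUnit_det_of_coercive (div_pos h.cast_pos h.b_pos) h.coercive'

theorem norm_factor_inv (h : AlignedEmbedding b X E Y) : ‖(S)⁻¹‖ ≤ b / n := by
  refine (l2_opNorm_inv_le_of_coercive (div_pos h.cast_pos h.b_pos) h.coercive').trans_eq ?_
  rw [inv_div]

theorem norm_factor (h : AlignedEmbedding b X E Y) : ‖X‖ ≤ √n :=
  Real.le_sqrt_of_sq_le h.norm_factor_sq

theorem norm_embedding_sq (h : AlignedEmbedding b X E Y) : ‖Y‖ ^ 2 ≤ 2 * n := by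
  refine (norm_sq_le_of_mul_eq h.eigen.1).trans ((norm_add_le _ _).trans ?_)
  have h1 : ‖X * Xᵀ‖ ≤ n := by
    refine (l2_opNorm_mul _ _).trans ?_
    rw [l2_opNorm_transpose, ← sq]; exact h.norm_factor_sq
  have h2 : (n : ℝ) / b ≤ n := div_le_self h.cast_pos.le h.one_le
  linarith [h.norm_noise, h.cast_pos]

theorem norm_embedding (h : AlignedEmbedding b X E Y) : ‖Y‖ ≤ 2 * √n := by
  refine le_of_sq_le_sq ?_ (by positivity)
  rw [mul_pow, Real.sq_sqrt h.cast_pos.le]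
  linarith [h.norm_embedding_sq, h.cast_pos]

theorem norm_gram (h : AlignedEmbedding b X E Y) : ‖G‖ ≤ 2 * n := by
  rw [l2_opNorm_transpose_mul_self]; exact h.norm_embedding_sq

/-- This is the invariance equation `(X Xᵀ + E) Y = Y G` multiplied by the inverse of `G`. -/
theorem decomp (h : AlignedEmbedding b X E Y) : Y = X * K + V := by
  have h1 : (X * Xᵀ + E) * Y * (G)⁻¹ = Y * G * (G)⁻¹ := by rw [h.eigen.1]
  rw [Matrix.mul_assoc Y, mul_nonsing_inv _ h.isUnit_gram, Matrix.mul_one] at h1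
  rw [signalCoeff, noisePart]
  conv_lhs => rw [← h1]
  simp only [Matrix.add_mul, Matrix.mul_assoc]

theorem norm_signalCoeff (h : AlignedEmbedding b X E Y) : ‖K‖ ≤ 4 * b := by
  refine (l2_opNorm_mul_le_of_le (l2_opNorm_mul_le_of_le ((l2_opNorm_transpose X).trans_le h.norm_factor)
    h.norm_embedding) h.norm_gram_inv).trans_eq ?_
  have h1 := h.sqrt_mul_sqrt
  have h2 := h.cast_pos.ne'
  calc √(n : ℝ) * (2 * √n) * (2 * b / n) = (√(n : ℝ) * √n) * 2 * (2 * b / n) := by ring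
    _ = 4 * b := by rw [h1]; field_simp; ring

/-- Inserting the decomposition of `Y` into `V` itself gives a fixed-point equation whose linear
part contracts by the factor `1 / 2`. -/
theorem noisePart_eq (h : AlignedEmbedding b X E Y) :
    V = E * X * (K * (G)⁻¹) + E * V * (G)⁻¹ := by
  calc V = E * (X * K + V) * (G)⁻¹ := by rw [← h.decomp, noisePart]
    _ = _ := by simp only [Matrix.mul_add, Matrix.add_mul, Matrix.mul_assoc]

theorem norm_signalCoeff_mul_inv (h : AlignedEmbedding b X E Y) :
    ‖K * (G)⁻¹‖ ≤ 8 * b ^ 2 / n :=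
  (l2_opNorm_mul_le_of_le h.norm_signalCoeff h.norm_gram_inv).trans_eq (by ring)

theorem norm_noisePart (h : AlignedEmbedding b X E Y) : ‖V‖ ≤ 16 * b ^ 3 := by
  have hn := h.cast_pos.ne'
  have hb := h.b_pos.ne'
  -- The last term is absorbed on the left: `‖E‖ * ‖G⁻¹‖ ≤ n / (4 b) * (2 b / n) = 1 / 2`.
  have h1 : ‖V‖ ≤ b * n * (8 * b ^ 2 / n) + n / b / 4 * ‖V‖ * (2 * b / n) := by
    conv_lhs => rw [h.noisePart_eq]
    exact (norm_add_le _ _).trans (add_le_add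
      (l2_opNorm_mul_le_of_le h.norm_noise_mul h.norm_signalCoeff_mul_inv)
      (l2_opNorm_mul_le_of_le (l2_opNorm_mul_le_of_le h.norm_noise le_rfl) h.norm_gram_inv))
  have h2 : b * n * (8 * b ^ 2 / n) + n / b / 4 * ‖V‖ * (2 * b / n) = 8 * b ^ 3 + ‖V‖ / 2 := by
    field_simp; ring
  linarith

/-- The fixed-point equation multiplied on the left by `r`. It exploits the smallness of `r * (E *
X)`, which `‖r‖ * ‖V‖` would lose, and is applied with `Xᵀ`, `r * E` and the row of ones. -/
theorem norm_mul_noisePart (h : AlignedEmbedding b X E Y) {r : Matrix m (Fin n) ℝ} {p q : ℝ}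
    (hp : ‖r * (E * X)‖ ≤ p) (hq : ‖r * E‖ ≤ q) :
    ‖r * V‖ ≤ (8 * b ^ 2 * p + 32 * b ^ 4 * q) / n := by
  have h1 : r * V = r * (E * X) * (K * (G)⁻¹) + r * E * V * (G)⁻¹ := by
    conv_lhs => rw [h.noisePart_eq]
    simp only [Matrix.mul_add, Matrix.mul_assoc]
  rw [h1]
  refine (norm_add_le _ _).trans ((add_le_add
      (l2_opNorm_mul_le_of_le hp h.norm_signalCoeff_mul_inv)
      (l2_opNorm_mul_le_of_le (l2_opNorm_mul_le_of_le hq h.norm_noisePart) h.norm_gram_inv)).trans_eq ?_)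
  ring

theorem norm_factor_mul_noise (h : AlignedEmbedding b X E Y) : ‖Xᵀ * E‖ ≤ b * n := by
  rw [← l2_opNorm_transpose, transpose_mul, transpose_transpose, h.noise_symm]
  exact h.norm_noise_mul

theorem norm_factor_mul_noisePart (h : AlignedEmbedding b X E Y) : ‖Xᵀ * V‖ ≤ 40 * b ^ 5 := by
  refine (h.norm_mul_noisePart h.norm_mul_noise_mul h.norm_factor_mul_noise).trans ?_
  have hn := h.cast_pos.ne'
  have h1 : (8 * b ^ 2 * (b * n) + 32 * b ^ 4 * (b * n)) / n = 8 * b ^ 3 + 32 * b ^ 5 := by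
    field_simp
  linarith [h.pow_le (show 3 ≤ 5 by norm_num)]

/-- Expanding `Y` as `X * K + V` gives a bound independent of `n`, where the product of the norms
would be of order `√n`. -/
theorem norm_embedding_mul_noisePart (h : AlignedEmbedding b X E Y) :
    ‖Yᵀ * V‖ ≤ 416 * b ^ 6 := by
  have h1 : Yᵀ * V = (K)ᵀ * (Xᵀ * V) + (V)ᵀ * V := by
    calc Yᵀ * V = (X * K + V)ᵀ * V := by rw [← h.decomp]
      _ = _ := by rw [transpose_add, transpose_mul, Matrix.add_mul, Matrix.mul_assoc]
  rw [h1]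
  refine (norm_add_le _ _).trans ((add_le_add
    (l2_opNorm_mul_le_of_le ((l2_opNorm_transpose _).trans_le h.norm_signalCoeff)
      h.norm_factor_mul_noisePart)
    (l2_opNorm_mul_le_of_le ((l2_opNorm_transpose _).trans_le h.norm_noisePart)
      h.norm_noisePart)).trans_eq ?_)
  ring

theorem cross_eq (h : AlignedEmbedding b X E Y) : Xᵀ * Y = K * G := by
  rw [signalCoeff, Matrix.mul_assoc, nonsing_inv_mul _ h.isUnit_gram, Matrix.mul_one]

/-- This is where alignment enters. With `H = Xᵀ Y` symmetric, the difference `Δ = H - G` solves the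
Sylvester equation `H Δ + Δ G = -Yᵀ V G`. As `H ≥ 0` and `G ≥ n / (2 b)`, its left side has size at
least of order `n ‖Δ‖`, while the right side is `O(n)`. -/
theorem norm_cross_sub_gram (h : AlignedEmbedding b X E Y) :
    ‖Xᵀ * Y - G‖ ≤ 1700 * b ^ 8 := by
  set H := Xᵀ * Y with hH
  set Δ := H - G with hΔ
  have hHs : Hᵀ = H := by
    have := h.aligned.isHermitian.eq
    rwa [conjTranspose_eq_transpose_of_trivial] at this
  have hGs : (G)ᵀ = G := by rw [transpose_mul, transpose_transpose]
  have hΔs : Δᵀ = Δ := by rw [hΔ, transpose_sub, hHs, hGs]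
  have hG : G = Hᵀ * K + Yᵀ * V := by
    calc G = Yᵀ * (X * K + V) := by rw [← h.decomp]
      _ = _ := by rw [Matrix.mul_add, ← Matrix.mul_assoc, hH, transpose_mul, transpose_transpose]
  have hsq : H * Δ + Δ * G = -(Yᵀ * V * G) := by
    have h1 : G * G = H * H + Yᵀ * V * G := by
      nth_rw 1 [hG]
      rw [Matrix.add_mul, Matrix.mul_assoc Hᵀ, ← h.cross_eq, hHs]
    rw [hΔ, Matrix.mul_sub, Matrix.sub_mul, h1]
    abel
  -- The trace against `Δ` makes the term with `H` nonnegative and the term with `G` a sum of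
  -- quadratic forms over the rows of `Δ`.
  have htr : (Δ * (H * Δ)).trace + (Δ * (Δ * G)).trace = -(Δ * (Yᵀ * V * G)).trace := by
    rw [← trace_add, ← Matrix.mul_add, hsq, Matrix.mul_neg, trace_neg]
  have h1 : 0 ≤ (Δ * (H * Δ)).trace := by
    have := (h.aligned.mul_mul_conjTranspose_same Δ).trace_nonneg
    rwa [conjTranspose_eq_transpose_of_trivial, hΔs, Matrix.mul_assoc] at this
  have h2 : n / (2 * b) * ‖Δ‖ ^ 2 ≤ (Δ * (Δ * G)).trace := by
    have h3 : (Δ * (Δ * G)).trace = ∑ i, Δ i ⬝ᵥ G *ᵥ Δ i := by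
      rw [trace_mul_comm, trace]
      exact Finset.sum_congr rfl fun i _ => by rw [diag_apply, mul_mul_apply, hΔs]
    rw [h3]
    refine (mul_le_mul_of_nonneg_left (l2_opNorm_sq_le_sum_sq Δ) ?_).trans ?_
    · have := h.b_pos; positivity
    rw [Finset.mul_sum]
    refine Finset.sum_le_sum fun i _ => le_of_eq_of_le ?_ (h.coercive_gram (Δ i))
    simp only [dotProduct, sq]
  have h4 : -(Δ * (Yᵀ * V * G)).trace ≤ d * (‖Δ‖ * (416 * b ^ 6 * (2 * n))) := by
    refine (neg_le_abs _).trans ((abs_trace_le _).trans ?_)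
    rw [Fintype.card_fin]
    gcongr
    exact l2_opNorm_mul_le_of_le le_rfl (l2_opNorm_mul_le_of_le h.norm_embedding_mul_noisePart h.norm_gram)
  rcases (norm_nonneg Δ).eq_or_lt with h0 | h0
  · rw [← h0]; have := h.b_pos; positivity
  have hn := h.cast_pos
  have hb := h.b_pos
  have h5 : n / (2 * b) * ‖Δ‖ ^ 2 ≤ b * (‖Δ‖ * (416 * b ^ 6 * (2 * n))) := by
    have : (d : ℝ) * (‖Δ‖ * (416 * b ^ 6 * (2 * n))) ≤ b * (‖Δ‖ * (416 * b ^ 6 * (2 * n))) :=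
      mul_le_mul_of_nonneg_right h.card_le (by positivity)
    linarith
  have h6 : n / (2 * b) * ‖Δ‖ * ‖Δ‖ ≤ n / (2 * b) * ‖Δ‖ * (1664 * b ^ 8) := by
    refine le_of_eq_of_le (by ring) (h5.trans_eq ?_)
    field_simp
    ring
  have := le_of_mul_le_mul_left h6 (by positivity)
  linarith [pow_pos hb 8]

theorem norm_signalCoeff_sub_one (h : AlignedEmbedding b X E Y) :
    ‖K - 1‖ ≤ 3400 * b ^ 9 / n := by
  have h1 : K - 1 = (Xᵀ * Y - G) * (G)⁻¹ := by
    rw [Matrix.sub_mul, mul_nonsing_inv _ h.isUnit_gram, signalCoeff]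
  rw [h1]
  exact (l2_opNorm_mul_le_of_le h.norm_cross_sub_gram h.norm_gram_inv).trans_eq (by ring)

theorem sub_eq (h : AlignedEmbedding b X E Y) : Y - X = X * (K - 1) + V := by
  calc Y - X = X * K + V - X := by rw [← h.decomp]
    _ = _ := by rw [Matrix.mul_sub, Matrix.mul_one]; abel

theorem norm_sub (h : AlignedEmbedding b X E Y) : ‖Y - X‖ ≤ 3500 * b ^ 9 := by
  rw [h.sub_eq]
  refine (norm_add_le _ _).trans ((add_le_add
    (l2_opNorm_mul_le_of_le h.norm_factor h.norm_signalCoeff_sub_one) h.norm_noisePart).trans ?_)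
  have hb := h.b_pos
  have h1 : √(n : ℝ) ≤ n := by
    nth_rw 2 [← h.sqrt_mul_sqrt]
    exact le_mul_of_one_le_left h.sqrt_pos.le h.one_le_sqrt
  have h2 : √(n : ℝ) * (3400 * b ^ 9 / n) ≤ 3400 * b ^ 9 := by
    rw [mul_div_assoc', div_le_iff₀ h.cast_pos, mul_comm]
    gcongr
  linarith [h.pow_le (show 3 ≤ 9 by norm_num), pow_pos hb 9]

/-- The product of the norms would give order `√n`; the gain comes from the near orthogonality of
`X` and `V`. -/
theorem norm_factor_mul_sub (h : AlignedEmbedding b X E Y) :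
    ‖Xᵀ * (Y - X)‖ ≤ 3500 * b ^ 9 := by
  rw [h.sub_eq, Matrix.mul_add, ← Matrix.mul_assoc]
  have h1 : ‖S‖ ≤ n := by rw [l2_opNorm_transpose_mul_self]; exact h.norm_factor_sq
  refine (norm_add_le _ _).trans ((add_le_add
    (l2_opNorm_mul_le_of_le h1 h.norm_signalCoeff_sub_one) h.norm_factor_mul_noisePart).trans ?_)
  have h2 : (n : ℝ) * (3400 * b ^ 9 / n) = 3400 * b ^ 9 := by
    have := h.cast_pos.ne'
    field_simp
  linarith [h.pow_le (show 5 ≤ 9 by norm_num), pow_pos h.b_pos 9]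

theorem norm_gram_sub (h : AlignedEmbedding b X E Y) : ‖S - G‖ ≤ 13000000 * b ^ 18 := by
  have h1 : S - G = -(Xᵀ * (Y - X) + (Xᵀ * (Y - X))ᵀ + (Y - X)ᵀ * (Y - X)) := by
    simp only [transpose_mul, transpose_sub, transpose_transpose, Matrix.mul_sub, Matrix.sub_mul]
    abel
  rw [h1, norm_neg]
  refine (norm_add₃_le).trans ((add_le_add (add_le_add h.norm_factor_mul_sub
    ((l2_opNorm_transpose _).trans_le h.norm_factor_mul_sub))
    (l2_opNorm_mul_le_of_le ((l2_opNorm_transpose _).trans_le h.norm_sub) h.norm_sub)).trans ?_)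
  have h2 : 3500 * b ^ 9 * (3500 * b ^ 9) = 12250000 * b ^ 18 := by ring
  rw [h2]
  linarith [h.pow_le (show 9 ≤ 18 by norm_num), pow_pos h.b_pos 18]

/-- Both factors of `K G⁻¹` are close to their limits: `K - 1 = O(1/n)`, and `G⁻¹ - S⁻¹ = S⁻¹ (S -
G) G⁻¹` with `S - G = O(1)`. -/
theorem norm_coeff_mul_inv_sub (h : AlignedEmbedding b X E Y) :
    ‖K * (G)⁻¹ - (S)⁻¹‖ ≤ 27000000 * b ^ 20 / n ^ 2 := by
  have h1 : K * (G)⁻¹ - (S)⁻¹ = (K - 1) * (G)⁻¹ + (S)⁻¹ * (S - G) * (G)⁻¹ := by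
    rw [Matrix.mul_sub, nonsing_inv_mul _ h.isUnit_factor, Matrix.sub_mul, Matrix.sub_mul,
      Matrix.mul_assoc, mul_nonsing_inv _ h.isUnit_gram, Matrix.mul_one, Matrix.one_mul]
    abel
  rw [h1]
  refine (norm_add_le _ _).trans ((add_le_add
    (l2_opNorm_mul_le_of_le h.norm_signalCoeff_sub_one h.norm_gram_inv)
    (l2_opNorm_mul_le_of_le (l2_opNorm_mul_le_of_le h.norm_factor_inv h.norm_gram_sub)
      h.norm_gram_inv)).trans ?_)
  have hn := h.cast_pos
  have h2 : 3400 * b ^ 9 / n * (2 * b / n) + b / n * (13000000 * b ^ 18) * (2 * b / n) =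
      (6800 * b ^ 10 + 26000000 * b ^ 20) / n ^ 2 := by
    field_simp; ring
  rw [h2]
  gcongr
  linarith [h.pow_le (show 10 ≤ 20 by norm_num), pow_pos h.b_pos 20]

/-- First order expansion of a block of rows of the embedding. -/
theorem norm_rows_sub_expansion (h : AlignedEmbedding b X E Y) {r : Matrix m (Fin n) ℝ}
    (hrX : ‖r * X‖ ≤ b) (hrE : ‖r * E‖ ≤ b * √n) (hrEE : ‖r * E * E‖ ≤ b * n)
    (hrEEX : ‖r * E * (E * X)‖ ≤ b * n) :
    ‖r * (Y - X) - r * E * X * (S)⁻¹‖ ≤ 28000000 * b ^ 21 / n := by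
  have hn := h.cast_pos
  -- The three remainders are each `O(1/n)`: the error of `K` on the block itself, the error of the
  -- coefficient of the leading term, and the second-order noise.
  have h1 : r * (Y - X) - r * E * X * (S)⁻¹ =
      r * X * (K - 1) + (r * E) * X * (K * (G)⁻¹ - (S)⁻¹) + (r * E) * V * (G)⁻¹ := by
    rw [h.sub_eq]
    nth_rw 1 [h.noisePart_eq]
    simp only [Matrix.mul_sub, Matrix.mul_add, Matrix.mul_assoc]
    abel
  -- The bound on products with `V` is used with `r * E` in place of `r`, whence the hypotheses on
  -- `r * E * E` and `r * E * (E * X)`.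
  have h2 : ‖(r * E) * V‖ ≤ 40 * b ^ 5 := by
    refine (h.norm_mul_noisePart hrEEX hrEE).trans ?_
    have : (8 * b ^ 2 * (b * n) + 32 * b ^ 4 * (b * n)) / n = 8 * b ^ 3 + 32 * b ^ 5 := by
      field_simp
    linarith [h.pow_le (show 3 ≤ 5 by norm_num)]
  rw [h1]
  refine (norm_add₃_le).trans ((add_le_add (add_le_add
    (l2_opNorm_mul_le_of_le hrX h.norm_signalCoeff_sub_one)
    (l2_opNorm_mul_le_of_le (l2_opNorm_mul_le_of_le hrE h.norm_factor) h.norm_coeff_mul_inv_sub))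
    (l2_opNorm_mul_le_of_le h2 h.norm_gram_inv)).trans ?_)
  have h3 : b * √n * √n = b * n := by rw [mul_assoc, h.sqrt_mul_sqrt]
  have h4 : b * (3400 * b ^ 9 / n) + b * n * (27000000 * b ^ 20 / n ^ 2) +
      40 * b ^ 5 * (2 * b / n) = (3400 * b ^ 10 + 27000000 * b ^ 21 + 80 * b ^ 6) / n := by
    field_simp
    ring
  rw [h3, h4]
  gcongr
  linarith [h.pow_le (show 10 ≤ 21 by norm_num), h.pow_le (show 6 ≤ 21 by norm_num),
    pow_pos h.b_pos 21]

/-- Crude bound on blocks of rows of the error of the embedding. -/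
theorem norm_rows_sub (h : AlignedEmbedding b X E Y) {r : Matrix m (Fin n) ℝ}
    (hrX : ‖r * X‖ ≤ b * n) (hrE : ‖r * E‖ ≤ b * n) (hrEX : ‖r * (E * X)‖ ≤ b * n) :
    ‖r * (Y - X)‖ ≤ 3500 * b ^ 10 := by
  have hn := h.cast_pos
  rw [h.sub_eq, Matrix.mul_add, ← Matrix.mul_assoc]
  refine (norm_add_le _ _).trans ((add_le_add
    (l2_opNorm_mul_le_of_le hrX h.norm_signalCoeff_sub_one)
    (h.norm_mul_noisePart hrEX hrE)).trans ?_)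
  have h1 : b * n * (3400 * b ^ 9 / n) + (8 * b ^ 2 * (b * n) + 32 * b ^ 4 * (b * n)) / n =
      3400 * b ^ 10 + 8 * b ^ 3 + 32 * b ^ 5 := by
    field_simp
    ring
  rw [h1]
  linarith [h.pow_le (show 3 ≤ 10 by norm_num), h.pow_le (show 5 ≤ 10 by norm_num),
    pow_pos h.b_pos 10]

end AlignedEmbedding
end Perturbation

/-! ### Effect of centering the embedding. -/

section Centering

open scoped Matrix.Norms.L2Operator
open Matrix

/-- The row vector of ones. -/
def onesRow (n : ℕ) : Matrix Unit (Fin n) ℝ := Matrix.of fun _ _ => 1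

/-- The row vector that selects row `i`. -/
def unitRow {n : ℕ} (i : Fin n) : Matrix Unit (Fin n) ℝ :=
  Matrix.of fun _ j => if j = i then 1 else 0

theorem unitRow_mul_apply {n : ℕ} {m : Type*} (i : Fin n) (M : Matrix (Fin n) m ℝ) (u : Unit)
    (a : m) : (unitRow i * M) u a = M i a := by
  simp [unitRow, mul_apply]

theorem onesRow_mul_apply {n : ℕ} {m : Type*} (M : Matrix (Fin n) m ℝ) (u : Unit) (a : m) :
    (onesRow n * M) u a = ∑ j, M j a := by
  simp [onesRow, mul_apply]

theorem unitRow_mul_onesRow {n : ℕ} (i : Fin n) : unitRow i * (onesRow n)ᵀ = 1 := by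
  ext a b
  simp [unitRow_mul_apply, onesRow]

theorem norm_onesRow_le (n : ℕ) : ‖onesRow n‖ ≤ √n :=
  l2_opNorm_le_of_sum_sq_le (Real.sqrt_nonneg _) (by simp [onesRow])

theorem norm_unitRow_le {n : ℕ} (i : Fin n) : ‖unitRow i‖ ≤ 1 :=
  l2_opNorm_le_of_sum_sq_le zero_le_one (by simp [unitRow])

theorem centering_eq (n : ℕ) : centering n = 1 - (n : ℝ)⁻¹ • ((onesRow n)ᵀ * onesRow n) := by
  rw [centering]
  congr 2
  ext i j
  simp [onesRow, mul_apply]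

theorem centering_mul {n : ℕ} {m : Type*} (M : Matrix (Fin n) m ℝ) :
    centering n * M = M - (n : ℝ)⁻¹ • ((onesRow n)ᵀ * (onesRow n * M)) := by
  rw [centering_eq, Matrix.sub_mul, Matrix.one_mul, Matrix.smul_mul, Matrix.mul_assoc]

theorem norm_centering_le {n : ℕ} (hn : 0 < n) : ‖centering n‖ ≤ 2 := by
  have hn' : (0 : ℝ) < n := Nat.cast_pos.2 hn
  rw [centering_eq]
  refine (norm_sub_le _ _).trans ?_
  have h1 : ‖(1 : Matrix (Fin n) (Fin n) ℝ)‖ ≤ 1 :=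
    l2_opNorm_le_one_of_mem_orthogonalGroup (one_mem _)
  have h2 : ‖(n : ℝ)⁻¹ • ((onesRow n)ᵀ * onesRow n)‖ ≤ 1 := by
    rw [norm_smul, norm_inv, Real.norm_natCast, inv_mul_le_iff₀ hn', mul_one,
      l2_opNorm_transpose_mul_self]
    calc ‖onesRow n‖ ^ 2 ≤ √(n : ℝ) ^ 2 := pow_le_pow_left₀ (norm_nonneg _) (norm_onesRow_le n) 2
      _ = n := Real.sq_sqrt hn'.le
  linarith

theorem onesRow_mul_transpose {n : ℕ} : onesRow n * (onesRow n)ᵀ = (n : ℝ) • 1 := by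
  ext; simp [onesRow, mul_apply]

theorem centering_transpose (n : ℕ) : (centering n)ᵀ = centering n := by
  rw [centering_eq, transpose_sub, transpose_smul, transpose_mul, transpose_transpose,
    transpose_one]

theorem centering_mul_centering (n : ℕ) : centering n * centering n = centering n := by
  rcases Nat.eq_zero_or_pos n with rfl | hn
  · exact Subsingleton.elim _ _
  have hn' : (n : ℝ) ≠ 0 := Nat.cast_ne_zero.2 hn.ne'
  have h : onesRow n * centering n = 0 := by
    rw [centering_eq, Matrix.mul_sub, Matrix.mul_one, Matrix.mul_smul, ← Matrix.mul_assoc,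
      onesRow_mul_transpose, Matrix.smul_mul, Matrix.one_mul, smul_smul, inv_mul_cancel₀ hn',
      one_smul, sub_self]
  rw [centering_mul, h, Matrix.mul_zero, smul_zero, sub_zero]

namespace AlignedEmbedding

variable {n d : ℕ} {b : ℝ} {X Y : Matrix (Fin n) (Fin d) ℝ} {E : Matrix (Fin n) (Fin n) ℝ}

/-- The sum of the `n` row errors stays bounded, so their mean is `O(1/n)` and centering is
invisible on the scale `1/√n`. -/
theorem norm_onesRow_mul_sub (h : AlignedEmbedding b X E Y)
    (hE : ‖onesRow n * E‖ ≤ b * n) (hEX : ‖onesRow n * (E * X)‖ ≤ b * n) :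
    ‖onesRow n * (Y - X)‖ ≤ 3500 * b ^ 10 := by
  refine h.norm_rows_sub ?_ hE hEX
  refine (l2_opNorm_mul_le_of_le (norm_onesRow_le n) h.norm_factor).trans ?_
  rw [h.sqrt_mul_sqrt]
  exact le_mul_of_one_le_left h.cast_pos.le h.one_le

/-- First order expansion of a row of the centered embedding. -/
theorem norm_unitRow_centering_sub (h : AlignedEmbedding b X E Y)
    (hE : ‖onesRow n * E‖ ≤ b * n) (hEX : ‖onesRow n * (E * X)‖ ≤ b * n) {i : Fin n}
    (hrX : ‖unitRow i * X‖ ≤ b) (hrE : ‖unitRow i * E‖ ≤ b * √n)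
    (hrEE : ‖unitRow i * E * E‖ ≤ b * n) (hrEEX : ‖unitRow i * E * (E * X)‖ ≤ b * n) :
    ‖unitRow i * (centering n * (Y - X)) - unitRow i * E * X * (Xᵀ * X)⁻¹‖ ≤
      29000000 * b ^ 21 / n := by
  have hn := h.cast_pos
  have h1 : unitRow i * (centering n * (Y - X)) - unitRow i * E * X * (Xᵀ * X)⁻¹ =
      (unitRow i * (Y - X) - unitRow i * E * X * (Xᵀ * X)⁻¹) -
        (n : ℝ)⁻¹ • (onesRow n * (Y - X)) := by
    rw [centering_mul, Matrix.mul_sub (unitRow i), Matrix.mul_smul, ← Matrix.mul_assoc _ _ᵀ,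
      unitRow_mul_onesRow, Matrix.one_mul]
    abel
  rw [h1]
  refine (norm_sub_le _ _).trans ?_
  rw [norm_smul, norm_inv, Real.norm_natCast]
  have h2 : (n : ℝ)⁻¹ * ‖onesRow n * (Y - X)‖ ≤ (n : ℝ)⁻¹ * (3500 * b ^ 10) := by
    gcongr
    exact h.norm_onesRow_mul_sub hE hEX
  refine (add_le_add (h.norm_rows_sub_expansion hrX hrE hrEE hrEEX) h2).trans ?_
  rw [inv_mul_eq_div, ← add_div]
  gcongr
  linarith [h.pow_le (show 10 ≤ 21 by norm_num), pow_pos h.b_pos 21]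

/-- This comparison controls the rotation selected by the diagonality convention. With `R = Y - X`
and `J` a symmetric projection, the difference is `(T + Tᵀ + (J R)ᵀ J R) / n` for `T = Xᵀ J R`, and
each summand is `O(1)`. -/
theorem norm_secondMoment_sub (h : AlignedEmbedding b X E Y)
    (hE : ‖onesRow n * E‖ ≤ b * n) (hEX : ‖onesRow n * (E * X)‖ ≤ b * n) :
    ‖secondMoment (centering n * Y) - secondMoment (centering n * X)‖ ≤
      50000000 * b ^ 18 / n := by
  have hn := h.cast_pos
  set R := Y - X with hR
  set T := Xᵀ * (centering n * R) with hT
  have h1 : secondMoment (centering n * Y) - secondMoment (centering n * X) =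
      (n : ℝ)⁻¹ • (T + Tᵀ + (centering n * R)ᵀ * (centering n * R)) := by
    have h2 : ∀ M N : Matrix (Fin n) (Fin d) ℝ, (centering n * M)ᵀ * (centering n * N) =
        Mᵀ * (centering n * N) := by
      intro M N
      rw [transpose_mul, centering_transpose, Matrix.mul_assoc, ← Matrix.mul_assoc (centering n),
        centering_mul_centering]
    have hY : Y = X + R := by rw [hR]; abel
    rw [secondMoment, secondMoment, ← smul_sub, h2, h2, h2, hT, hY]
    congr 1
    simp only [transpose_mul, transpose_add, transpose_transpose, centering_transpose,
      Matrix.mul_add, Matrix.add_mul, Matrix.mul_assoc]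
    abel
  have hT' : ‖T‖ ≤ 7000 * b ^ 10 := by
    rw [hT, centering_mul, Matrix.mul_sub, Matrix.mul_smul, ← Matrix.mul_assoc]
    refine (norm_sub_le _ _).trans ?_
    rw [norm_smul, norm_inv, Real.norm_natCast]
    have h3 : ‖Xᵀ * (onesRow n)ᵀ‖ ≤ n := by
      refine (l2_opNorm_mul_le_of_le ((l2_opNorm_transpose _).trans_le h.norm_factor)
        ((l2_opNorm_transpose _).trans_le (norm_onesRow_le n))).trans_eq h.sqrt_mul_sqrt
    have h4 := l2_opNorm_mul_le_of_le h3 (h.norm_onesRow_mul_sub hE hEX)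
    have h5 : (n : ℝ)⁻¹ * ‖Xᵀ * (onesRow n)ᵀ * (onesRow n * R)‖ ≤ 3500 * b ^ 10 := by
      rwa [inv_mul_le_iff₀ hn]
    linarith [h.norm_factor_mul_sub, h.pow_le (show 9 ≤ 10 by norm_num)]
  have hJR : ‖centering n * R‖ ≤ 2 * (3500 * b ^ 9) :=
    l2_opNorm_mul_le_of_le (norm_centering_le h.pos) h.norm_sub
  rw [h1, norm_smul, norm_inv, Real.norm_natCast, inv_mul_eq_div]
  gcongr
  refine (norm_add₃_le).trans ((add_le_add (add_le_add hT'
    ((l2_opNorm_transpose _).trans_le hT'))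
    (l2_opNorm_mul_le_of_le ((l2_opNorm_transpose _).trans_le hJR) hJR)).trans ?_)
  have h2 : 2 * (3500 * b ^ 9) * (2 * (3500 * b ^ 9)) = 49000000 * b ^ 18 := by ring
  rw [h2]
  linarith [h.pow_le (show 10 ≤ 18 by norm_num), pow_pos h.b_pos 18]

/-- The diagonal of the cross moment matrix of the embedding is bounded below. -/
theorem le_cross_diag (h : AlignedEmbedding b X E Y) (hn : 6800 * b ^ 9 ≤ n) (a : Fin d) :
    n / (4 * b) ≤ (Xᵀ * Y) a a := by
  have h1 := h.coercive_gram (Pi.single a 1)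
  simp only [dotProduct_single, mul_one, mulVec_single_one, Pi.single_eq_same, single_dotProduct,
    one_mul, col_apply] at h1
  have h2 := (abs_le.1 ((abs_entry_le_l2_opNorm _ a a).trans h.norm_cross_sub_gram)).1
  rw [Matrix.sub_apply] at h2
  have hb := h.b_pos
  have h3 : 1700 * b ^ 8 ≤ n / (4 * b) := by
    rw [le_div_iff₀ (by positivity)]
    linarith [show 1700 * b ^ 8 * (4 * b) = 6800 * b ^ 9 by ring]
  have h4 : (n : ℝ) / (2 * b) = n / (4 * b) + n / (4 * b) := by field_simp; ring
  linarith

theorem norm_cross_le (h : AlignedEmbedding b X E Y) : ‖Xᵀ * Y‖ ≤ 2 * n := by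
  refine (l2_opNorm_mul_le_of_le ((l2_opNorm_transpose X).trans_le h.norm_factor)
    h.norm_embedding).trans_eq ?_
  rw [mul_left_comm, h.sqrt_mul_sqrt]

end AlignedEmbedding

end Centering

/-! ### Orthogonal matrices that nearly intertwine diagonal matrices. -/

section Identifiability

open scoped Matrix.Norms.L2Operator
open Matrix

theorem StrictMono.eq_id_of_fintype {α : Type*} [LinearOrder α] [Fintype α] {f : α → α}
    (hf : StrictMono f) : f = id :=
  funext fun _ => le_antisymm hf.apply_le hf.le_apply

/-- After ordering the indices by `v`, the map is strictly monotone on a finite linear order. -/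
theorem Function.eq_id_of_lt_imp_lt {ι : Type*} [Fintype ι] {v : ι → ℝ} (hv : v.Injective)
    {f : ι → ι} (hf : ∀ a b, v a < v b → v (f a) < v (f b)) : f = id := by
  let _ : LinearOrder ι := LinearOrder.lift' v hv
  exact StrictMono.eq_id_of_fintype (f := f) fun a b hab => hf a b hab

namespace Matrix

variable {d : ℕ} {W : Matrix (Fin d) (Fin d) ℝ}

theorem sum_sq_col_of_mem_orthogonalGroup (hW : W ∈ orthogonalGroup (Fin d) ℝ) (b : Fin d) :
    ∑ a, W a b ^ 2 = 1 := by
  have h := congrFun (congrFun (transpose_mul_self_of_mem_orthogonalGroup hW) b) b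
  rw [mul_apply, one_apply_eq] at h
  simpa [sq] using h

theorem sum_mul_col_of_mem_orthogonalGroup (hW : W ∈ orthogonalGroup (Fin d) ℝ) {b b' : Fin d}
    (hb : b ≠ b') : ∑ a, W a b * W a b' = 0 := by
  have h := congrFun (congrFun (transpose_mul_self_of_mem_orthogonalGroup hW) b) b'
  rwa [mul_apply, one_apply_ne hb] at h

theorem exists_le_abs_of_mem_orthogonalGroup (hW : W ∈ orthogonalGroup (Fin d) ℝ) (b : Fin d) :
    ∃ a, 1 ≤ d * |W a b| := by
  by_contra! h
  have hd : (0 : ℝ) < d := Nat.cast_pos.2 b.pos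
  have h1 : ∀ a, W a b ^ 2 < (1 / d) ^ 2 := fun a => by
    rw [← sq_abs]
    refine pow_lt_pow_left₀ ?_ (abs_nonneg _) two_ne_zero
    rw [lt_div_iff₀ hd, mul_comm]
    exact h a
  have h2 : ∑ a, W a b ^ 2 < ∑ _a : Fin d, (1 / (d : ℝ)) ^ 2 :=
    Finset.sum_lt_sum_of_nonempty ⟨b, Finset.mem_univ b⟩ fun a _ => h1 a
  rw [sum_sq_col_of_mem_orthogonalGroup hW, Finset.sum_const, Finset.card_univ, Fintype.card_fin,
    nsmul_eq_mul] at h2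
  have h3 : (d : ℝ) * (1 / d) ^ 2 = 1 / d := by field_simp
  have h4 : (1 : ℝ) / d ≤ 1 := by
    rw [div_le_one hd]; exact Nat.one_le_cast.2 b.pos
  linarith

theorem abs_entry_le_one_of_mem_orthogonalGroup (hW : W ∈ orthogonalGroup (Fin d) ℝ)
    (a b : Fin d) : |W a b| ≤ 1 :=
  (abs_entry_le_l2_opNorm W a b).trans (l2_opNorm_le_one_of_mem_orthogonalGroup hW)

/-- If an orthogonal matrix nearly intertwines two diagonal matrices whose entries are in the
same order, those of the first being separated, its off-diagonal entries are small. -/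
theorem abs_offDiag_le_of_intertwine (hW : W ∈ orthogonalGroup (Fin d) ℝ) {v w : Fin d → ℝ}
    {c η : ℝ} (hc : 0 < c) (hη : 0 ≤ η) (hsep : ∀ a b, a ≠ b → c ≤ |v a - v b|)
    (horder : ∀ a b, v a < v b → w a ≤ w b) (hηc : 4 * d ^ 2 * η ≤ c)
    (hW' : ∀ a b, |(v a - w b) * W a b| ≤ η) (a b : Fin d) (hab : a ≠ b) :
    |W a b| ≤ 2 * η / c := by
  have hd : (1 : ℝ) ≤ d := Nat.one_le_cast.2 a.pos
  have hηd : 4 * d * η ≤ c := by nlinarith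
  -- In every column `b`, the row `π b` carries an entry of size at least `1 / d`, which forces `w
  -- b` to be close to `v (π b)`; separation then makes the rest of the column small.
  choose π hπ using exists_le_abs_of_mem_orthogonalGroup hW
  have hclose : ∀ b, |v (π b) - w b| ≤ d * η := by
    intro b
    have h1 := hW' (π b) b
    rw [abs_mul] at h1
    have h2 := mul_le_mul_of_nonneg_left (hπ b) (abs_nonneg (v (π b) - w b))
    nlinarith
  have hsmall : ∀ a b, a ≠ π b → |W a b| ≤ 2 * η / c := by
    intro a b hab
    have h1 := hW' a b
    rw [abs_mul] at h1
    have h2 := hsep a (π b) hab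
    have h3 : |v a - v (π b)| ≤ |v a - w b| + |v (π b) - w b| := by
      rw [abs_sub_comm (v (π b))]; exact abs_sub_le _ _ _
    have h4 : c / 2 ≤ |v a - w b| := by linarith [hclose b]
    rw [le_div_iff₀ hc]
    nlinarith [abs_nonneg (W a b)]
  -- Two columns concentrated on the same row could not be orthogonal.
  have hinj : ∀ b b', b ≠ b' → π b ≠ π b' := by
    intro b b' hbb h
    have h1 := sum_mul_col_of_mem_orthogonalGroup hW hbb
    rw [← Finset.add_sum_erase _ _ (Finset.mem_univ (π b))] at h1
    have h2 : |W (π b) b * W (π b) b'| ≤ d * (2 * η / c) ^ 2 := by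
      rw [eq_neg_of_add_eq_zero_left h1, abs_neg]
      refine (Finset.abs_sum_le_sum_abs _ _).trans ?_
      refine (Finset.sum_le_card_nsmul _ _ ((2 * η / c) ^ 2) fun a ha => ?_).trans ?_
      · have ha' := (Finset.mem_erase.1 ha).1
        rw [abs_mul, sq]
        exact mul_le_mul (hsmall a b ha') (hsmall a b' (h ▸ ha')) (abs_nonneg _) (by positivity)
      · rw [nsmul_eq_mul]
        gcongr
        exact_mod_cast (Finset.card_le_univ _).trans_eq (Fintype.card_fin d)
    have h3 : 1 ≤ (d * |W (π b) b|) * (d * |W (π b) b'|) := by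
      have h4 := hπ b'
      rw [← h] at h4
      exact one_le_mul_of_one_le_of_one_le (hπ b) h4
    have h5 : 2 * η / c * (2 * d) ≤ 1 / d := by
      rw [le_div_iff₀ (by linarith), div_mul_eq_mul_div, div_mul_eq_mul_div, div_le_one hc]
      nlinarith
    have h6 : (d : ℝ) ^ 2 * (d * (2 * η / c) ^ 2) ≤ 1 / 4 := by
      have h7 : 2 * η / c * (2 * d) ^ 2 ≤ 2 := by
        have := mul_le_mul_of_nonneg_right h5 (show (0 : ℝ) ≤ 2 * d by linarith)
        have h8 : 1 / (d : ℝ) * (2 * d) = 2 := by field_simp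
        nlinarith
      have h9 : 0 ≤ 2 * η / c := by positivity
      have h10 : (d * (2 * η / c)) ≤ 1 / 2 / d := by
        rw [le_div_iff₀ (by linarith)]; nlinarith
      have h11 : d * (2 * η / c) * d ≤ 1 / 2 := (le_div_iff₀ (by linarith)).1 h10
      have h12 : d * (2 * η / c) ≤ 1 / 2 :=
        (le_mul_of_one_le_right (by positivity) hd).trans h11
      calc (d : ℝ) ^ 2 * (d * (2 * η / c) ^ 2) = d * (2 * η / c) * d * (d * (2 * η / c)) := by ring
        _ ≤ 1 / 2 * (1 / 2) := mul_le_mul h11 h12 (by positivity) (by norm_num)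
        _ = 1 / 4 := by norm_num
    rw [abs_mul] at h2
    have h12 := mul_le_mul_of_nonneg_left h2 (sq_nonneg (d : ℝ))
    nlinarith
  have hv : v.Injective := by
    intro a b h
    by_contra hne
    have := hsep a b hne
    rw [h, sub_self, abs_zero] at this
    linarith
  -- `w` has the order of `v`, and `w b` is within `d * η` of `v (π b)`, so `π` preserves the order
  -- of `v`.
  have hid : π = id := by
    refine Function.eq_id_of_lt_imp_lt hv fun a b hlt => ?_
    have h1 := horder a b hlt
    have h2 := abs_le.1 (hclose a)
    have h3 := abs_le.1 (hclose b)
    have hne : π a ≠ π b := hinj a b fun h => by rw [h] at hlt; exact lt_irrefl _ hlt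
    have h4 := hsep _ _ hne
    by_contra! hge
    rw [abs_of_nonneg (sub_nonneg.2 hge)] at h4
    nlinarith
  exact hsmall a b (by rw [hid]; exact hab)

theorem one_sub_sq_diag_le (hW : W ∈ orthogonalGroup (Fin d) ℝ) {ε : ℝ}
    (h : ∀ a b, a ≠ b → |W a b| ≤ ε) (a : Fin d) : 1 - W a a ^ 2 ≤ d * ε ^ 2 := by
  have h1 := sum_sq_col_of_mem_orthogonalGroup hW a
  rw [← Finset.add_sum_erase _ _ (Finset.mem_univ a)] at h1
  have h2 : ∑ k ∈ Finset.univ.erase a, W k a ^ 2 ≤ d * ε ^ 2 := by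
    refine (Finset.sum_le_card_nsmul _ _ (ε ^ 2) fun k hk => ?_).trans ?_
    · rw [← sq_abs]
      exact pow_le_pow_left₀ (abs_nonneg _) (h k a (Finset.mem_erase.1 hk).1) 2
    · rw [nsmul_eq_mul]
      gcongr
      exact_mod_cast (Finset.card_le_univ _).trans_eq (Fintype.card_fin d)
  linarith

/-- An orthogonal matrix with small off-diagonal entries, whose diagonal entries are not close
to `-1`, is close to the identity. -/
theorem l2_opNorm_sub_one_le (hW : W ∈ orthogonalGroup (Fin d) ℝ) {ε : ℝ} (hε : 0 ≤ ε)
    (hdε : 4 * d * ε ≤ 1) (h : ∀ a b, a ≠ b → |W a b| ≤ ε) (hdiag : ∀ a, -(1 / 2) < W a a) :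
    ‖W - 1‖ ≤ d * ε := by
  have hent : ∀ a b, |(W - 1) a b| ≤ ε := by
    intro a b
    rw [Matrix.sub_apply]
    by_cases hab : a = b
    · subst hab
      have hd : (1 : ℝ) ≤ d := Nat.one_le_cast.2 a.pos
      have h1 := one_sub_sq_diag_le hW h a
      have h2 := hdiag a
      have h3 := (abs_le.1 (abs_entry_le_one_of_mem_orthogonalGroup hW a a)).2
      rw [one_apply_eq, abs_sub_comm, abs_of_nonneg (by linarith)]
      -- Here `(1 - W a a) * (1 + W a a) ≤ d * ε ^ 2` with second factor above `1 / 2`, so `1 - W a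
      -- a ≤ 2 * d * ε ^ 2 ≤ ε`.
      nlinarith
    · rw [one_apply_ne hab, sub_zero]; exact h a b hab
  refine l2_opNorm_le_of_sum_sq_le (by positivity) ?_
  calc ∑ a, ∑ b, (W - 1) a b ^ 2 ≤ ∑ _a : Fin d, ∑ _b : Fin d, ε ^ 2 := by
        refine Finset.sum_le_sum fun a _ => Finset.sum_le_sum fun b _ => ?_
        rw [← sq_abs]
        exact pow_le_pow_left₀ (abs_nonneg _) (hent a b) 2
    _ = (d * ε) ^ 2 := by simp; ring

/-- A combination of the entries of a nearly diagonal orthogonal column with a coefficient on the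
diagonal that dominates determines the sign of the diagonal entry. -/
theorem neg_half_lt_diag_of_dotProduct_nonneg {ε : ℝ} (hε : 0 ≤ ε)
    (h : ∀ a b, a ≠ b → |W a b| ≤ ε) {u : Fin d → ℝ} {p q : ℝ} {a : Fin d} (hp : p ≤ u a)
    (hq : ∀ k, |u k| ≤ q) (hpq : 2 * d * q * ε < p) (hp0 : 0 < p) (hnn : 0 ≤ ∑ k, u k * W k a) :
    -(1 / 2) < W a a := by
  by_contra! hlt
  rw [← Finset.add_sum_erase _ _ (Finset.mem_univ a)] at hnn
  have hq0 : 0 ≤ q := (abs_nonneg _).trans (hq a)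
  have h2 : ∑ k ∈ Finset.univ.erase a, u k * W k a ≤ d * (q * ε) := by
    refine (Finset.sum_le_card_nsmul _ _ (q * ε) fun k hk => ?_).trans ?_
    · refine (le_abs_self _).trans ?_
      rw [abs_mul]
      exact mul_le_mul (hq k) (h k a (Finset.mem_erase.1 hk).1) (abs_nonneg _) hq0
    · rw [nsmul_eq_mul]
      gcongr
      exact_mod_cast (Finset.card_le_univ _).trans_eq (Fintype.card_fin d)
  nlinarith

end Matrix

end Identifiability

/-! ### The expansion under either resolution of the rotation indeterminacy. -/

section RotationResolution

open scoped Matrix.Norms.L2Operator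
open Matrix

/-- Bounds satisfied with high probability by the row `i` of symmetric independent noise. -/
structure IsTameRow {n d : ℕ} (b : ℝ) (X : Matrix (Fin n) (Fin d) ℝ)
    (E : Matrix (Fin n) (Fin n) ℝ) (i : Fin n) : Prop where
  factor : ‖unitRow i * X‖ ≤ b
  noise : ‖unitRow i * E‖ ≤ b * √n
  noise_factor : ‖unitRow i * E * X‖ ≤ b * √n
  noise_noise : ‖unitRow i * E * E‖ ≤ b * n
  noise_noise_factor : ‖unitRow i * E * (E * X)‖ ≤ b * n

/-- Bounds satisfied with high probability by symmetric independent noise. -/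
structure IsTameNoise {n d : ℕ} (b : ℝ) (X : Matrix (Fin n) (Fin d) ℝ)
    (E : Matrix (Fin n) (Fin n) ℝ) : Prop where
  symm : Eᵀ = E
  noise : ‖E‖ ≤ n / b / 4
  noise_factor : ‖E * X‖ ≤ b * n
  factor_noise_factor : ‖Xᵀ * (E * X)‖ ≤ b * n
  ones_noise : ‖onesRow n * E‖ ≤ b * n
  ones_noise_factor : ‖onesRow n * (E * X)‖ ≤ b * n

namespace AlignedEmbedding

variable {n d : ℕ} {b c : ℝ} {X Y : Matrix (Fin n) (Fin d) ℝ} {E : Matrix (Fin n) (Fin n) ℝ}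
  {W : Matrix (Fin d) (Fin d) ℝ}

theorem norm_unitRow_centering_sub_expansion (h : AlignedEmbedding b X E Y)
    (hE : IsTameNoise b X E) {i : Fin n} (hi : IsTameRow b X E i) :
    ‖unitRow i * (centering n * (Y - X)) - unitRow i * E * X * (Xᵀ * X)⁻¹‖ ≤
      29000000 * b ^ 21 / n :=
  h.norm_unitRow_centering_sub hE.ones_noise hE.ones_noise_factor hi.factor hi.noise
    hi.noise_noise hi.noise_noise_factor

theorem norm_unitRow_centering_sub_le (h : AlignedEmbedding b X E Y)
    (hE : IsTameNoise b X E) {i : Fin n} (hi : IsTameRow b X E i) :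
    ‖unitRow i * (centering n * (Y - X))‖ ≤ 30000000 * b ^ 21 / √n := by
  have h1 := h.norm_unitRow_centering_sub_expansion hE hi
  have h2 := l2_opNorm_mul_le_of_le hi.noise_factor h.norm_factor_inv
  have h3 := norm_le_norm_sub_add (unitRow i * (centering n * (Y - X)))
    (unitRow i * E * X * (Xᵀ * X)⁻¹)
  have hs := h.sqrt_pos
  have h4 : b * √n * (b / n) = b ^ 2 / √n := by
    nth_rw 2 [← h.sqrt_mul_sqrt]
    field_simp
  have h5 : 29000000 * b ^ 21 / n ≤ 29000000 * b ^ 21 / √n := by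
    have := h.b_pos
    refine div_le_div_of_nonneg_left (by positivity) hs ?_
    nth_rw 2 [← h.sqrt_mul_sqrt]
    exact le_mul_of_one_le_left hs.le h.one_le_sqrt
  have h6 : b ^ 2 / √n ≤ 1000000 * b ^ 21 / √n := by
    gcongr
    linarith [h.pow_le (show 2 ≤ 21 by norm_num), pow_pos h.b_pos 21]
  have h7 : 30000000 * b ^ 21 / √(n : ℝ) = 29000000 * b ^ 21 / √n + 1000000 * b ^ 21 / √n := by
    ring
  linarith

theorem norm_unitRow_centering_factor (h : AlignedEmbedding b X E Y) {i : Fin n}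
    (hi : IsTameRow b X E i) : ‖unitRow i * (centering n * X)‖ ≤ 2 * b := by
  rw [centering_mul, Matrix.mul_sub, Matrix.mul_smul, ← Matrix.mul_assoc _ _ᵀ,
    unitRow_mul_onesRow, Matrix.one_mul]
  refine (norm_sub_le _ _).trans ?_
  have h1 := l2_opNorm_mul_le_of_le (norm_onesRow_le n) h.norm_factor
  rw [h.sqrt_mul_sqrt] at h1
  have h2 : ‖(n : ℝ)⁻¹ • (onesRow n * X)‖ ≤ 1 := by
    rw [norm_smul, norm_inv, Real.norm_natCast, inv_mul_le_iff₀ h.cast_pos, mul_one]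
    exact h1
  linarith [hi.factor, h.one_le]

theorem norm_unitRow_centering_embedding (h : AlignedEmbedding b X E Y)
    (hE : IsTameNoise b X E) {i : Fin n} (hi : IsTameRow b X E i) :
    ‖unitRow i * (centering n * Y)‖ ≤ 40000000 * b ^ 21 := by
  have h1 : unitRow i * (centering n * Y) =
      unitRow i * (centering n * X) + unitRow i * (centering n * (Y - X)) := by
    rw [← Matrix.mul_add, ← Matrix.mul_add, add_sub_cancel]
  rw [h1]
  refine (norm_add_le _ _).trans ?_
  have h2 := h.norm_unitRow_centering_sub_le hE hi
  have h3 : 30000000 * b ^ 21 / √n ≤ 30000000 * b ^ 21 :=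
    div_le_self (by have := h.b_pos; positivity) h.one_le_sqrt
  have h4 := h.pow_le (show 1 ≤ 21 by norm_num)
  rw [pow_one] at h4
  linarith [h.norm_unitRow_centering_factor hi, pow_pos h.b_pos 21]

/-- A rotation that makes the second moment matrix of the centered aligned embedding diagonal,
with diagonal entries in the order of those of the centered factor, is nearly diagonal. -/
theorem abs_offDiag_le (h : AlignedEmbedding b X E Y) (hE : IsTameNoise b X E)
    (hW : W ∈ orthogonalGroup (Fin d) ℝ) (hc : 0 < c)
    (hdiag : (secondMoment (centering n * X)).IsDiag)
    (hsep : ∀ a a', a ≠ a' → c ≤ |secondMoment (centering n * X) a a -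
      secondMoment (centering n * X) a' a'|)
    (hmatch : HasMatchingDiagonalGram (centering n * (Y * W)) (centering n * X))
    (hn : 4 * d ^ 2 * (50000000 * b ^ 18 / n) ≤ c) (a a' : Fin d) (ha : a ≠ a') :
    |W a a'| ≤ 2 * (50000000 * b ^ 18 / n) / c := by
  have hb := h.b_pos
  refine abs_offDiag_le_of_intertwine hW (v := fun a => secondMoment (centering n * X) a a)
    (w := fun a => secondMoment (centering n * (Y * W)) a a) hc (by positivity) hsep hmatch.2 hn
    (fun a a' => ?_) a a' ha
  have h1 : secondMoment (centering n * (Y * W)) = Wᵀ * secondMoment (centering n * Y) * W := by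
    simp only [secondMoment, transpose_mul, Matrix.mul_smul, Matrix.smul_mul, Matrix.mul_assoc]
  -- `W` would intertwine the two diagonal matrices exactly if the centered second moments of `X`
  -- and `Y` coincided; the defect is `O(1/n)`.
  have h2 : secondMoment (centering n * X) * W - W * secondMoment (centering n * (Y * W)) =
      -((secondMoment (centering n * Y) - secondMoment (centering n * X)) * W) := by
    rw [h1, Matrix.mul_assoc, ← Matrix.mul_assoc W, mul_transpose_self_of_mem_orthogonalGroup hW,
      Matrix.one_mul, Matrix.sub_mul]
    abel
  have h3 : (secondMoment (centering n * X) a a - secondMoment (centering n * (Y * W)) a' a') *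
      W a a' =
      (secondMoment (centering n * X) * W - W * secondMoment (centering n * (Y * W))) a a' := by
    rw [Matrix.sub_apply]
    nth_rw 2 [← hdiag.diagonal_diag]
    nth_rw 2 [← hmatch.1.diagonal_diag]
    rw [diagonal_mul, mul_diagonal, diag_apply, diag_apply]
    ring
  rw [h3, h2]
  refine (abs_entry_le_l2_opNorm _ _ _).trans ?_
  rw [norm_neg]
  refine (l2_opNorm_mul_le_of_le (h.norm_secondMoment_sub hE.ones_noise hE.ones_noise_factor)
    (l2_opNorm_le_one_of_mem_orthogonalGroup hW)).trans_eq (mul_one _)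

/-- The sign conventions exclude reflections. -/
theorem neg_half_lt_diag (h : AlignedEmbedding b X E Y) (hE : IsTameNoise b X E) (hc : 0 < c)
    {ε : ℝ} (hε : 0 ≤ ε) (hoff : ∀ a a', a ≠ a' → |W a a'| ≤ ε)
    (h1 : 16 * b * d * ε < 1) (h2 : 12 * b * d * ε < c) (h3 : 6800 * b ^ 9 ≤ n)
    (h4 : 30000000 * b ^ 21 / √n ≤ c / 2)
    (hsign : (∀ a, 0 ≤ ∑ j, (Y * W) j a * X j a) ∨
      ∃ i, IsTameRow b X E i ∧ (∀ a, c ≤ (centering n * X) i a) ∧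
        ∀ a, 0 ≤ (centering n * (Y * W)) i a) (a : Fin d) :
    -(1 / 2) < W a a := by
  have hb := h.b_pos
  have hn := h.cast_pos
  rcases hsign with hsign | ⟨i, hi, hcZ, hsign⟩
  -- The diagonal entry `p = n / (4 * b)` must dominate entries up to `q = 2 * n`; the requirement
  -- `2 * d * q * ε < p` is `16 * b * d * ε < 1`.
  · refine neg_half_lt_diag_of_dotProduct_nonneg hε hoff (u := (Xᵀ * Y) a) (h.le_cross_diag h3 a)
      (fun k => (abs_entry_le_l2_opNorm _ a k).trans h.norm_cross_le) ?_ (by positivity) ?_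
    · rw [lt_div_iff₀ (by positivity)]
      nlinarith
    · have h5 : ∑ k, (Xᵀ * Y) a k * W k a = ∑ j, (Y * W) j a * X j a := by
        rw [← mul_apply, Matrix.mul_assoc, mul_apply]
        exact Finset.sum_congr rfl fun j _ => by rw [transpose_apply, mul_comm]
      rw [h5]; exact hsign a
  · have h5 : ∀ k, (centering n * Y) i k =
        (centering n * X) i k + (centering n * (Y - X)) i k := fun k => by
      rw [← Matrix.add_apply, ← Matrix.mul_add, add_sub_cancel]
    have h6 : ∀ k, |(centering n * (Y - X)) i k| ≤ c / 2 := fun k => by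
      rw [← unitRow_mul_apply i (centering n * (Y - X)) () k]
      exact (abs_entry_le_l2_opNorm _ _ _).trans ((h.norm_unitRow_centering_sub_le hE hi).trans h4)
    have h7 : ∀ k, |(centering n * X) i k| ≤ 2 * b := fun k => by
      rw [← unitRow_mul_apply i (centering n * X) () k]
      exact (abs_entry_le_l2_opNorm _ _ _).trans (h.norm_unitRow_centering_factor hi)
    -- With this, the entries of the row of the centered `Y` are at most `2 * b + c / 2 ≤ 3 * b`,
    -- while those of the centered `X` are at least `c`, leaving `p = c / 2`; hence `12 * b * d * ε
    -- < c`.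
    have hc2 : c ≤ 2 * b := (hcZ a).trans ((le_abs_self _).trans (h7 a))
    refine neg_half_lt_diag_of_dotProduct_nonneg hε hoff (u := (centering n * Y) i) (p := c / 2)
      (q := 3 * b) ?_ (fun k => ?_) ?_ (by positivity) ?_
    · rw [h5]
      linarith [hcZ a, (abs_le.1 (h6 a)).1]
    · rw [h5]
      refine (abs_add_le _ _).trans ?_
      linarith [h6 k, h7 k]
    · linarith
    · rw [← mul_apply, Matrix.mul_assoc]; exact hsign a

end AlignedEmbedding

/-- The rotation indeterminacy of the embedding `Y` of `X * Xᵀ + E` is resolved, either by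
alignment with `X`, or by a diagonal second moment matrix and a sign convention. -/
def IsResolved {n d : ℕ} (b c : ℝ) (X : Matrix (Fin n) (Fin d) ℝ)
    (E : Matrix (Fin n) (Fin n) ℝ) (Y : Matrix (Fin n) (Fin d) ℝ) : Prop :=
  IsNearestRotation Y X ∨
    ((secondMoment (centering n * X)).IsDiag ∧
      (∀ a a', a ≠ a' → c ≤ |secondMoment (centering n * X) a a -
        secondMoment (centering n * X) a' a'|) ∧
      HasMatchingDiagonalGram (centering n * Y) (centering n * X) ∧
      ((∀ a, 0 ≤ ∑ j, Y j a * X j a) ∨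
        ∃ i, IsTameRow b X E i ∧ (∀ a, c ≤ (centering n * X) i a) ∧
          ∀ a, 0 ≤ (centering n * Y) i a))

/-- First order expansion of a row of the centered spectral embedding of `X * Xᵀ + E`, on the
event that the noise `E` is tame. -/
theorem exists_norm_unitRow_centering_sub_expansion_le (d : ℕ) {b c : ℝ} (hb : 1 ≤ b)
    (hd : (d : ℝ) ≤ b) (hc : 0 < c) : ∃ C : ℝ, ∀ᶠ n : ℕ in atTop,
    ∀ (X Y : Matrix (Fin n) (Fin d) ℝ) (E : Matrix (Fin n) (Fin n) ℝ) (i : Fin n),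
      (∀ v, n / b * (v ⬝ᵥ v) ≤ (X *ᵥ v) ⬝ᵥ (X *ᵥ v)) → ‖X‖ ^ 2 ≤ n → IsTameNoise b X E →
      IsTameRow b X E i → IsRotatedASE (X * Xᵀ + E) Y → IsResolved b c X E Y →
      ‖unitRow i * (centering n * Y - centering n * X) - unitRow i * E * X * (Xᵀ * X)⁻¹‖ ≤
        C / n := by
  have hb0 : 0 < b := by linarith
  have hlim : ∀ p : ℝ, Tendsto (fun n : ℕ => p / n) atTop (𝓝 0) := fun p =>
    tendsto_const_div_atTop_nhds_zero_nat p
  have hlim' : Tendsto (fun n : ℕ => 30000000 * b ^ 21 / √(n : ℝ)) atTop (𝓝 0) :=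
    Tendsto.const_div_atTop (Real.tendsto_sqrt_atTop.comp tendsto_natCast_atTop_atTop) _
  set ε : ℕ → ℝ := fun n => 100000000 * b ^ 18 / c / n with hεdef
  -- The first summand is the error for an aligned embedding. The second is the size of a centered
  -- row times `n * d * ε n`, the bound on `n * ‖W - 1‖`.
  refine ⟨29000000 * b ^ 21 + 40000000 * b ^ 21 * (d * (100000000 * b ^ 18 / c)), ?_⟩
  have hmul : ∀ q : ℝ, Tendsto (fun n : ℕ => q * ε n) atTop (𝓝 0) := fun q => by
    simpa using (hlim (100000000 * b ^ 18 / c)).const_mul q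
  filter_upwards [eventually_gt_atTop 0, (hmul (16 * b * d)).eventually_lt_const one_pos,
    (hmul (12 * b * d)).eventually_lt_const hc,
    (hmul (4 * d)).eventually_lt_const one_pos,
    (hmul (2 * d ^ 2)).eventually_lt_const one_pos,
    tendsto_natCast_atTop_atTop.eventually_ge_atTop (6800 * b ^ 9),
    hlim'.eventually_le_const (show (0 : ℝ) < c / 2 by positivity)]
    with n hn h1 h2 h3 h4 h5 h6 X Y E i hcoer hX hE hi hY hres
  have hn' : (0 : ℝ) < n := Nat.cast_pos.2 hn
  have hε : 0 ≤ ε n := by positivity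
  have haligned : ∀ Y', IsRotatedASE (X * Xᵀ + E) Y' → IsNearestRotation Y' X →
      AlignedEmbedding b X E Y' := fun Y' hY' hnear =>
    ⟨hb, hd, hn, hcoer, hX, hE.noise, hE.noise_factor, hE.factor_noise_factor, hE.symm, hY',
      hnear.posSemidef⟩
  rw [← Matrix.mul_sub (centering n)]
  rcases hres with hnear | ⟨hdiag, hsep, hmatch, hsign⟩
  · refine ((haligned Y hY hnear).norm_unitRow_centering_sub_expansion hE hi).trans ?_
    gcongr
    exact le_add_of_nonneg_right (by positivity)
  -- The expansion holds for the aligned embedding `Y * W`; it passes to `Y` once `Wᵀ` is shown to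
  -- be `1 + O(1/n)`.
  · obtain ⟨W, hW, hnear⟩ := exists_isNearestRotation X Y
    set Y' := Y * W with hY'
    have h := haligned Y' (hY.mul_orthogonal hW) hnear
    have hWt : Wᵀ ∈ orthogonalGroup (Fin d) ℝ := mem_orthogonalGroup_of_transpose_mul
      (by rw [transpose_transpose, mul_transpose_self_of_mem_orthogonalGroup hW])
    have hYY' : Y = Y' * Wᵀ := by
      rw [hY', Matrix.mul_assoc, mul_transpose_self_of_mem_orthogonalGroup hW, Matrix.mul_one]
    rw [hYY'] at hmatch hsign
    have hεeq : 2 * (50000000 * b ^ 18 / n) / c = ε n := by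
      rw [hεdef]; field_simp; norm_num
    have hoff := h.abs_offDiag_le hE hWt hc hdiag hsep hmatch (by
      have : 4 * d ^ 2 * (50000000 * b ^ 18 / n) = c * (2 * d ^ 2 * ε n) := by
        rw [← hεeq]; field_simp; ring
      rw [this]
      exact mul_le_of_le_one_right hc.le h4.le)
    rw [hεeq] at hoff
    have hd1 := h.neg_half_lt_diag hE hc hε hoff h1 h2 h5 h6 hsign
    have hW1 := l2_opNorm_sub_one_le hWt hε h3.le hoff hd1
    have hdec : unitRow i * (centering n * (Y - X)) - unitRow i * E * X * (Xᵀ * X)⁻¹ =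
        (unitRow i * (centering n * (Y' - X)) - unitRow i * E * X * (Xᵀ * X)⁻¹) +
          unitRow i * (centering n * Y') * (Wᵀ - 1) := by
      rw [hYY']
      simp only [Matrix.mul_sub, Matrix.mul_one, Matrix.mul_assoc]
      abel
    rw [hdec]
    refine (norm_add_le _ _).trans ((add_le_add (h.norm_unitRow_centering_sub_expansion hE hi)
      (l2_opNorm_mul_le_of_le (h.norm_unitRow_centering_embedding hE hi) hW1)).trans_eq ?_)
    rw [hεdef]
    field_simp

end RotationResolution

/-! ### Second moments of products of independent symmetric noise. -/

section SecondMoments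

variable {Ω : Type*} [MeasurableSpace Ω] {μ : Measure Ω}

/-- `f` is integrable, with mean at most `B`. -/
def HasMeanLE (μ : Measure Ω) (f : Ω → ℝ) (B : ℝ) : Prop :=
  Integrable f μ ∧ ∫ ω, f ω ∂μ ≤ B

namespace HasMeanLE

variable {f g : Ω → ℝ} {B B' : ℝ}

theorem mono (h : HasMeanLE μ f B) (hB : B ≤ B') : HasMeanLE μ f B' := ⟨h.1, h.2.trans hB⟩

theorem add (hf : HasMeanLE μ f B) (hg : HasMeanLE μ g B') :
    HasMeanLE μ (fun ω => f ω + g ω) (B + B') :=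
  ⟨hf.1.add hg.1, by rw [integral_add hf.1 hg.1]; exact add_le_add hf.2 hg.2⟩

theorem const_mul (hf : HasMeanLE μ f B) {c : ℝ} (hc : 0 ≤ c) :
    HasMeanLE μ (fun ω => c * f ω) (c * B) :=
  ⟨hf.1.const_mul c, by rw [integral_const_mul]; exact mul_le_mul_of_nonneg_left hf.2 hc⟩

theorem div_const (hf : HasMeanLE μ f B) {c : ℝ} (hc : 0 ≤ c) :
    HasMeanLE μ (fun ω => f ω / c) (B / c) := by
  simpa only [inv_mul_eq_div] using hf.const_mul (inv_nonneg.2 hc)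

theorem sum {ι : Type*} {s : Finset ι} {f : ι → Ω → ℝ} {B : ι → ℝ}
    (h : ∀ i ∈ s, HasMeanLE μ (f i) (B i)) :
    HasMeanLE μ (fun ω => ∑ i ∈ s, f i ω) (∑ i ∈ s, B i) :=
  ⟨integrable_finsetSum s fun i hi => (h i hi).1, by
    rw [integral_finsetSum s fun i hi => (h i hi).1]
    exact Finset.sum_le_sum fun i hi => (h i hi).2⟩

theorem mono_fun [IsFiniteMeasure μ] (hg : HasMeanLE μ g B) (hf : AEStronglyMeasurable f μ)
    (h0 : ∀ ω, 0 ≤ f ω) (h : ∀ ω, f ω ≤ g ω) : HasMeanLE μ f B := by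
  have hint : Integrable f μ := hg.1.mono' hf (ae_of_all _ fun ω => by
    rw [Real.norm_eq_abs, abs_of_nonneg (h0 ω)]; exact h ω)
  exact ⟨hint, (integral_mono hint hg.1 h).trans hg.2⟩

end HasMeanLE

variable [IsProbabilityMeasure μ]

theorem hasMeanLE_const (c : ℝ) : HasMeanLE μ (fun _ => c) c :=
  ⟨integrable_const c, by simp⟩

/-- Second moment of a linear combination of bounded orthogonal random variables. -/
theorem hasMeanLE_sq_sum_of_orthogonal {T : Type*} [Fintype T] {f : T → Ω → ℝ}
    (hf : ∀ t, Measurable (f t)) (hb : ∀ t ω, |f t ω| ≤ 1)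
    (horth : ∀ s t, s ≠ t → ∫ ω, f s ω * f t ω ∂μ = 0) (c : T → ℝ) :
    HasMeanLE μ (fun ω => (∑ t, f t ω * c t) ^ 2) (∑ t, c t ^ 2) := by
  classical
  have hint : ∀ s t, Integrable (fun ω => f s ω * f t ω) μ := fun s t => by
    refine Integrable.of_bound ((hf s).mul (hf t)).aestronglyMeasurable 1 (ae_of_all _ fun ω => ?_)
    rw [Real.norm_eq_abs, abs_mul]
    exact mul_le_one₀ (hb s ω) (abs_nonneg _) (hb t ω)
  have hexp : ∀ ω, (∑ t, f t ω * c t) ^ 2 = ∑ s, ∑ t, f s ω * f t ω * (c s * c t) := by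
    intro ω
    rw [sq, Finset.sum_mul_sum]
    exact Finset.sum_congr rfl fun s _ => Finset.sum_congr rfl fun t _ => by ring
  simp only [hexp]
  refine HasMeanLE.sum fun s _ => ?_
  refine ⟨integrable_finsetSum _ fun t _ => (hint s t).mul_const _, ?_⟩
  rw [integral_finsetSum _ fun t _ => (hint s t).mul_const _,
    Finset.sum_eq_single s (fun t _ hts => by
      rw [integral_mul_const, horth s t hts.symm, zero_mul]) (by simp), integral_mul_const]
  have h1 : ∫ ω, f s ω * f s ω ∂μ ≤ 1 := by
    refine (integral_mono (hint s s) (integrable_const 1) fun ω => ?_).trans_eq (by simp)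
    have := mul_le_one₀ (hb s ω) (abs_nonneg _) (hb s ω)
    rwa [abs_mul_abs_self] at this
  nlinarith [sq_nonneg (c s)]

/-- A product of powers of independent random variables has mean zero if one of the factors is
a centered random variable. -/
theorem integral_prod_pow_eq_zero {κ : Type*} [Fintype κ] {η : κ → Ω → ℝ}
    (hη : ∀ e, Measurable (η e)) (hind : iIndepFun η μ) {m : κ → ℕ} {a : κ} (ha : m a = 1)
    (hmean : ∫ ω, η a ω ∂μ = 0) : ∫ ω, ∏ e, η e ω ^ m e ∂μ = 0 := by
  rw [hind.integral_fun_prod_comp (f := fun e x => x ^ m e) (fun e => (hη e).aemeasurable)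
    (fun e => (measurable_id.pow_const (m e)).aestronglyMeasurable)]
  refine Finset.prod_eq_zero (Finset.mem_univ a) ?_
  simpa [ha] using hmean

theorem integral_mul_eq_zero_of_ne {κ : Type*} [Fintype κ] {η : κ → Ω → ℝ}
    (hη : ∀ e, Measurable (η e)) (hind : iIndepFun η μ) (hmean : ∀ e, ∫ ω, η e ω ∂μ = 0)
    {a b : κ} (hab : a ≠ b) : ∫ ω, η a ω * η b ω ∂μ = 0 := by
  classical
  rw [← integral_prod_pow_eq_zero hη hind (a := a)
    (m := fun e => (if e = a then 1 else 0) + (if e = b then 1 else 0)) (by simp [hab]) (hmean a)]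
  congr 1
  ext ω
  simp only [pow_add, Finset.prod_mul_distrib]
  simp [pow_ite]

/-- Only `a` has to differ from the other indices. These may coincide, so the product is written
with exponents that are sums of indicators. -/
theorem integral_mul_mul_mul_eq_zero_of_ne {κ : Type*} [Fintype κ] {η : κ → Ω → ℝ}
    (hη : ∀ e, Measurable (η e)) (hind : iIndepFun η μ) (hmean : ∀ e, ∫ ω, η e ω ∂μ = 0)
    {a b c d : κ} (hab : a ≠ b) (hac : a ≠ c) (had : a ≠ d) :
    ∫ ω, η a ω * η b ω * (η c ω * η d ω) ∂μ = 0 := by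
  classical
  rw [← integral_prod_pow_eq_zero hη hind (a := a)
    (m := fun e => (if e = a then 1 else 0) + (if e = b then 1 else 0) +
      ((if e = c then 1 else 0) + (if e = d then 1 else 0))) (by simp [hab, hac, had]) (hmean a)]
  congr 1
  ext ω
  simp only [pow_add, Finset.prod_mul_distrib]
  simp [pow_ite]

/-- `ξ` is a symmetric matrix with zero diagonal whose entries above the diagonal are independent,
centered and bounded by `1`. -/
structure IsSymmetricNoise (μ : Measure Ω) {n : ℕ} (ξ : Ω → Matrix (Fin n) (Fin n) ℝ) : Prop where
  measurable_entry : ∀ i j, Measurable fun ω => ξ ω i j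
  symm : ∀ ω i j, ξ ω i j = ξ ω j i
  diag_eq_zero : ∀ ω i, ξ ω i i = 0
  abs_le_one : ∀ ω i j, |ξ ω i j| ≤ 1
  mean_eq_zero : ∀ i j, ∫ ω, ξ ω i j ∂μ = 0
  indep : iIndepFun (fun (e : {e : Fin n × Fin n // e.1 < e.2}) ω => ξ ω e.1.1 e.1.2) μ

/-- The pair of distinct indices `i` and `j`, in increasing order. -/
def orderedPair {n : ℕ} (i j : Fin n) (h : i ≠ j) : {e : Fin n × Fin n // e.1 < e.2} :=
  if hij : i < j then ⟨(i, j), hij⟩ else ⟨(j, i), lt_of_le_of_ne (not_lt.1 hij) h.symm⟩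

theorem orderedPair_eq_iff {n : ℕ} {i j k l : Fin n} (h : i ≠ j) (h' : k ≠ l) :
    orderedPair i j h = orderedPair k l h' ↔ (i = k ∧ j = l) ∨ (i = l ∧ j = k) := by
  unfold orderedPair
  split_ifs with h1 h2 h2 <;> simp only [Subtype.mk.injEq, Prod.mk.injEq] <;> omega

namespace IsSymmetricNoise

variable {n : ℕ} {ξ : Ω → Matrix (Fin n) (Fin n) ℝ}

theorem apply_orderedPair (h : IsSymmetricNoise μ ξ) (ω : Ω) {i j : Fin n} (hij : i ≠ j) :
    ξ ω (orderedPair i j hij).1.1 (orderedPair i j hij).1.2 = ξ ω i j := by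
  unfold orderedPair
  split_ifs
  · rfl
  · exact h.symm ω j i

theorem integral_mul_eq_zero (h : IsSymmetricNoise μ ξ) {i j k l : Fin n}
    (h1 : ¬(i = k ∧ j = l)) (h2 : ¬(i = l ∧ j = k)) : ∫ ω, ξ ω i j * ξ ω k l ∂μ = 0 := by
  by_cases hij : i = j
  · simp [hij, h.diag_eq_zero]
  by_cases hkl : k = l
  · simp [hkl, h.diag_eq_zero]
  simp only [← h.apply_orderedPair _ hij, ← h.apply_orderedPair _ hkl]
  refine integral_mul_eq_zero_of_ne (η := fun (e : {e : Fin n × Fin n // e.1 < e.2}) ω =>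
    ξ ω e.1.1 e.1.2) (fun e => h.measurable_entry _ _) h.indep (fun e => h.mean_eq_zero _ _) ?_
  rw [Ne, orderedPair_eq_iff]
  tauto

theorem integral_mul_mul_mul_eq_zero (h : IsSymmetricNoise μ ξ) {i j k l p q r s : Fin n}
    (h1 : ¬(i = k ∧ j = l)) (h2 : ¬(i = l ∧ j = k)) (h3 : ¬(i = p ∧ j = q))
    (h4 : ¬(i = q ∧ j = p)) (h5 : ¬(i = r ∧ j = s)) (h6 : ¬(i = s ∧ j = r)) :
    ∫ ω, ξ ω i j * ξ ω k l * (ξ ω p q * ξ ω r s) ∂μ = 0 := by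
  by_cases hij : i = j
  · simp [hij, h.diag_eq_zero]
  by_cases hkl : k = l
  · simp [hkl, h.diag_eq_zero]
  by_cases hpq : p = q
  · simp [hpq, h.diag_eq_zero]
  by_cases hrs : r = s
  · simp [hrs, h.diag_eq_zero]
  simp only [← h.apply_orderedPair _ hij, ← h.apply_orderedPair _ hkl,
    ← h.apply_orderedPair _ hpq, ← h.apply_orderedPair _ hrs]
  refine integral_mul_mul_mul_eq_zero_of_ne (η := fun (e : {e : Fin n × Fin n // e.1 < e.2}) ω =>
    ξ ω e.1.1 e.1.2) (fun e => h.measurable_entry _ _) h.indep (fun e => h.mean_eq_zero _ _)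
    ?_ ?_ ?_ <;> rw [Ne, orderedPair_eq_iff] <;> tauto

theorem hasMeanLE_mulVec (h : IsSymmetricNoise μ ξ) (i : Fin n) (v : Fin n → ℝ) :
    HasMeanLE μ (fun ω => (ξ ω *ᵥ v) i ^ 2) (∑ k, v k ^ 2) :=
  hasMeanLE_sq_sum_of_orthogonal (f := fun k ω => ξ ω i k) (fun k => h.measurable_entry i k)
    (fun k ω => h.abs_le_one ω i k)
    (fun s t hst => h.integral_mul_eq_zero (by tauto) (by
      rintro ⟨rfl, rfl⟩; exact hst rfl)) v

/-- Entries above the diagonal are orthogonal, so the form is folded onto them, with weights `u i *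
v j + u j * v i`. The factor `4` comes from `(x + y)² ≤ 2 x² + 2 y²`, summed over all ordered pairs.
-/
theorem hasMeanLE_bilin (h : IsSymmetricNoise μ ξ) (u v : Fin n → ℝ) :
    HasMeanLE μ (fun ω => (u ⬝ᵥ ξ ω *ᵥ v) ^ 2) (4 * (∑ i, u i ^ 2) * ∑ i, v i ^ 2) := by
  have h1 : ∀ ω, u ⬝ᵥ ξ ω *ᵥ v = ∑ e : Fin n × Fin n,
      (if e.1 < e.2 then ξ ω e.1 e.2 else 0) * (u e.1 * v e.2 + u e.2 * v e.1) := by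
    intro ω
    have h2 : ∑ i, ∑ j, (if i < j then ξ ω i j else 0) * (u j * v i) =
        ∑ i, ∑ j, (if j < i then ξ ω i j else 0) * (u i * v j) := by
      rw [Finset.sum_comm]
      exact Finset.sum_congr rfl fun i _ => Finset.sum_congr rfl fun j _ => by rw [h.symm ω i j]
    rw [Fintype.sum_prod_type]
    simp only [mul_add, Finset.sum_add_distrib]
    rw [h2, ← Finset.sum_add_distrib]
    refine Finset.sum_congr rfl fun i _ => ?_
    rw [← Finset.sum_add_distrib, Matrix.mulVec, dotProduct, Finset.mul_sum]
    refine Finset.sum_congr rfl fun j _ => ?_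
    rcases lt_trichotomy i j with hij | hij | hij
    · simp [hij, hij.not_gt]; ring
    · simp [hij, h.diag_eq_zero]
    · simp [hij, hij.not_gt]; ring
  simp only [h1]
  refine (hasMeanLE_sq_sum_of_orthogonal
    (f := fun (e : Fin n × Fin n) ω => if e.1 < e.2 then ξ ω e.1 e.2 else 0) (fun e => ?_)
    (fun e ω => ?_) (fun s t hst => ?_) _).mono ?_
  · split_ifs
    · exact h.measurable_entry _ _
    · exact measurable_const
  · split_ifs
    · exact h.abs_le_one _ _ _
    · simp
  · by_cases hs : s.1 < s.2
    · by_cases ht : t.1 < t.2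
      · simp only [hs, ht, if_true]
        refine h.integral_mul_eq_zero ?_ ?_
        · rintro ⟨h2, h3⟩; exact hst (Prod.ext h2 h3)
        · rintro ⟨h2, h3⟩; omega
      · simp [ht]
    · simp [hs]
  · rw [Fintype.sum_prod_type]
    calc ∑ i, ∑ j, (u i * v j + u j * v i) ^ 2
        ≤ ∑ i, ∑ j, (2 * (u i ^ 2 * v j ^ 2) + 2 * (v i ^ 2 * u j ^ 2)) :=
          Finset.sum_le_sum fun i _ => Finset.sum_le_sum fun j _ => by
            nlinarith [sq_nonneg (u i * v j - u j * v i)]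
      _ = 4 * (∑ i, u i ^ 2) * ∑ i, v i ^ 2 := by
          simp only [Finset.sum_add_distrib, ← Finset.mul_sum, ← Finset.sum_mul]
          ring

/-- Paths `i → j → i` contribute the deterministic bound `n * |v i|`. Paths `i → j → k` with `k ≠ i`
have pairwise orthogonal weights, since two different ones always leave some edge that is used only
once. -/
theorem hasMeanLE_mul_mulVec (h : IsSymmetricNoise μ ξ) (i : Fin n) (v : Fin n → ℝ) :
    HasMeanLE μ (fun ω => ((ξ ω * ξ ω) *ᵥ v) i ^ 2)
      (2 * n ^ 2 * v i ^ 2 + 2 * n * ∑ k, v k ^ 2) := by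
  set f : Fin n × Fin n → Ω → ℝ := fun e ω => if e.2 = i then 0 else ξ ω i e.1 * ξ ω e.1 e.2
    with hf
  have h1 : ∀ ω, ((ξ ω * ξ ω) *ᵥ v) i =
      (∑ j, ξ ω i j ^ 2) * v i + ∑ e, f e ω * v e.2 := by
    intro ω
    rw [← Matrix.mulVec_mulVec, Fintype.sum_prod_type, Matrix.mulVec, dotProduct, Finset.sum_mul,
      ← Finset.sum_add_distrib]
    refine Finset.sum_congr rfl fun j _ => ?_
    rw [Matrix.mulVec, dotProduct, Finset.mul_sum,
      ← Finset.add_sum_erase _ _ (Finset.mem_univ i)]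
    rw [← Finset.add_sum_erase _ (fun y => f (j, y) ω * v (j, y).2) (Finset.mem_univ i)]
    have h2 : f (j, i) ω = 0 := by simp [hf]
    rw [h2, h.symm ω j i, zero_mul, zero_add]
    congr 1
    · ring
    · refine Finset.sum_congr rfl fun k hk => ?_
      simp only [hf, (Finset.mem_erase.1 hk).1, if_false]
      ring
  have hfm : ∀ e, Measurable (f e) := fun e => by
    simp only [hf]
    split_ifs
    · exact measurable_const
    · exact (h.measurable_entry _ _).mul (h.measurable_entry _ _)
  have h3 : HasMeanLE μ (fun ω => (∑ e, f e ω * v e.2) ^ 2) (∑ e : Fin n × Fin n, v e.2 ^ 2) := by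
    refine hasMeanLE_sq_sum_of_orthogonal hfm (fun e ω => ?_) (fun s t hst => ?_) _
    · simp only [hf]
      split_ifs
      · simp
      · rw [abs_mul]
        exact mul_le_one₀ (h.abs_le_one _ _ _) (abs_nonneg _) (h.abs_le_one _ _ _)
    · by_cases hs : s.2 = i
      · simp [hf, hs]
      by_cases ht : t.2 = i
      · simp [hf, ht]
      simp only [hf, hs, ht, if_false]
      by_cases hsi : s.1 = i
      · simp [hsi, h.diag_eq_zero]
      by_cases hti : t.1 = i
      · simp [hti, h.diag_eq_zero]
      -- The edge that occurs only once is the second edge of `s` when the midpoints agree and its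
      -- first edge otherwise.
      by_cases hs12 : s.1 = t.1
      · have h2 : s.2 ≠ t.2 := fun h2 => hst (Prod.ext hs12 h2)
        have h5 : ∀ ω, ξ ω i s.1 * ξ ω s.1 s.2 * (ξ ω i t.1 * ξ ω t.1 t.2) =
            ξ ω s.1 s.2 * ξ ω i s.1 * (ξ ω i t.1 * ξ ω t.1 t.2) := fun ω => by ring
        simp only [h5]
        refine h.integral_mul_mul_mul_eq_zero ?_ ?_ ?_ ?_ ?_ ?_ <;> grind
      · refine h.integral_mul_mul_mul_eq_zero ?_ ?_ ?_ ?_ ?_ ?_ <;> grind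
  have h4 : ∑ e : Fin n × Fin n, v e.2 ^ 2 = n * ∑ k, v k ^ 2 := by
    rw [Fintype.sum_prod_type]; simp
  rw [h4] at h3
  have hmeas : Measurable fun ω => ((ξ ω * ξ ω) *ᵥ v) i := by
    simp only [h1]
    have := h.measurable_entry
    fun_prop
  refine (((hasMeanLE_const (μ := μ) (2 * n ^ 2 * v i ^ 2)).add
    (h3.const_mul zero_le_two)).mono_fun (hmeas.pow_const 2).aestronglyMeasurable
    (fun ω => sq_nonneg _) fun ω => ?_).mono (le_of_eq (by ring))
  rw [h1]
  have h5 : 0 ≤ ∑ j, ξ ω i j ^ 2 := by positivity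
  have h6 : ∑ j, ξ ω i j ^ 2 ≤ n := by
    refine (Finset.sum_le_card_nsmul _ _ 1 fun j _ => ?_).trans_eq (by simp)
    rw [← sq_abs]
    exact pow_le_one₀ (abs_nonneg _) (h.abs_le_one ω i j)
  have h7 : ((∑ j, ξ ω i j ^ 2) * v i) ^ 2 ≤ n ^ 2 * v i ^ 2 := by
    rw [mul_pow]
    gcongr
  refine (add_sq_le (a := (∑ j, ξ ω i j ^ 2) * v i) (b := ∑ e, f e ω * v e.2)).trans ?_
  linarith

end IsSymmetricNoise

end SecondMoments

/-! ### From mean square sizes to norm bounds. -/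

section TameNoise

open scoped Matrix.Norms.L2Operator
open Matrix

/-- The sum of the squares of the entries of a matrix. -/
def sumSq {m k : Type*} [Fintype m] [Fintype k] (M : Matrix m k ℝ) : ℝ := ∑ i, ∑ j, M i j ^ 2

theorem sumSq_nonneg {m k : Type*} [Fintype m] [Fintype k] (M : Matrix m k ℝ) : 0 ≤ sumSq M := by
  unfold sumSq; positivity

variable {n d : ℕ}

/-- Normalized sizes of the matrices that appear in `IsTameNoise`. -/
noncomputable def noiseSize (X : Matrix (Fin n) (Fin d) ℝ) (M : Matrix (Fin n) (Fin n) ℝ) : ℝ :=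
  (sumSq (M * X) + sumSq (Xᵀ * (M * X)) + sumSq (onesRow n * M) + sumSq (onesRow n * (M * X))) /
    n ^ 2 + sumSq (M * M) / n ^ 3

/-- Normalized sizes of the matrices that appear in `IsTameRow`. -/
noncomputable def rowNoiseSize (X : Matrix (Fin n) (Fin d) ℝ) (i : Fin n) (M : Matrix (Fin n) (Fin n) ℝ) : ℝ :=
  (sumSq (unitRow i * M * M) + sumSq (unitRow i * M * (M * X))) / n ^ 2 +
    sumSq (unitRow i * M * X) / n

section Mean

variable {Ω : Type*} [MeasurableSpace Ω] {μ : Measure Ω} [IsProbabilityMeasure μ]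
  {ξ : Ω → Matrix (Fin n) (Fin n) ℝ} {X : Matrix (Fin n) (Fin d) ℝ}

theorem HasMeanLE.sumSq {m k : Type*} [Fintype m] [Fintype k] {M : Ω → Matrix m k ℝ}
    {B : m → k → ℝ} (h : ∀ i j, HasMeanLE μ (fun ω => M ω i j ^ 2) (B i j)) :
    HasMeanLE μ (fun ω => sumSq (M ω)) (∑ i, ∑ j, B i j) :=
  HasMeanLE.sum fun i _ => HasMeanLE.sum fun j _ => h i j

theorem sumSq_eq_sum_col (X : Matrix (Fin n) (Fin d) ℝ) :
    sumSq X = ∑ a, ∑ i, X i a ^ 2 := Finset.sum_comm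

/-- The constant is `1 + 4 + 1 + 4` for the four terms over `n ^ 2`, plus `4` for the square of the
noise. -/
theorem IsSymmetricNoise.hasMeanLE_noiseSize (h : IsSymmetricNoise μ ξ) (hn : 0 < n)
    (hX : sumSq X ≤ n) : HasMeanLE μ (fun ω => noiseSize X (ξ ω)) 14 := by
  have hn' : (0 : ℝ) < n := Nat.cast_pos.2 hn
  have hX0 := sumSq_nonneg X
  have h1 : HasMeanLE μ (fun ω => sumSq (ξ ω * X)) (n ^ 2) := by
    refine (HasMeanLE.sumSq fun i a => h.hasMeanLE_mulVec i (fun k => X k a)).mono ?_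
    rw [← sumSq_eq_sum_col, Finset.sum_const, Finset.card_univ, Fintype.card_fin, nsmul_eq_mul, sq]
    gcongr
  have h2 : HasMeanLE μ (fun ω => sumSq (Xᵀ * (ξ ω * X))) (4 * n ^ 2) := by
    refine (HasMeanLE.sumSq fun a b =>
      h.hasMeanLE_bilin (fun k => X k a) (fun k => X k b)).mono ?_
    simp only [← Finset.mul_sum, ← Finset.sum_mul]
    rw [← sumSq_eq_sum_col, mul_assoc, ← sq]
    gcongr
  have h3 : HasMeanLE μ (fun ω => sumSq (onesRow n * ξ ω)) (n ^ 2) := by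
    have h4 : ∀ ω (u : Unit) j, (onesRow n * ξ ω) u j = (ξ ω *ᵥ fun _ => 1) j := by
      intro ω u j
      rw [onesRow_mul_apply, mulVec, dotProduct]
      exact Finset.sum_congr rfl fun i _ => by rw [h.symm ω, mul_one]
    refine (HasMeanLE.sumSq (B := fun _ _ => n) fun u j => ?_).mono (by simp [sq])
    simp only [h4]
    simpa using h.hasMeanLE_mulVec j (fun _ => 1)
  have h5 : HasMeanLE μ (fun ω => sumSq (onesRow n * (ξ ω * X))) (4 * n ^ 2) := by
    have h4 : ∀ ω (u : Unit) a, (onesRow n * (ξ ω * X)) u a =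
        (fun _ => 1) ⬝ᵥ ξ ω *ᵥ (fun k => X k a) := by
      intro ω u j
      rw [onesRow_mul_apply, dotProduct]
      simp only [one_mul]
      rfl
    refine (HasMeanLE.sumSq (B := fun _ a => 4 * n * ∑ k, X k a ^ 2) fun u a => ?_).mono ?_
    · simp only [h4]
      simpa using h.hasMeanLE_bilin (fun _ => 1) (fun k => X k a)
    · simp only [← Finset.mul_sum]
      rw [← sumSq_eq_sum_col, Finset.univ_unique, Finset.sum_singleton, sq, mul_assoc]
      gcongr
  have h6 : HasMeanLE μ (fun ω => sumSq (ξ ω * ξ ω)) (4 * n ^ 3) := by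
    refine (HasMeanLE.sumSq (B := fun i k => 2 * n ^ 2 * (if i = k then 1 else 0) + 2 * n)
      fun i k => ?_).mono (le_of_eq ?_)
    · have h7 := h.hasMeanLE_mul_mulVec i (Pi.single k 1)
      simp only [mulVec_single_one, col_apply] at h7
      refine h7.mono (le_of_eq ?_)
      simp [Pi.single_apply]
    · simp [Finset.sum_add_distrib]
      ring
  refine (((((h1.add h2).add h3).add h5).div_const (sq_nonneg (n : ℝ))).add
    (h6.div_const (pow_nonneg hn'.le 3))).mono (le_of_eq ?_)
  field_simp
  norm_num

/-- The constant is `4 + 4 + 1`, one summand for each term. -/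
theorem IsSymmetricNoise.hasMeanLE_rowNoiseSize (h : IsSymmetricNoise μ ξ) (hn : 0 < n)
    (hX : sumSq X ≤ n) {i : Fin n} (hi : ∑ a, X i a ^ 2 ≤ 1) :
    HasMeanLE μ (fun ω => rowNoiseSize X i (ξ ω)) 9 := by
  have hn' : (0 : ℝ) < n := Nat.cast_pos.2 hn
  have hX0 := sumSq_nonneg X
  have h1 : HasMeanLE μ (fun ω => sumSq (unitRow i * ξ ω * ξ ω)) (4 * n ^ 2) := by
    refine (HasMeanLE.sumSq (B := fun _ k => 2 * n ^ 2 * (if i = k then 1 else 0) + 2 * n)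
      fun u k => ?_).mono (le_of_eq ?_)
    · have h7 := h.hasMeanLE_mul_mulVec i (Pi.single k 1)
      simp only [mulVec_single_one, col_apply] at h7
      simp only [Matrix.mul_assoc, unitRow_mul_apply]
      refine h7.mono (le_of_eq ?_)
      simp [Pi.single_apply]
    · simp [Finset.sum_add_distrib]
      ring
  have h2 : HasMeanLE μ (fun ω => sumSq (unitRow i * ξ ω * (ξ ω * X))) (4 * n ^ 2) := by
    refine (HasMeanLE.sumSq (B := fun _ a => 2 * n ^ 2 * X i a ^ 2 + 2 * n * ∑ k, X k a ^ 2)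
      fun u a => ?_).mono ?_
    · simp only [Matrix.mul_assoc, unitRow_mul_apply]
      simp only [← Matrix.mul_assoc]
      exact h.hasMeanLE_mul_mulVec i (fun k => X k a)
    · rw [Finset.univ_unique, Finset.sum_singleton, Finset.sum_add_distrib, ← Finset.mul_sum,
        ← Finset.mul_sum, ← sumSq_eq_sum_col]
      nlinarith
  have h3 : HasMeanLE μ (fun ω => sumSq (unitRow i * ξ ω * X)) n := by
    refine (HasMeanLE.sumSq (B := fun _ a => ∑ k, X k a ^ 2) fun u a => ?_).mono ?_
    · simp only [Matrix.mul_assoc, unitRow_mul_apply]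
      exact h.hasMeanLE_mulVec i (fun k => X k a)
    · rwa [Finset.univ_unique, Finset.sum_singleton, ← sumSq_eq_sum_col]
  refine (((h1.add h2).div_const (sq_nonneg (n : ℝ))).add (h3.div_const hn'.le)).mono
    (le_of_eq ?_)
  field_simp
  norm_num

end Mean

variable {X : Matrix (Fin n) (Fin d) ℝ} {M : Matrix (Fin n) (Fin n) ℝ} {p : Fin n → ℝ}
  {L b : ℝ}

theorem norm_le_of_sumSq_le {m k : Type*} [Fintype m] [Fintype k] [DecidableEq k]
    [DecidableEq m] {M : Matrix m k ℝ} {C : ℝ} (hC : 0 ≤ C) (h : sumSq M ≤ C ^ 2) : ‖M‖ ≤ C :=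
  l2_opNorm_le_of_sum_sq_le hC h

theorem norm_diagonal_le_one (hp : ∀ i, 0 ≤ p i ∧ p i ≤ 1) : ‖diagonal p‖ ≤ 1 := by
  rw [l2_opNorm_diagonal, pi_norm_le_iff_of_nonneg zero_le_one]
  intro i
  rw [Real.norm_eq_abs, abs_of_nonneg (hp i).1]
  exact (hp i).2

theorem unitRow_mul_diagonal (i : Fin n) : unitRow i * diagonal p = p i • unitRow i := by
  ext u j
  rw [unitRow_mul_apply, Matrix.smul_apply, unitRow, of_apply, diagonal_apply]
  by_cases h : i = j <;> simp [h, eq_comm]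

/-- Noise of small size is tame, even after subtracting a bounded diagonal. -/
theorem isTameNoise_of_noiseSize_le (hn : 0 < n) (hX : sumSq X ≤ n) (hM : Mᵀ = M)
    (hp : ∀ i, 0 ≤ p i ∧ p i ≤ 1) (hL : 0 < L) (hb : √L + 1 ≤ b) (hnb : L * (8 * b) ^ 4 ≤ n)
    (hnb' : 8 * b ≤ n) (h : noiseSize X M ≤ L) : IsTameNoise b X (M - diagonal p) := by
  have hn' : (0 : ℝ) < n := Nat.cast_pos.2 hn
  have hsL := Real.sqrt_pos.2 hL
  have hb0 : 0 < b := by linarith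
  have hn1 : (1 : ℝ) ≤ n := Nat.one_le_cast.2 hn
  have hsn : √(n : ℝ) * √n = n := Real.mul_self_sqrt hn'.le
  have hsn1 : 1 ≤ √(n : ℝ) := Real.one_le_sqrt.2 hn1
  have hsnn : √(n : ℝ) ≤ n := by nlinarith
  have h0 : ∀ (k : ℕ) {s : ℝ}, s / n ^ k ≤ L → s ≤ L * n ^ k := fun k s hs =>
    (div_le_iff₀ (pow_pos hn' k)).1 hs
  have hq1 := sumSq_nonneg (M * X)
  have hq2 := sumSq_nonneg (Xᵀ * (M * X))
  have hq3 := sumSq_nonneg (onesRow n * M)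
  have hq4 := sumSq_nonneg (onesRow n * (M * X))
  have hq5 := sumSq_nonneg (M * M)
  unfold noiseSize at h
  have hA : sumSq (M * X) + sumSq (Xᵀ * (M * X)) + sumSq (onesRow n * M) +
      sumSq (onesRow n * (M * X)) ≤ L * n ^ 2 := by
    refine h0 2 ?_
    have : 0 ≤ sumSq (M * M) / (n : ℝ) ^ 3 := by positivity
    linarith
  have hB : sumSq (M * M) ≤ L * n ^ 3 := by
    refine h0 3 ?_
    have : 0 ≤ (sumSq (M * X) + sumSq (Xᵀ * (M * X)) + sumSq (onesRow n * M) +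
      sumSq (onesRow n * (M * X))) / (n : ℝ) ^ 2 := by positivity
    linarith
  have hsq : L * n ^ 2 = (√L * n) ^ 2 := by rw [mul_pow, Real.sq_sqrt hL.le]
  rw [hsq] at hA
  have hXn : ‖X‖ ≤ √n := norm_le_of_sumSq_le (Real.sqrt_nonneg _) (by rwa [Real.sq_sqrt hn'.le])
  have h1 : ‖M * X‖ ≤ √L * n := norm_le_of_sumSq_le (by positivity) (by linarith)
  have h2 : ‖Xᵀ * (M * X)‖ ≤ √L * n := norm_le_of_sumSq_le (by positivity) (by linarith)
  have h3 : ‖onesRow n * M‖ ≤ √L * n := norm_le_of_sumSq_le (by positivity) (by linarith)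
  have h4 : ‖onesRow n * (M * X)‖ ≤ √L * n := norm_le_of_sumSq_le (by positivity) (by linarith)
  -- For symmetric `M`, `‖M‖ ^ 4 = ‖M * M‖ ^ 2` is at most the squared Frobenius norm of `M * M`,
  -- which is `O(n ^ 3)`. So `‖M‖ = O(n ^ (3 / 4))`, which is weaker than the true order `√n` but
  -- still `o(n)`.
  have h5 : ‖M‖ ≤ n / (8 * b) := by
    have h6 : ‖M‖ ^ 4 ≤ L * n ^ 3 := by
      have h7 : ‖M * M‖ = ‖M‖ ^ 2 := by
        rw [← l2_opNorm_transpose_mul_self, hM]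
      calc ‖M‖ ^ 4 = ‖M * M‖ ^ 2 := by rw [h7]; ring
        _ ≤ sumSq (M * M) := l2_opNorm_sq_le_sum_sq _
        _ ≤ _ := hB
    refine le_of_pow_le_pow_left₀ (n := 4) (by norm_num) (by positivity) (h6.trans ?_)
    rw [div_pow, le_div_iff₀ (by positivity)]
    calc L * (n : ℝ) ^ 3 * (8 * b) ^ 4 = L * (8 * b) ^ 4 * (n : ℝ) ^ 3 := by ring
      _ ≤ n * (n : ℝ) ^ 3 := by gcongr
      _ = (n : ℝ) ^ 4 := by ring
  have hD := norm_diagonal_le_one hp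
  have hDX : ‖diagonal p * X‖ ≤ √n :=
    (l2_opNorm_mul_le_of_le hD hXn).trans_eq (one_mul _)
  have hbn : √L * n + n ≤ b * n := by nlinarith
  have hones := norm_onesRow_le n
  refine ⟨?_, ?_, ?_, ?_, ?_, ?_⟩
  · rw [transpose_sub, hM, diagonal_transpose]
  · refine (norm_sub_le _ _).trans ?_
    have h6 : 1 ≤ n / (8 * b) := by rwa [le_div_iff₀ (by positivity), one_mul]
    have h7 : n / b / 4 = n / (8 * b) + n / (8 * b) := by field_simp; ring
    linarith
  · rw [Matrix.sub_mul]
    refine (norm_sub_le _ _).trans ?_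
    linarith
  · rw [Matrix.sub_mul, Matrix.mul_sub]
    refine (norm_sub_le _ _).trans ?_
    have := l2_opNorm_mul_le_of_le ((l2_opNorm_transpose X).trans_le hXn) hDX
    linarith
  · rw [Matrix.mul_sub]
    refine (norm_sub_le _ _).trans ?_
    have := l2_opNorm_mul_le_of_le hones hD
    linarith
  · rw [Matrix.sub_mul, Matrix.mul_sub]
    refine (norm_sub_le _ _).trans ?_
    have := l2_opNorm_mul_le_of_le hones hDX
    linarith

/-- Rows of noise of small size are tame, even after subtracting a bounded diagonal. -/
theorem isTameRow_of_rowNoiseSize_le (hn : 0 < n) (hX : sumSq X ≤ n) {i : Fin n}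
    (hi : ∑ a, X i a ^ 2 ≤ 1) (hM1 : ∀ j, |M i j| ≤ 1)
    (hp : ∀ i, 0 ≤ p i ∧ p i ≤ 1) (hL : 0 < L) (hb : 2 * √L + 4 ≤ b)
    (h : rowNoiseSize X i M ≤ L) : IsTameRow b X (M - diagonal p) i := by
  have hn' : (0 : ℝ) < n := Nat.cast_pos.2 hn
  have hsL := Real.sqrt_pos.2 hL
  have hb0 : 0 < b := by linarith
  have hn1 : (1 : ℝ) ≤ n := Nat.one_le_cast.2 hn
  have hsn : √(n : ℝ) * √n = n := Real.mul_self_sqrt hn'.le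
  have hsn1 : 1 ≤ √(n : ℝ) := Real.one_le_sqrt.2 hn1
  have hsnn : √(n : ℝ) ≤ n := by nlinarith
  have hq1 := sumSq_nonneg (unitRow i * M * M)
  have hq2 := sumSq_nonneg (unitRow i * M * (M * X))
  have hq3 := sumSq_nonneg (unitRow i * M * X)
  unfold rowNoiseSize at h
  have hA : sumSq (unitRow i * M * M) + sumSq (unitRow i * M * (M * X)) ≤ (√L * n) ^ 2 := by
    rw [mul_pow, Real.sq_sqrt hL.le, ← div_le_iff₀ (by positivity)]
    have : 0 ≤ sumSq (unitRow i * M * X) / (n : ℝ) := by positivity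
    linarith
  have hB : sumSq (unitRow i * M * X) ≤ (√L * √n) ^ 2 := by
    rw [mul_pow, Real.sq_sqrt hL.le, Real.sq_sqrt hn'.le, ← div_le_iff₀ hn']
    have : 0 ≤ (sumSq (unitRow i * M * M) + sumSq (unitRow i * M * (M * X))) / (n : ℝ) ^ 2 := by
      positivity
    linarith
  have hXn : ‖X‖ ≤ √n := norm_le_of_sumSq_le (Real.sqrt_nonneg _) (by rwa [Real.sq_sqrt hn'.le])
  have h1 : ‖unitRow i * M * M‖ ≤ √L * n := norm_le_of_sumSq_le (by positivity) (by linarith)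
  have h2 : ‖unitRow i * M * (M * X)‖ ≤ √L * n :=
    norm_le_of_sumSq_le (by positivity) (by linarith)
  have h3 : ‖unitRow i * M * X‖ ≤ √L * √n := norm_le_of_sumSq_le (by positivity) hB
  have h4 : ‖unitRow i * M‖ ≤ √n := by
    refine norm_le_of_sumSq_le (Real.sqrt_nonneg _) ?_
    rw [Real.sq_sqrt hn'.le, sumSq, Finset.univ_unique, Finset.sum_singleton]
    refine (Finset.sum_le_card_nsmul _ _ 1 fun j _ => ?_).trans_eq (by simp)
    rw [unitRow_mul_apply, ← sq_abs]
    exact pow_le_one₀ (abs_nonneg _) (hM1 j)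
  have h5 : ‖unitRow i * X‖ ≤ 1 := by
    refine norm_le_of_sumSq_le zero_le_one ?_
    rw [sumSq, Finset.univ_unique, Finset.sum_singleton]
    simpa only [unitRow_mul_apply, one_pow] using hi
  have hpi : ‖p i‖ ≤ 1 := by
    rw [Real.norm_eq_abs, abs_of_nonneg (hp i).1]; exact (hp i).2
  have hD := norm_diagonal_le_one hp
  have hDX : ‖diagonal p * X‖ ≤ √n :=
    (l2_opNorm_mul_le_of_le hD hXn).trans_eq (one_mul _)
  have hrE : unitRow i * (M - diagonal p) = unitRow i * M - p i • unitRow i := by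
    rw [Matrix.mul_sub, unitRow_mul_diagonal]
  have hsmul : ∀ {k : Type} [Fintype k] [DecidableEq k] (N : Matrix Unit k ℝ),
      ‖p i • N‖ ≤ ‖N‖ := fun N => by
    rw [norm_smul]; exact mul_le_of_le_one_left (norm_nonneg _) hpi
  have h6 : ‖unitRow i * (M - diagonal p)‖ ≤ 2 * √n := by
    rw [hrE]
    refine (norm_sub_le _ _).trans ?_
    linarith [hsmul (unitRow i), norm_unitRow_le i]
  have h7 : ‖unitRow i * (M - diagonal p) * X‖ ≤ √L * √n + 1 := by
    rw [hrE, Matrix.sub_mul, Matrix.smul_mul]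
    refine (norm_sub_le _ _).trans ?_
    linarith [hsmul (unitRow i * X)]
  have hbn : (2 * √L + 4) * n ≤ b * n := by gcongr
  have hbn' : (2 * √L + 4) * √n ≤ b * √n := by gcongr
  have hLn : √L * √n ≤ √L * n := by gcongr
  have hLn0 : 0 ≤ √L * √n := by positivity
  refine ⟨by linarith, by linarith, by linarith, ?_, ?_⟩
  -- Only the product of two copies of the noise needs its moment bound; the terms with the diagonal
  -- are of order `√n`.
  · have h8 : unitRow i * (M - diagonal p) * (M - diagonal p) = unitRow i * M * M -
        unitRow i * M * diagonal p - p i • (unitRow i * (M - diagonal p)) := by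
      nth_rw 1 [hrE]
      rw [Matrix.sub_mul, Matrix.mul_sub (unitRow i * M), Matrix.smul_mul]
    rw [h8]
    refine (norm_sub_le _ _).trans ((add_le_add_left (norm_sub_le _ _) _).trans ?_)
    have h9 := l2_opNorm_mul_le_of_le h4 hD
    linarith [hsmul (unitRow i * (M - diagonal p))]
  · have h8 : unitRow i * (M - diagonal p) * ((M - diagonal p) * X) = unitRow i * M * (M * X) -
        unitRow i * M * (diagonal p * X) - p i • (unitRow i * (M - diagonal p) * X) := by
      nth_rw 1 [hrE]
      rw [Matrix.sub_mul, Matrix.sub_mul M, Matrix.mul_sub (unitRow i * M), Matrix.smul_mul,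
        Matrix.mul_assoc (unitRow i) (M - diagonal p), Matrix.sub_mul M]
    rw [h8]
    refine (norm_sub_le _ _).trans ((add_le_add_left (norm_sub_le _ _) _).trans ?_)
    have h9 := l2_opNorm_mul_le_of_le h4 hDX
    linarith [hsmul (unitRow i * (M - diagonal p) * X)]

end TameNoise

/-! ### Characteristic functions of sums of independent bounded variables. -/

section CharacteristicFunctions

/-- Telescoping: exchange one factor at a time, all others having norm at most one. -/
theorem norm_prod_sub_prod_le_sum {ι : Type*} (s : Finset ι) {f g : ι → ℂ}
    (hf : ∀ i ∈ s, ‖f i‖ ≤ 1) (hg : ∀ i ∈ s, ‖g i‖ ≤ 1) :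
    ‖∏ i ∈ s, f i - ∏ i ∈ s, g i‖ ≤ ∑ i ∈ s, ‖f i - g i‖ := by
  classical
  induction s using Finset.induction_on with
  | empty => simp
  | insert a s ha ih =>
    rw [Finset.prod_insert ha, Finset.prod_insert ha, Finset.sum_insert ha]
    have hf' := ih (fun i hi => hf i (Finset.mem_insert_of_mem hi))
      (fun i hi => hg i (Finset.mem_insert_of_mem hi))
    have h1 : f a * ∏ i ∈ s, f i - g a * ∏ i ∈ s, g i =
        (f a - g a) * ∏ i ∈ s, f i + g a * (∏ i ∈ s, f i - ∏ i ∈ s, g i) := by ring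
    rw [h1]
    refine (norm_add_le _ _).trans (add_le_add ?_ ?_)
    · rw [norm_mul]
      refine mul_le_of_le_one_right (norm_nonneg _) ?_
      rw [norm_prod]
      exact Finset.prod_le_one (fun i _ => norm_nonneg _)
        fun i hi => hf i (Finset.mem_insert_of_mem hi)
    · rw [norm_mul]
      exact (mul_le_of_le_one_left (norm_nonneg _) (hg a (Finset.mem_insert_self _ _))).trans hf'

theorem norm_exp_mul_I_sub_taylor_le {θ : ℝ} (hθ : |θ| ≤ 1) :
    ‖Complex.exp (θ * Complex.I) - (1 + θ * Complex.I - θ ^ 2 / 2)‖ ≤ |θ| ^ 3 := by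
  have hn : ‖(θ : ℂ) * Complex.I‖ = |θ| := by simp
  have h := Complex.exp_bound (x := θ * Complex.I) (n := 3) (by rw [hn]; exact hθ) (by norm_num)
  rw [hn] at h
  have h1 : ∑ m ∈ Finset.range 3, ((θ : ℂ) * Complex.I) ^ m / (m.factorial : ℂ) =
      1 + θ * Complex.I - θ ^ 2 / 2 := by
    simp [Finset.sum_range_succ, mul_pow, Nat.factorial]
    ring
  rw [h1] at h
  refine h.trans ?_
  refine mul_le_of_le_one_right (by positivity) ?_
  norm_num [Nat.factorial]

theorem norm_exp_mul_I_sub_le (x y : ℝ) :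
    ‖Complex.exp (x * Complex.I) - Complex.exp (y * Complex.I)‖ ≤ |x - y| := by
  have h : Complex.exp (x * Complex.I) - Complex.exp (y * Complex.I) =
      Complex.exp (y * Complex.I) * (Complex.exp (Complex.I * ((x - y : ℝ) : ℂ)) - 1) := by
    rw [mul_sub, ← Complex.exp_add, mul_one]
    congr 2
    push_cast
    ring
  rw [h, norm_mul, Complex.norm_exp_ofReal_mul_I, one_mul]
  exact Real.norm_exp_I_mul_ofReal_sub_one_le

variable {Ω : Type*} [MeasurableSpace Ω] {μ : Measure Ω} [IsProbabilityMeasure μ]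

theorem integrable_exp_mul_I {f : Ω → ℝ} (hf : AEMeasurable f μ) :
    Integrable (fun ω => Complex.exp (f ω * Complex.I)) μ := by
  refine Integrable.of_bound (C := 1) ?_ (ae_of_all _ fun ω => ?_)
  · exact (Complex.measurable_exp.comp_aemeasurable
      ((Complex.measurable_ofReal.comp_aemeasurable hf).mul_const _)).aestronglyMeasurable
  · rw [Complex.norm_exp_ofReal_mul_I]

/-- The characteristic function of a bounded centered random variable is close to that of the
Gaussian with the same variance. -/
theorem norm_charFun_sub_gaussian_le {ξ : Ω → ℝ} (hξ : Measurable ξ) (hb : ∀ ω, |ξ ω| ≤ 1)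
    (hmean : ∫ ω, ξ ω ∂μ = 0) {s : ℝ} (hs : |s| ≤ 1) :
    ‖∫ ω, Complex.exp ((ξ ω * s : ℝ) * Complex.I) ∂μ -
      Complex.exp (-((∫ ω, ξ ω ^ 2 ∂μ) * s ^ 2 / 2 : ℝ))‖ ≤ 2 * |s| ^ 3 := by
  set v := ∫ ω, ξ ω ^ 2 ∂μ with hv
  have hint : Integrable ξ μ := Integrable.of_bound hξ.aestronglyMeasurable 1 (ae_of_all _ hb)
  have hint2 : Integrable (fun ω => ξ ω ^ 2) μ :=
    Integrable.of_bound (hξ.pow_const 2).aestronglyMeasurable 1 (ae_of_all _ fun ω => by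
      rw [norm_pow]; exact pow_le_one₀ (norm_nonneg _) (hb ω))
  have hθ : ∀ ω, |ξ ω * s| ≤ |s| := fun ω => by
    rw [abs_mul]; exact mul_le_of_le_one_left (abs_nonneg _) (hb ω)
  have hv0 : 0 ≤ v := integral_nonneg fun ω => sq_nonneg _
  have hv1 : v ≤ 1 := by
    refine (integral_mono hint2 (integrable_const 1) fun ω => ?_).trans_eq (by simp)
    rw [← sq_abs]
    exact pow_le_one₀ (abs_nonneg _) (hb ω)
  have hI1 : Integrable (fun ω => ((ξ ω * s : ℝ) : ℂ) * Complex.I) μ :=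
    ((hint.mul_const s).ofReal).mul_const _
  have hI2 : Integrable (fun ω => ((ξ ω * s : ℝ) : ℂ) ^ 2 / 2) μ := by
    have h1 : ∀ ω, ((ξ ω * s : ℝ) : ℂ) ^ 2 / 2 = ((ξ ω ^ 2 * (s ^ 2 / 2) : ℝ) : ℂ) := fun ω => by
      push_cast; ring
    simp only [h1]
    exact (hint2.mul_const _).ofReal
  have hI12 : Integrable (fun ω => 1 + ((ξ ω * s : ℝ) : ℂ) * Complex.I) μ :=
    (integrable_const _).add hI1
  have hI : Integrable
      (fun ω => 1 + ((ξ ω * s : ℝ) : ℂ) * Complex.I - ((ξ ω * s : ℝ) : ℂ) ^ 2 / 2) μ :=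
    hI12.sub hI2
  have hT : ∫ ω, (1 + ((ξ ω * s : ℝ) : ℂ) * Complex.I - ((ξ ω * s : ℝ) : ℂ) ^ 2 / 2) ∂μ =
      ((1 - v * s ^ 2 / 2 : ℝ) : ℂ) := by
    rw [integral_sub hI12 hI2, integral_add (integrable_const _) hI1,
      integral_mul_const]
    have h1 : ∀ ω, ((ξ ω * s : ℝ) : ℂ) ^ 2 / 2 = ((ξ ω ^ 2 * (s ^ 2 / 2) : ℝ) : ℂ) := fun ω => by
      push_cast; ring
    simp only [h1]
    rw [integral_complex_ofReal, integral_complex_ofReal, integral_mul_const, integral_mul_const,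
      hmean, ← hv]
    simp
    ring
  -- Both characteristic functions are compared with the common second-order expansion `1 - v * s ^
  -- 2 / 2`, each at cost `|s| ^ 3`.
  have h1 : ‖∫ ω, Complex.exp ((ξ ω * s : ℝ) * Complex.I) ∂μ - ((1 - v * s ^ 2 / 2 : ℝ) : ℂ)‖ ≤
      |s| ^ 3 := by
    rw [← hT, ← integral_sub (integrable_exp_mul_I (hξ.mul_const s).aemeasurable) hI]
    refine (norm_integral_le_of_norm_le_const (C := |s| ^ 3) (ae_of_all _ fun ω => ?_)).trans_eq
      (by simp)
    exact (norm_exp_mul_I_sub_taylor_le ((hθ ω).trans hs)).trans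
      (pow_le_pow_left₀ (abs_nonneg _) (hθ ω) 3)
  have hs2 : s ^ 2 ≤ 1 := by rw [← sq_abs]; exact pow_le_one₀ (abs_nonneg _) hs
  set x := v * s ^ 2 / 2 with hx
  have hx0 : 0 ≤ x := by positivity
  have hxs : x ≤ s ^ 2 / 2 := by
    rw [hx]; nlinarith [sq_nonneg s]
  have h2 : ‖((1 - x : ℝ) : ℂ) - Complex.exp (-(x : ℝ))‖ ≤ |s| ^ 3 := by
    rw [← Complex.ofReal_neg, ← Complex.ofReal_exp, ← Complex.ofReal_sub, Complex.norm_real,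
      Real.norm_eq_abs, abs_sub_comm]
    have h3 := Real.abs_exp_sub_one_sub_id_le (x := -x) (by rw [abs_neg, abs_of_nonneg hx0]; linarith)
    have h4 : Real.exp (-x) - (1 - x) = Real.exp (-x) - 1 - -x := by ring
    rw [h4]
    refine h3.trans ?_
    rw [neg_sq]
    have h5 : x ^ 2 ≤ (s ^ 2) ^ 2 := pow_le_pow_left₀ hx0 (by linarith [sq_nonneg s]) 2
    have h6 : (s ^ 2) ^ 2 = |s| ^ 3 * |s| := by rw [← sq_abs s]; ring
    have h7 : |s| ^ 3 * |s| ≤ |s| ^ 3 := mul_le_of_le_one_right (by positivity) hs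
    linarith
  refine (norm_sub_le_norm_sub_add_norm_sub _ ((1 - x : ℝ) : ℂ) _).trans ?_
  linarith

/-- The characteristic function of a linear combination of the entries of a row of independent
noise is close to that of the Gaussian with the same variance. -/
theorem IsSymmetricNoise.norm_charFun_row_sub_gaussian_le {n : ℕ}
    {ξ : Ω → Matrix (Fin n) (Fin n) ℝ} (h : IsSymmetricNoise μ ξ) (i : Fin n) {s : Fin n → ℝ}
    (hs : ∀ j, |s j| ≤ 1) :
    ‖∫ ω, Complex.exp ((∑ j, ξ ω i j * s j : ℝ) * Complex.I) ∂μ -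
      Complex.exp (-((∑ j, (∫ ω, ξ ω i j ^ 2 ∂μ) * s j ^ 2) / 2 : ℝ))‖ ≤ 2 * ∑ j, |s j| ^ 3 := by
  have hprod : ∫ ω, Complex.exp ((∑ j, ξ ω i j * s j : ℝ) * Complex.I) ∂μ =
      ∏ j : {j // j ≠ i}, ∫ ω, Complex.exp ((ξ ω i j * s j : ℝ) * Complex.I) ∂μ := by
    -- Without its diagonal entry, which is zero, a row of the noise is an injectively reindexed
    -- subfamily of the entries above the diagonal.
    have hind : iIndepFun (fun (j : {j // j ≠ i}) ω => ξ ω i j) μ := by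
      have h1 := h.indep.precomp (g := fun j : {j // j ≠ i} => orderedPair i j j.2.symm) (by
        intro j k hjk
        rw [orderedPair_eq_iff] at hjk
        rcases hjk with hjk | hjk
        · exact Subtype.ext hjk.2
        · exact absurd hjk.2 j.2)
      simpa only [h.apply_orderedPair] using h1
    have h2 := hind.integral_fun_prod_comp
      (f := fun (j : {j // j ≠ i}) (x : ℝ) => Complex.exp ((x * s j : ℝ) * Complex.I))
      (fun j => (h.measurable_entry i j).aemeasurable)
      (fun j => Continuous.aestronglyMeasurable (by fun_prop))
    rw [← h2]
    congr 1
    ext ω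
    rw [← Complex.exp_sum, ← Finset.sum_mul]
    congr 2
    rw [← Complex.ofReal_sum, Complex.ofReal_inj,
      ← Finset.add_sum_erase _ _ (Finset.mem_univ i), h.diag_eq_zero, zero_mul, zero_add]
    exact Finset.sum_subtype _ (by simp) _
  have hgauss : Complex.exp (-((∑ j, (∫ ω, ξ ω i j ^ 2 ∂μ) * s j ^ 2) / 2 : ℝ)) =
      ∏ j : {j // j ≠ i}, Complex.exp (-((∫ ω, ξ ω i j ^ 2 ∂μ) * s j ^ 2 / 2 : ℝ)) := by
    rw [← Complex.exp_sum, Finset.sum_neg_distrib, ← Complex.ofReal_sum, ← Finset.sum_div,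
      ← Finset.add_sum_erase _ _ (Finset.mem_univ i)]
    simp only [h.diag_eq_zero]
    congr 3
    simp only [ne_eq, OfNat.ofNat_ne_zero, not_false_eq_true, zero_pow, integral_zero, zero_mul,
      zero_add]
    congr 1
    exact Finset.sum_subtype _ (by simp) _
  rw [hprod, hgauss]
  refine (norm_prod_sub_prod_le_sum _ (fun j _ => ?_) (fun j _ => ?_)).trans ?_
  · refine (norm_integral_le_of_norm_le_const (C := 1) (ae_of_all _ fun ω => ?_)).trans_eq
      (by simp)
    rw [Complex.norm_exp_ofReal_mul_I]
  · rw [← Complex.ofReal_neg, Complex.norm_exp_ofReal, Real.exp_le_one_iff]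
    have : 0 ≤ ∫ ω, ξ ω i j ^ 2 ∂μ := integral_nonneg fun ω => sq_nonneg _
    have : 0 ≤ (∫ ω, ξ ω i j ^ 2 ∂μ) * s j ^ 2 := by positivity
    linarith
  · refine (Finset.sum_le_sum fun (j : {j // j ≠ i}) _ => norm_charFun_sub_gaussian_le (h.measurable_entry i j)
      (fun ω => h.abs_le_one ω i j) (h.mean_eq_zero i j) (hs j)).trans ?_
    rw [← Finset.mul_sum]
    have h3 : ∑ j : {j // j ≠ i}, |s j| ^ 3 = ∑ j ∈ Finset.univ.erase i, |s j| ^ 3 :=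
      (Finset.sum_subtype (Finset.univ.erase i) (p := fun j => j ≠ i) (by simp)
        fun j => |s j| ^ 3).symm
    rw [h3]
    gcongr
    exact Finset.erase_subset _ _

/-- Random variables that are close with high probability have close characteristic functions. -/
theorem norm_integral_exp_sub_le {f g : Ω → ℝ} (hf : AEMeasurable f μ) (hg : AEMeasurable g μ)
    {δ ε : ℝ} (hδ : 0 ≤ δ) (hε : 0 ≤ ε) {B : Set Ω} (hB : μ B ≤ ENNReal.ofReal ε)
    (h : ∀ᵐ ω ∂μ, ω ∉ B → |f ω - g ω| ≤ δ) :
    ‖∫ ω, Complex.exp (f ω * Complex.I) ∂μ - ∫ ω, Complex.exp (g ω * Complex.I) ∂μ‖ ≤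
      δ + 2 * ε := by
  -- The exceptional set need not be measurable and is replaced by its measurable hull. On it the
  -- integrands differ by at most `2`.
  have hBm := measurableSet_toMeasurable μ B
  rw [← integral_sub (integrable_exp_mul_I hf) (integrable_exp_mul_I hg)]
  have hint : Integrable (fun ω => δ + (toMeasurable μ B).indicator (fun _ => (2 : ℝ)) ω) μ :=
    (integrable_const δ).add ((integrable_const 2).indicator hBm)
  refine (norm_integral_le_of_norm_le hint ?_).trans ?_
  · filter_upwards [h] with ω hω
    by_cases hωB : ω ∈ toMeasurable μ B
    · rw [Set.indicator_of_mem hωB]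
      refine (norm_sub_le _ _).trans ?_
      rw [Complex.norm_exp_ofReal_mul_I, Complex.norm_exp_ofReal_mul_I]
      linarith
    · rw [Set.indicator_of_notMem hωB, add_zero]
      exact (norm_exp_mul_I_sub_le _ _).trans (hω fun hB' => hωB (subset_toMeasurable μ B hB'))
  · rw [integral_add (integrable_const δ) ((integrable_const 2).indicator hBm),
      integral_indicator_const _ hBm]
    have h1 : μ.real (toMeasurable μ B) ≤ ε := by
      rw [measureReal_def, measure_toMeasurable]
      exact ENNReal.toReal_le_of_le_ofReal hε hB
    simp only [integral_const, probReal_univ, smul_eq_mul, one_mul]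
    linarith

end CharacteristicFunctions

/-! ### The noise of a Bernoulli network. -/

section Network

variable {Ω : Type*} [MeasurableSpace Ω] {μ : Measure Ω} [IsProbabilityMeasure μ] {n : ℕ}
  {P : Matrix (Fin n) (Fin n) ℝ} {A : Ω → Matrix (Fin n) (Fin n) ℝ}

/-- The centered off-diagonal part of the adjacency matrix of a random network. -/
def networkNoise (P A : Matrix (Fin n) (Fin n) ℝ) : Matrix (Fin n) (Fin n) ℝ :=
  Matrix.of fun i j => if i = j then 0 else A i j - P i j

theorem networkNoise_apply_of_ne (P A : Matrix (Fin n) (Fin n) ℝ) {i j : Fin n} (h : i ≠ j) :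
    networkNoise P A i j = A i j - P i j := by simp [networkNoise, h]

theorem networkNoise_apply_self (P A : Matrix (Fin n) (Fin n) ℝ) (i : Fin n) :
    networkNoise P A i i = 0 := by simp [networkNoise]

/-- `A` has zero diagonal while `P` need not, so the perturbation of `X * Xᵀ` is centered noise
minus the diagonal of `P`. -/
theorem IsBernoulliNetwork.add_networkNoise (hA : IsBernoulliNetwork μ P A) (ω : Ω) :
    P + (networkNoise P (A ω) - Matrix.diagonal fun i => P i i) = A ω := by
  ext i j
  by_cases h : i = j
  · subst h
    simp [networkNoise_apply_self, hA.diag_eq_zero]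
  · simp [networkNoise_apply_of_ne _ _ h, Matrix.diagonal_apply_ne _ h]

theorem IsBernoulliNetwork.integral_entry (hA : IsBernoulliNetwork μ P A)
    (hP : ∀ i j, 0 ≤ P i j ∧ P i j ≤ 1) {i j : Fin n} (hij : i ≠ j) :
    ∫ ω, A ω i j ∂μ = P i j := by
  have h1 : ∀ ω, A ω i j = Set.indicator {ω | A ω i j = 1} 1 ω := by
    intro ω
    rcases hA.binary ω i j with h | h
    · rw [Set.indicator_of_notMem (by simp [h]), h]
    · rw [Set.indicator_of_mem (by simpa using h), h, Pi.one_apply]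
  have hm : MeasurableSet {ω | A ω i j = 1} :=
    hA.measurable_entry i j (measurableSet_singleton 1)
  calc ∫ ω, A ω i j ∂μ = ∫ ω, Set.indicator {ω | A ω i j = 1} 1 ω ∂μ :=
        integral_congr_ae (ae_of_all _ h1)
    _ = P i j := by
        rw [integral_indicator_one hm, measureReal_def, hA.prob_edge i j hij,
          ENNReal.toReal_ofReal (hP i j).1]

theorem IsBernoulliNetwork.integrable_entry (hA : IsBernoulliNetwork μ P A) (i j : Fin n) :
    Integrable (fun ω => A ω i j) μ :=
  Integrable.of_bound (hA.measurable_entry i j).aestronglyMeasurable 1 (ae_of_all _ fun ω => by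
    rcases hA.binary ω i j with h | h <;> simp [h])

theorem IsBernoulliNetwork.integral_networkNoise_sq (hA : IsBernoulliNetwork μ P A)
    (hP : ∀ i j, 0 ≤ P i j ∧ P i j ≤ 1) {i j : Fin n} (hij : i ≠ j) :
    ∫ ω, networkNoise P (A ω) i j ^ 2 ∂μ = P i j * (1 - P i j) := by
  have h1 : ∀ ω, networkNoise P (A ω) i j ^ 2 = (1 - 2 * P i j) * A ω i j + P i j ^ 2 := by
    intro ω
    rw [networkNoise_apply_of_ne _ _ hij]
    rcases hA.binary ω i j with h | h <;> rw [h] <;> ring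
  simp only [h1]
  rw [integral_add ((hA.integrable_entry i j).const_mul _) (integrable_const _),
    integral_const_mul, hA.integral_entry hP hij]
  simp
  ring

theorem IsBernoulliNetwork.isSymmetricNoise (hA : IsBernoulliNetwork μ P A)
    (hP : ∀ i j, 0 ≤ P i j ∧ P i j ≤ 1) (hPs : ∀ i j, P i j = P j i) :
    IsSymmetricNoise μ fun ω => networkNoise P (A ω) where
  measurable_entry i j := by
    by_cases h : i = j
    · simp only [h, networkNoise_apply_self]; exact measurable_const
    · simp only [networkNoise_apply_of_ne _ _ h]; exact (hA.measurable_entry i j).sub_const _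
  symm ω i j := by
    by_cases h : i = j
    · rw [h]
    · rw [networkNoise_apply_of_ne _ _ h, networkNoise_apply_of_ne _ _ (Ne.symm h), hA.symm,
        hPs]
  diag_eq_zero ω i := networkNoise_apply_self _ _ i
  abs_le_one ω i j := by
    by_cases h : i = j
    · rw [h, networkNoise_apply_self]; simp
    · rw [networkNoise_apply_of_ne _ _ h, abs_le]
      have := hP i j
      rcases hA.binary ω i j with h | h <;> rw [h] <;> constructor <;> linarith
  mean_eq_zero i j := by
    by_cases h : i = j
    · simp [h, networkNoise_apply_self]
    · simp only [networkNoise_apply_of_ne _ _ h]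
      rw [integral_sub (hA.integrable_entry i j) (integrable_const _), hA.integral_entry hP h]
      simp
  indep := by
    have h := hA.indep.comp (fun e x => x - P e.1.1 e.1.2) fun e => measurable_id.sub_const _
    refine h.congr fun e => ae_of_all _ fun ω => ?_
    simp [networkNoise_apply_of_ne _ _ e.2.ne]

/-- Independent noise is tame with high probability. -/
theorem IsSymmetricNoise.measure_not_tame_le {d : ℕ} {ξ : Ω → Matrix (Fin n) (Fin n) ℝ}
    (h : IsSymmetricNoise μ ξ) (hn : 0 < n) {X : Matrix (Fin n) (Fin d) ℝ}
    (hX : ∀ i, ∑ a, X i a ^ 2 ≤ 1) {p : Fin n → ℝ} (hp : ∀ i, 0 ≤ p i ∧ p i ≤ 1) {L b : ℝ}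
    (hL : 0 < L) (hb : 2 * √L + 4 ≤ b) (hnb : L * (8 * b) ^ 4 ≤ n) (hnb' : 8 * b ≤ n)
    (i k : Fin n) :
    μ {ω | ¬(IsTameNoise b X (ξ ω - Matrix.diagonal p) ∧
      IsTameRow b X (ξ ω - Matrix.diagonal p) i ∧ IsTameRow b X (ξ ω - Matrix.diagonal p) k)} ≤
      ENNReal.ofReal (32 / L) := by
  have hXs : sumSq X ≤ n :=
    (Finset.sum_le_card_nsmul _ _ 1 fun j _ => hX j).trans_eq (by simp)
  have hmean := ((h.hasMeanLE_noiseSize hn hXs).add (h.hasMeanLE_rowNoiseSize hn hXs (hX i))).add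
    (h.hasMeanLE_rowNoiseSize hn hXs (hX k))
  have hpos : ∀ (M : Matrix (Fin n) (Fin n) ℝ), 0 ≤ noiseSize X M := fun M => by
    have h1 := sumSq_nonneg (M * X)
    have h2 := sumSq_nonneg (Xᵀ * (M * X))
    have h3 := sumSq_nonneg (onesRow n * M)
    have h4 := sumSq_nonneg (onesRow n * (M * X))
    have h5 := sumSq_nonneg (M * M)
    unfold noiseSize
    positivity
  have hpos' : ∀ (M : Matrix (Fin n) (Fin n) ℝ) i, 0 ≤ rowNoiseSize X i M := fun M i => by
    have h1 := sumSq_nonneg (unitRow i * M * M)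
    have h2 := sumSq_nonneg (unitRow i * M * (M * X))
    have h3 := sumSq_nonneg (unitRow i * M * X)
    unfold rowNoiseSize
    positivity
  have hmarkov := mul_meas_ge_le_integral_of_nonneg (ae_of_all _ fun ω =>
    add_nonneg (add_nonneg (hpos (ξ ω)) (hpos' (ξ ω) i)) (hpos' (ξ ω) k)) hmean.1 L
  -- Markov's inequality for a sum with mean at most `14 + 9 + 9 = 32`; row `i` is the one studied,
  -- row `k` will be the one in the sign convention.
  have hle : μ.real {ω | L ≤ noiseSize X (ξ ω) + rowNoiseSize X i (ξ ω) +
      rowNoiseSize X k (ξ ω)} ≤ 32 / L := by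
    rw [le_div_iff₀ hL, mul_comm]
    refine hmarkov.trans (hmean.2.trans (by norm_num))
  have hle' := ENNReal.ofReal_le_ofReal hle
  rw [ofReal_measureReal] at hle'
  refine (measure_mono fun ω hω => ?_).trans hle'
  by_contra hlt
  have hlt' : noiseSize X (ξ ω) + rowNoiseSize X i (ξ ω) + rowNoiseSize X k (ξ ω) < L :=
    not_le.1 fun h => hlt h
  have h1 := hpos (ξ ω)
  have h2 := hpos' (ξ ω) i
  have h3 := hpos' (ξ ω) k
  have hs := Real.sqrt_nonneg L
  refine hω ⟨isTameNoise_of_noiseSize_le hn hXs ?_ hp hL (by linarith) hnb hnb' (by linarith),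
    isTameRow_of_rowNoiseSize_le hn hXs (hX i) (h.abs_le_one ω i) hp hL hb (by linarith),
    isTameRow_of_rowNoiseSize_le hn hXs (hX k) (h.abs_le_one ω k) hp hL hb (by linarith)⟩
  ext i j
  exact h.symm ω j i

end Network

/-! ### Limits of the second moment and score matrices. -/

section Limits

open Matrix

variable {d : ℕ}

theorem rowVec_apply_of_lt {n : ℕ} (M : Matrix (Fin n) (Fin d) ℝ) {i : ℕ} (h : i < n)
    (a : Fin d) : rowVec M i a = M ⟨i, h⟩ a := by
  simp [rowVec, h]

theorem inner_rowVec {n : ℕ} (X : Matrix (Fin n) (Fin d) ℝ) {i j : ℕ} (hi : i < n) (hj : j < n) :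
    inner ℝ (rowVec X i) (rowVec X j) = (X * Xᵀ) ⟨i, hi⟩ ⟨j, hj⟩ := by
  rw [PiLp.inner_apply, mul_apply]
  refine Finset.sum_congr rfl fun a _ => ?_
  rw [rowVec_apply_of_lt _ hi, rowVec_apply_of_lt _ hj]
  simp [mul_comm]

/-- In this form the quadratic form is visibly the variance of a weighted sum of the entries of row
`i` of the noise. -/
theorem dotProduct_scoreCov_mulVec {n : ℕ} (X : Matrix (Fin n) (Fin d) ℝ) {i : ℕ} (hi : i < n)
    (u : Fin d → ℝ) : u ⬝ᵥ scoreCov X i *ᵥ u = (n : ℝ)⁻¹ * ∑ j, (if j = ⟨i, hi⟩ then 0 else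
      (X * Xᵀ) ⟨i, hi⟩ j * (1 - (X * Xᵀ) ⟨i, hi⟩ j)) * (X *ᵥ u) j ^ 2 := by
  rw [scoreCov, smul_mulVec, dotProduct_smul, smul_eq_mul, sum_mulVec, dotProduct_sum]
  congr 1
  refine Finset.sum_congr rfl fun j _ => ?_
  by_cases hj : j = ⟨i, hi⟩
  · have : (j : ℕ) = i := by rw [hj]
    simp [hj]
  · have hj' : (j : ℕ) ≠ i := fun h => hj (Fin.ext h)
    rw [if_neg hj', if_neg hj, smul_mulVec, dotProduct_smul, smul_eq_mul, inner_rowVec X hi j.2,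
      vecMulVec_mulVec, dotProduct_smul]
    simp only [mulVec]
    rw [MulOpposite.smul_eq_mul_unop, MulOpposite.unop_op, dotProduct_comm u, sq]

/-- A limit of score covariance matrices is positive semidefinite. -/
theorem posSemidef_of_tendsto_scoreCov {X : ∀ n : ℕ, Matrix (Fin n) (Fin d) ℝ} {i : ℕ}
    (hX : ∀ n i j, 0 ≤ (X n * (X n)ᵀ) i j ∧ (X n * (X n)ᵀ) i j ≤ 1)
    {Q : Matrix (Fin d) (Fin d) ℝ} (hQ : Tendsto (fun n => scoreCov (X n) i) atTop (𝓝 Q)) :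
    Q.PosSemidef := by
  refine PosSemidef.of_dotProduct_mulVec_nonneg ?_ fun u => ?_
  · have h1 : ∀ n, (scoreCov (X n) i)ᴴ = scoreCov (X n) i := fun n => by
      rw [conjTranspose_eq_transpose_of_trivial, scoreCov, transpose_smul, transpose_sum]
      congr 1
      refine Finset.sum_congr rfl fun j _ => ?_
      split_ifs
      · simp
      · rw [transpose_smul, transpose_vecMulVec]
    have h2 : Tendsto (fun n => (scoreCov (X n) i)ᴴ) atTop (𝓝 Qᴴ) :=
      (Continuous.tendsto (by fun_prop) Q).comp hQ
    simp only [h1] at h2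
    exact tendsto_nhds_unique h2 hQ
  · rw [star_trivial]
    have h1 : Tendsto (fun n => u ⬝ᵥ scoreCov (X n) i *ᵥ u) atTop (𝓝 (u ⬝ᵥ Q *ᵥ u)) :=
      ((Continuous.tendsto (f := fun M : Matrix (Fin d) (Fin d) ℝ => u ⬝ᵥ M *ᵥ u)
        (by fun_prop)) Q).comp hQ
    refine ge_of_tendsto h1 ?_
    filter_upwards [eventually_gt_atTop i] with n hn
    rw [dotProduct_scoreCov_mulVec _ hn]
    refine mul_nonneg (by positivity) (Finset.sum_nonneg fun j _ => mul_nonneg ?_ (sq_nonneg _))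
    split_ifs
    · exact le_rfl
    · have := hX n ⟨i, hn⟩ j
      exact mul_nonneg this.1 (by linarith)

theorem tendsto_inv_secondMoment {X : ∀ n : ℕ, Matrix (Fin n) (Fin d) ℝ}
    {MX : Matrix (Fin d) (Fin d) ℝ} (hMX : Tendsto (fun n => secondMoment (X n)) atTop (𝓝 MX))
    (hMX_inv : IsUnit MX.det) :
    Tendsto (fun n => (secondMoment (X n))⁻¹) atTop (𝓝 MX⁻¹) := by
  refine (continuousAt_matrix_inv MX ?_).tendsto.comp hMX
  rw [Ring.inverse_eq_inv']
  exact continuousAt_inv₀ hMX_inv.ne_zero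

theorem transpose_eq_of_tendsto_secondMoment {X : ∀ n : ℕ, Matrix (Fin n) (Fin d) ℝ}
    {MX : Matrix (Fin d) (Fin d) ℝ} (hMX : Tendsto (fun n => secondMoment (X n)) atTop (𝓝 MX)) :
    MXᵀ = MX := by
  have h1 : ∀ n, (secondMoment (X n))ᵀ = secondMoment (X n) := fun n => by
    rw [secondMoment, transpose_smul, transpose_mul, transpose_transpose]
  have h2 : Tendsto (fun n => (secondMoment (X n))ᵀ) atTop (𝓝 MXᵀ) :=
    (Continuous.tendsto (by fun_prop) MX).comp hMX
  simp only [h1] at h2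
  exact tendsto_nhds_unique h2 hMX

theorem inv_gram_eq {n : ℕ} (hn : 0 < n) {X : Matrix (Fin n) (Fin d) ℝ}
    (hdet : IsUnit (secondMoment X).det) :
    (Xᵀ * X)⁻¹ = (n : ℝ)⁻¹ • (secondMoment X)⁻¹ := by
  have hn' : (n : ℝ) ≠ 0 := Nat.cast_ne_zero.2 hn.ne'
  have hS : Xᵀ * X = (n : ℝ) • secondMoment X := by
    rw [secondMoment, smul_smul, mul_inv_cancel₀ hn', one_smul]
  refine inv_eq_left_inv ?_
  rw [hS, Matrix.smul_mul, Matrix.mul_smul, smul_smul, inv_mul_cancel₀ hn', one_smul,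
    nonsing_inv_mul _ hdet]

-- Coercivity follows from the left inverse `T = (Xᵀ X)⁻¹ Xᵀ`: since `T Tᵀ = (Xᵀ X)⁻¹`, one has
-- `|v|² = |T X v|² ≤ (b / n) |X v|²`.
open scoped Matrix.Norms.L2Operator in
theorem norm_inv_gram_and_coercive {n : ℕ} (hn : 0 < n) {X : Matrix (Fin n) (Fin d) ℝ} {b : ℝ}
    (hb : 0 < b) (hdet : IsUnit (secondMoment X).det) (hle : ‖(secondMoment X)⁻¹‖ ≤ b) :
    ‖(Xᵀ * X)⁻¹‖ ≤ b / n ∧ ∀ v, n / b * (v ⬝ᵥ v) ≤ (X *ᵥ v) ⬝ᵥ (X *ᵥ v) := by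
  have hn' : (0 : ℝ) < n := Nat.cast_pos.2 hn
  have hS : Xᵀ * X = (n : ℝ) • secondMoment X := by
    rw [secondMoment, smul_smul, mul_inv_cancel₀ hn'.ne', one_smul]
  have hnorm : ‖(Xᵀ * X)⁻¹‖ ≤ b / n := by
    rw [inv_gram_eq hn hdet, norm_smul, norm_inv, Real.norm_natCast, inv_mul_eq_div]
    gcongr
  refine ⟨hnorm, fun v => ?_⟩
  have hunit : IsUnit (Xᵀ * X).det := by
    rw [hS, det_smul]
    exact (isUnit_iff_ne_zero.2 (pow_ne_zero _ hn'.ne')).mul hdet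
  set T := (Xᵀ * X)⁻¹ * Xᵀ with hT
  have hTT : ‖T‖ ^ 2 ≤ b / n := by
    rw [← l2_opNorm_transpose, ← l2_opNorm_transpose_mul_self, transpose_transpose]
    have : T * Tᵀ = (Xᵀ * X)⁻¹ := by
      rw [hT, transpose_mul, transpose_transpose, transpose_nonsing_inv, transpose_mul,
        transpose_transpose, Matrix.mul_assoc, ← Matrix.mul_assoc Xᵀ, mul_nonsing_inv _ hunit,
        Matrix.mul_one]
    rwa [this]
  have h1 := dotProduct_mulVec_self_le T (X *ᵥ v)
  rw [mulVec_mulVec, hT, Matrix.mul_assoc, nonsing_inv_mul _ hunit, one_mulVec, ← hT] at h1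
  have h2 : v ⬝ᵥ v ≤ b / n * ((X *ᵥ v) ⬝ᵥ (X *ᵥ v)) :=
    h1.trans (mul_le_mul_of_nonneg_right hTT (dotProduct_self_nonneg' _))
  calc n / b * (v ⬝ᵥ v) ≤ n / b * (b / n * ((X *ᵥ v) ⬝ᵥ (X *ᵥ v))) := by gcongr
    _ = _ := by field_simp

end Limits

/-! ### The leading term and its central limit theorem. -/

section LeadingTerm

open Matrix

variable {d : ℕ}

/-- The projection on `t` of the leading term `√n (XᵀX)⁻¹ Xᵀ ξ eᵢ` of the error of row `i`. -/
noncomputable def leadingTerm {n : ℕ} (X : Matrix (Fin n) (Fin d) ℝ) (ξ : Matrix (Fin n) (Fin n) ℝ)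
    (i : ℕ) (t : Fin d → ℝ) : ℝ :=
  if h : i < n then ∑ j, ξ ⟨i, h⟩ j * ((X *ᵥ (secondMoment X)⁻¹ *ᵥ t) j / √n) else 0

theorem leadingTerm_of_lt {n : ℕ} (X : Matrix (Fin n) (Fin d) ℝ) (ξ : Matrix (Fin n) (Fin n) ℝ)
    {i : ℕ} (h : i < n) (t : Fin d → ℝ) : leadingTerm X ξ i t =
      ∑ j, ξ ⟨i, h⟩ j * ((X *ᵥ (secondMoment X)⁻¹ *ᵥ t) j / √n) := by
  rw [leadingTerm, dif_pos h]

open scoped Matrix.Norms.L2Operator in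
theorem abs_mulVec_row_le (N : Matrix Unit (Fin d) ℝ) (t : EuclideanSpace ℝ (Fin d)) (u : Unit) :
    |(N *ᵥ t.ofLp) u| ≤ ‖N‖ * ‖t‖ := by
  have h := abs_dotProduct_mulVec_le N (Pi.single u 1) t.ofLp
  simpa using h

open scoped Matrix.Norms.L2Operator in
/-- The projections of the error of a row of the centered embedding are close to those of its
leading term. -/
theorem abs_inner_sub_leadingTerm_le {n : ℕ} {X Y : Matrix (Fin n) (Fin d) ℝ}
    {ξ : Matrix (Fin n) (Fin n) ℝ} {p : Fin n → ℝ} {i : ℕ} (hi : i < n) {b C : ℝ}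
    (hdet : IsUnit (secondMoment X).det) (hinv : ‖(Xᵀ * X)⁻¹‖ ≤ b / n)
    (hp : ∀ i, 0 ≤ p i ∧ p i ≤ 1) (hrow : ‖unitRow ⟨i, hi⟩ * X‖ ≤ b)
    (h : ‖unitRow ⟨i, hi⟩ * (centering n * Y - centering n * X) -
      unitRow ⟨i, hi⟩ * (ξ - diagonal p) * X * (Xᵀ * X)⁻¹‖ ≤ C / n)
    (t : EuclideanSpace ℝ (Fin d)) :
    |inner ℝ (√(n : ℝ) • (rowVec (centering n * Y) i - rowVec (centering n * X) i)) t -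
      leadingTerm X ξ i t| ≤ (C + b * b) * ‖t‖ / √n := by
  have hn : 0 < n := by omega
  have hn' : (0 : ℝ) < n := Nat.cast_pos.2 hn
  have hsn : √(n : ℝ) * √n = n := Real.mul_self_sqrt hn'.le
  have hs0 : 0 < √(n : ℝ) := Real.sqrt_pos.2 hn'
  set r := unitRow (⟨i, hi⟩ : Fin n) with hr
  set N := r * (centering n * Y - centering n * X) - r * ξ * X * (Xᵀ * X)⁻¹ with hN
  have h1 : inner ℝ (√(n : ℝ) • (rowVec (centering n * Y) i - rowVec (centering n * X) i)) t =
      √n * ((r * (centering n * Y - centering n * X)) *ᵥ t.ofLp) () := by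
    rw [real_inner_smul_left, PiLp.inner_apply, mulVec, dotProduct]
    congr 1
    refine Finset.sum_congr rfl fun a _ => ?_
    rw [PiLp.sub_apply, rowVec_apply_of_lt _ hi, rowVec_apply_of_lt _ hi, hr, unitRow_mul_apply,
      Matrix.sub_apply]
    simp [mul_comm]
  have h2 : leadingTerm X ξ i t = √n * ((r * ξ * X * (Xᵀ * X)⁻¹) *ᵥ t.ofLp) () := by
    rw [leadingTerm_of_lt _ _ hi, inv_gram_eq hn hdet, Matrix.mul_smul, smul_mulVec,
      Pi.smul_apply, smul_eq_mul, ← mulVec_mulVec, ← mulVec_mulVec, mulVec, dotProduct]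
    simp only [hr, unitRow_mul_apply]
    rw [Finset.mul_sum, Finset.mul_sum]
    refine Finset.sum_congr rfl fun j _ => ?_
    nth_rw 3 [← hsn]
    field_simp
  -- The leading term uses `ξ` without the diagonal correction, which costs `p i * ‖r * X * (Xᵀ *
  -- X)⁻¹‖ ≤ b * b / n`.
  have h3 : ‖N‖ ≤ (C + b * b) / n := by
    have h4 : N = (r * (centering n * Y - centering n * X) -
        r * (ξ - diagonal p) * X * (Xᵀ * X)⁻¹) - p ⟨i, hi⟩ • (r * X * (Xᵀ * X)⁻¹) := by
      rw [hN, Matrix.mul_sub r ξ, hr, unitRow_mul_diagonal]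
      simp only [Matrix.sub_mul, Matrix.smul_mul]
      abel
    rw [h4, add_div]
    refine (norm_sub_le _ _).trans (add_le_add h ?_)
    rw [norm_smul, Real.norm_eq_abs, abs_of_nonneg (hp _).1]
    refine (mul_le_of_le_one_left (norm_nonneg _) (hp _).2).trans ?_
    exact (l2_opNorm_mul_le_of_le hrow hinv).trans_eq (by ring)
  rw [h1, h2, ← mul_sub, ← Pi.sub_apply, ← sub_mulVec, ← hN, abs_mul, abs_of_pos hs0]
  calc √(n : ℝ) * |(N *ᵥ t.ofLp) ()| ≤ √n * ((C + b * b) / n * ‖t‖) := by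
        gcongr
        exact (abs_mulVec_row_le N t ()).trans (by gcongr)
    _ = (C + b * b) * ‖t‖ / √n := by
        nth_rw 2 [← hsn]
        field_simp

variable {Ω : ℕ → Type*} [∀ n, MeasurableSpace (Ω n)] {μ : ∀ n, Measure (Ω n)}
  [∀ n, IsProbabilityMeasure (μ n)] {X : ∀ n : ℕ, Matrix (Fin n) (Fin d) ℝ}
  {A : ∀ n, Ω n → Matrix (Fin n) (Fin n) ℝ} {MX Q : Matrix (Fin d) (Fin d) ℝ} {i : ℕ}

theorem sum_sq_row_le_one {n : ℕ} {X : Matrix (Fin n) (Fin d) ℝ}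
    (hX : ∀ i j, 0 ≤ (X * Xᵀ) i j ∧ (X * Xᵀ) i j ≤ 1) (j : Fin n) : ∑ a, X j a ^ 2 ≤ 1 := by
  have h := (hX j j).2
  rw [mul_apply] at h
  simpa only [transpose_apply, ← sq] using h

theorem tendsto_dotProduct_mulVec {w : ℕ → Fin d → ℝ} {w₀ : Fin d → ℝ}
    {S : ℕ → Matrix (Fin d) (Fin d) ℝ} {S₀ : Matrix (Fin d) (Fin d) ℝ}
    (hw : Tendsto w atTop (𝓝 w₀)) (hS : Tendsto S atTop (𝓝 S₀)) :
    Tendsto (fun n => w n ⬝ᵥ S n *ᵥ w n) atTop (𝓝 (w₀ ⬝ᵥ S₀ *ᵥ w₀)) := by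
  have hcont : Continuous fun q : (Fin d → ℝ) × Matrix (Fin d) (Fin d) ℝ =>
      q.1 ⬝ᵥ q.2 *ᵥ q.1 := continuous_fst.dotProduct (continuous_snd.matrix_mulVec continuous_fst)
  exact (hcont.tendsto (w₀, S₀)).comp (hw.prodMk_nhds hS)

/-- Central limit theorem for the leading term of the error of a row of the embedding. -/
theorem tendsto_charFun_leadingTerm
    (hP : ∀ n i j, 0 ≤ (X n * (X n)ᵀ) i j ∧ (X n * (X n)ᵀ) i j ≤ 1)
    (hA : ∀ n, IsBernoulliNetwork (μ n) (X n * (X n)ᵀ) (A n))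
    (hMX : Tendsto (fun n => secondMoment (X n)) atTop (𝓝 MX)) (hMX_inv : IsUnit MX.det)
    (hQ : Tendsto (fun n => scoreCov (X n) i) atTop (𝓝 Q)) (t : Fin d → ℝ) :
    Tendsto (fun n => ∫ ω, Complex.exp
      ((leadingTerm (X n) (networkNoise (X n * (X n)ᵀ) (A n ω)) i t : ℝ) * Complex.I) ∂(μ n))
      atTop (𝓝 (Complex.exp (-((t ⬝ᵥ (MX⁻¹ * Q * MX⁻¹) *ᵥ t) / 2 : ℝ)))) := by
  set w : ℕ → Fin d → ℝ := fun n => (secondMoment (X n))⁻¹ *ᵥ t with hw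
  set w₀ : Fin d → ℝ := MX⁻¹ *ᵥ t with hw₀
  have hwlim : Tendsto w atTop (𝓝 w₀) :=
    ((Continuous.tendsto (f := fun M : Matrix (Fin d) (Fin d) ℝ => M *ᵥ t)
      (by fun_prop)) MX⁻¹).comp (tendsto_inv_secondMoment hMX hMX_inv)
  have hvar : Tendsto (fun n => w n ⬝ᵥ scoreCov (X n) i *ᵥ w n) atTop
      (𝓝 (t ⬝ᵥ (MX⁻¹ * Q * MX⁻¹) *ᵥ t)) := by
    have h1 : t ⬝ᵥ (MX⁻¹ * Q * MX⁻¹) *ᵥ t = w₀ ⬝ᵥ Q *ᵥ w₀ := by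
      have hsymm : (MX⁻¹)ᵀ = MX⁻¹ := by
        rw [transpose_nonsing_inv, transpose_eq_of_tendsto_secondMoment hMX]
      rw [hw₀, mulVec_mulVec, dotProduct_mulVec_mulVec, hsymm, Matrix.mul_assoc]
    rw [h1]
    exact tendsto_dotProduct_mulVec hwlim hQ
  have hww : Tendsto (fun n => w n ⬝ᵥ w n) atTop (𝓝 (w₀ ⬝ᵥ w₀)) :=
    ((Continuous.tendsto (f := fun u : Fin d → ℝ => u ⬝ᵥ u) (by fun_prop)) w₀).comp hwlim
  set B := √(w₀ ⬝ᵥ w₀ + 1) with hB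
  have hB0 : 0 ≤ w₀ ⬝ᵥ w₀ + 1 := by have := dotProduct_self_nonneg' w₀; linarith
  have hlim : Tendsto (fun n : ℕ => B / √(n : ℝ)) atTop (𝓝 0) :=
    Tendsto.const_div_atTop (Real.tendsto_sqrt_atTop.comp tendsto_natCast_atTop_atTop) _
  have hlim' : Tendsto (fun n : ℕ => 2 * (B ^ 3 / √(n : ℝ))) atTop (𝓝 0) := by
    simpa using (Tendsto.const_div_atTop
      (Real.tendsto_sqrt_atTop.comp tendsto_natCast_atTop_atTop) (B ^ 3)).const_mul 2
  have hgauss : Tendsto (fun n => Complex.exp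
      (-((w n ⬝ᵥ scoreCov (X n) i *ᵥ w n) / 2 : ℝ))) atTop
      (𝓝 (Complex.exp (-((t ⬝ᵥ (MX⁻¹ * Q * MX⁻¹) *ᵥ t) / 2 : ℝ)))) :=
    ((Continuous.tendsto (f := fun x : ℝ => Complex.exp (-(x / 2 : ℝ))) (by fun_prop)) _).comp hvar
  -- It remains to compare, at each `n`, with the Gaussian whose variance is that of the leading
  -- term at the same `n`.
  refine tendsto_of_tendsto_of_dist hgauss ?_
  refine squeeze_zero' (Eventually.of_forall fun n => dist_nonneg) ?_ hlim'
  filter_upwards [eventually_gt_atTop i, hlim.eventually_le_const one_pos,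
    hww.eventually_lt_const (lt_add_one _)] with n hi hn1 hwn
  have hn' : (0 : ℝ) < n := Nat.cast_pos.2 (by omega)
  have hsn : √(n : ℝ) * √n = n := Real.mul_self_sqrt hn'.le
  have hs0 : 0 < √(n : ℝ) := Real.sqrt_pos.2 hn'
  have hnoise := (hA n).isSymmetricNoise (hP n) fun j k => by
    rw [← transpose_apply (X n * (X n)ᵀ), transpose_mul, transpose_transpose]
  set s : Fin n → ℝ := fun j => (X n *ᵥ w n) j / √n with hs
  -- Rows of `X` have norm at most one because the diagonal of `X Xᵀ` is at most one, and `|w n|² <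
  -- |w₀|² + 1` for large `n`. So the cubic error is at most `n * (B / √n) ^ 3`.
  have hsB : ∀ j, |s j| ≤ B / √n := by
    intro j
    rw [hs, abs_div, abs_of_pos hs0]
    gcongr
    refine Real.abs_le_sqrt ?_
    have h1 : (X n *ᵥ w n) j ^ 2 ≤ (∑ a, X n j a ^ 2) * ∑ a, w n a ^ 2 :=
      Finset.sum_mul_sq_le_sq_mul_sq Finset.univ (X n j) (w n)
    have h2 : ∑ a, w n a ^ 2 = w n ⬝ᵥ w n := by simp only [dotProduct, sq]
    rw [h2] at h1
    have h3 := mul_le_of_le_one_left (dotProduct_self_nonneg' (w n))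
      (sum_sq_row_le_one (hP n) j)
    linarith
  have hmain := hnoise.norm_charFun_row_sub_gaussian_le ⟨i, hi⟩ fun j => (hsB j).trans hn1
  have hsum : ∑ j, (∫ ω, networkNoise (X n * (X n)ᵀ) (A n ω) ⟨i, hi⟩ j ^ 2 ∂(μ n)) * s j ^ 2 =
      w n ⬝ᵥ scoreCov (X n) i *ᵥ w n := by
    rw [dotProduct_scoreCov_mulVec _ hi, Finset.mul_sum]
    refine Finset.sum_congr rfl fun j _ => ?_
    have h1 : s j ^ 2 = (n : ℝ)⁻¹ * (X n *ᵥ w n) j ^ 2 := by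
      rw [hs, div_pow, sq √(n : ℝ), hsn, inv_mul_eq_div]
    by_cases hj : j = ⟨i, hi⟩
    · simp [hj, networkNoise_apply_self]
    · rw [if_neg hj, (hA n).integral_networkNoise_sq (hP n) (Ne.symm hj), h1]
      ring
  rw [hsum] at hmain
  rw [dist_comm, dist_eq_norm]
  simp only [leadingTerm_of_lt _ _ hi]
  refine hmain.trans ?_
  gcongr
  calc ∑ j, |s j| ^ 3 ≤ ∑ _j : Fin n, (B / √(n : ℝ)) ^ 3 :=
        Finset.sum_le_sum fun j _ => pow_le_pow_left₀ (abs_nonneg _) (hsB j) 3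
    _ = B ^ 3 / √n := by
        rw [Finset.sum_const, Finset.card_univ, Fintype.card_fin, nsmul_eq_mul]
        nth_rw 1 [← hsn]
        field_simp

/-- The quantifiers over `b` and `E` stay inside the almost sure event because `b` will depend on
the tolerance `ε`, whereas `c` must be fixed beforehand. -/
theorem exists_eventually_isResolved {Z : ∀ n : ℕ, Matrix (Fin n) (Fin d) ℝ}
    (hXZ : ∀ n, centering n * X n = Z n) {Xhat : ∀ n, Ω n → Matrix (Fin n) (Fin d) ℝ}
    (h_rot :
      (∀ᶠ n in atTop, ∀ᵐ ω ∂(μ n), IsNearestRotation (Xhat n ω) (X n)) ∨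
      (HasSeparatedDiagonalGram Z ∧
        (∀ᶠ n in atTop, ∀ᵐ ω ∂(μ n),
          HasMatchingDiagonalGram (centering n * Xhat n ω) (Z n)) ∧
        ((∀ᶠ n in atTop, ∀ᵐ ω ∂(μ n), ∀ a, 0 ≤ ∑ j, Xhat n ω j a * X n j a) ∨
          ((∃ c : ℝ, 0 < c ∧ ∀ᶠ n in atTop, ∀ a, c ≤ rowVec (Z n) 0 a) ∧
            ∀ᶠ n in atTop, ∀ᵐ ω ∂(μ n), ∀ a, 0 ≤ rowVec (centering n * Xhat n ω) 0 a)))) :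
    ∃ c : ℝ, 0 < c ∧ ∀ᶠ n in atTop, ∀ᵐ ω ∂(μ n), ∀ (b : ℝ) (E : Matrix (Fin n) (Fin n) ℝ),
      (∀ h : 0 < n, IsTameRow b (X n) E ⟨0, h⟩) → IsResolved b c (X n) E (Xhat n ω) := by
  rcases h_rot with h | ⟨⟨c, hc, hsep⟩, hmatch, h | ⟨⟨c', hc', hZ⟩, h⟩⟩
  · exact ⟨1, one_pos, h.mono fun n hn => hn.mono fun ω hω b E _ => Or.inl hω⟩
  · refine ⟨c, hc, ?_⟩
    filter_upwards [hsep, hmatch, h] with n h1 h2 h3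
    filter_upwards [h2, h3] with ω h2 h3 b E _
    rw [← hXZ n] at h1 h2
    exact Or.inr ⟨h1.1, h1.2, h2, Or.inl h3⟩
  -- One constant serves both as separation of the diagonal entries and as lower bound for the first
  -- row.
  · refine ⟨min c c', lt_min hc hc', ?_⟩
    filter_upwards [hsep, hmatch, h, hZ, eventually_gt_atTop 0] with n h1 h2 h3 h4 hn
    filter_upwards [h2, h3] with ω h2 h3 b E hE
    rw [← hXZ n] at h1 h2 h4
    refine Or.inr ⟨h1.1, fun a a' ha => (min_le_left _ _).trans (h1.2 a a' ha), h2,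
      Or.inr ⟨⟨0, hn⟩, hE hn, fun a => ?_, fun a => ?_⟩⟩
    · rw [← rowVec_apply_of_lt (centering n * X n) hn a]
      exact (min_le_right _ _).trans (h4 a)
    · rw [← rowVec_apply_of_lt (centering n * Xhat n ω) hn a]
      exact h3 a

theorem measurable_leadingTerm {n : ℕ} {Ω : Type*} [MeasurableSpace Ω]
    {ξ : Ω → Matrix (Fin n) (Fin n) ℝ} (hξ : ∀ i j, Measurable fun ω => ξ ω i j)
    (X : Matrix (Fin n) (Fin d) ℝ) (i : ℕ) (t : Fin d → ℝ) :
    Measurable fun ω => leadingTerm X (ξ ω) i t := by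
  unfold leadingTerm
  split_ifs with h
  · fun_prop
  · exact measurable_const

theorem aemeasurable_rowVec {n : ℕ} {Ω : Type*} [MeasurableSpace Ω] {μ : Measure Ω}
    {Y : Ω → Matrix (Fin n) (Fin d) ℝ} (hY : ∀ j a, AEMeasurable (fun ω => Y ω j a) μ) (i : ℕ) :
    AEMeasurable (fun ω => rowVec (centering n * Y ω) i) μ := by
  unfold rowVec
  split_ifs with h
  · refine (WithLp.measurable_toLp 2 _).comp_aemeasurable (aemeasurable_pi_iff.2 fun a => ?_)
    simp only [mul_apply]
    fun_prop
  · exact aemeasurable_const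

end LeadingTerm

/-! ### Reduction to the leading term and conclusion. -/

section LimitLaw

open Matrix
open scoped Matrix.Norms.L2Operator

variable {d : ℕ} {Ω : ℕ → Type*} [∀ n, MeasurableSpace (Ω n)] {μ : ∀ n, Measure (Ω n)}
  [∀ n, IsProbabilityMeasure (μ n)] {X : ∀ n : ℕ, Matrix (Fin n) (Fin d) ℝ}
  {A : ∀ n, Ω n → Matrix (Fin n) (Fin n) ℝ} {MX : Matrix (Fin d) (Fin d) ℝ}
  {Xhat : ∀ n, Ω n → Matrix (Fin n) (Fin d) ℝ}

theorem aemeasurable_rowVec_error {n : ℕ} {Ω : Type*} [MeasurableSpace Ω] {μ : Measure Ω}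
    {Y : Ω → Matrix (Fin n) (Fin d) ℝ} (hY : ∀ j a, AEMeasurable (fun ω => Y ω j a) μ)
    (X : Matrix (Fin n) (Fin d) ℝ) (i : ℕ) : AEMeasurable (fun ω =>
      √(n : ℝ) • (rowVec (centering n * Y ω) i - rowVec (centering n * X) i)) μ := by
  have h := aemeasurable_rowVec hY i
  fun_prop

/-- The error of a row of the centered embedding and its leading term have asymptotically equal
characteristic functions. -/
theorem eventually_norm_integral_exp_sub_leadingTerm_le
    (hP : ∀ n i j, 0 ≤ (X n * (X n)ᵀ) i j ∧ (X n * (X n)ᵀ) i j ≤ 1)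
    (hA : ∀ n, IsBernoulliNetwork (μ n) (X n * (X n)ᵀ) (A n))
    (hMX : Tendsto (fun n => secondMoment (X n)) atTop (𝓝 MX)) (hMX_inv : IsUnit MX.det)
    (hXhat_meas : ∀ n j a, AEMeasurable (fun ω => Xhat n ω j a) (μ n))
    (hXhat : ∀ᶠ n in atTop, ∀ᵐ ω ∂(μ n), IsRotatedASE (A n ω) (Xhat n ω))
    {c : ℝ} (hc : 0 < c)
    (hres : ∀ᶠ n in atTop, ∀ᵐ ω ∂(μ n), ∀ (b : ℝ) (E : Matrix (Fin n) (Fin n) ℝ),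
      (∀ h : 0 < n, IsTameRow b (X n) E ⟨0, h⟩) → IsResolved b c (X n) E (Xhat n ω))
    (i : ℕ) (t : EuclideanSpace ℝ (Fin d)) {ε : ℝ} (hε : 0 < ε) :
    ∀ᶠ n in atTop, ‖(∫ ω, Complex.exp ((inner ℝ (√(n : ℝ) •
        (rowVec (centering n * Xhat n ω) i - rowVec (centering n * X n) i)) t : ℝ) *
          Complex.I) ∂(μ n)) -
      ∫ ω, Complex.exp ((leadingTerm (X n) (networkNoise (X n * (X n)ᵀ) (A n ω)) i t.ofLp : ℝ) *
        Complex.I) ∂(μ n)‖ ≤ ε + 2 * ε := by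
  -- With this level, the probability bound `32 / L` for the exceptional event is exactly `ε`.
  set L := 32 / ε with hL
  have hL0 : 0 < L := by positivity
  obtain ⟨b, hb1, hbd, hbL, hbM⟩ :
      ∃ b : ℝ, 1 ≤ b ∧ (d : ℝ) ≤ b ∧ 2 * √L + 4 ≤ b ∧ ‖MX⁻¹‖ < b :=
    ⟨max (max 1 d) (max (2 * √L + 4) (‖MX⁻¹‖ + 1)), by simp, by simp, by simp, by simp⟩
  have hb0 : 0 < b := by linarith
  obtain ⟨C, hC⟩ := exists_norm_unitRow_centering_sub_expansion_le d hb1 hbd hc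
  have hinv := ((tendsto_inv_secondMoment hMX hMX_inv).norm).eventually_lt_const hbM
  have hdet : ∀ᶠ n in atTop, (secondMoment (X n)).det ≠ 0 :=
    (((Continuous.matrix_det continuous_id).tendsto MX).comp hMX).eventually_ne hMX_inv.ne_zero
  have hlim : Tendsto (fun n : ℕ => (C + b * b) * ‖t‖ / √(n : ℝ)) atTop (𝓝 0) :=
    Tendsto.const_div_atTop (Real.tendsto_sqrt_atTop.comp tendsto_natCast_atTop_atTop) _
  filter_upwards [eventually_gt_atTop i, hC, hinv, hdet, hlim.eventually_le_const hε, hXhat, hres,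
    tendsto_natCast_atTop_atTop.eventually_ge_atTop (L * (8 * b) ^ 4),
    tendsto_natCast_atTop_atTop.eventually_ge_atTop (8 * b)]
    with n hi hC hinv hdet hlim hXhat hres hnL hnb
  have hn : 0 < n := by omega
  have hdet' := isUnit_iff_ne_zero.2 hdet
  obtain ⟨hgram, hcoer⟩ := norm_inv_gram_and_coercive hn hb0 hdet' hinv.le
  have hrows := sum_sq_row_le_one (hP n)
  have hXn : ‖X n‖ ^ 2 ≤ n := (l2_opNorm_sq_le_sum_sq (X n)).trans
    ((Finset.sum_le_card_nsmul _ _ 1 fun j _ => hrows j).trans_eq (by simp))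
  have hnoise := (hA n).isSymmetricNoise (hP n) fun j k => by
    rw [← transpose_apply (X n * (X n)ᵀ), transpose_mul, transpose_transpose]
  have hdiag : ∀ j, 0 ≤ (X n * (X n)ᵀ) j j ∧ (X n * (X n)ᵀ) j j ≤ 1 := fun j => hP n j j
  have htame := hnoise.measure_not_tame_le hn hrows hdiag hL0 hbL hnL hnb ⟨i, hi⟩ ⟨0, hn⟩
  have hLε : 32 / L = ε := by rw [hL]; field_simp
  rw [hLε] at htame
  refine norm_integral_exp_sub_le ?_ ?_ hε.le hε.le htame ?_
  · have h := aemeasurable_rowVec_error (hXhat_meas n) (X n) i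
    exact h.inner_const
  · exact (measurable_leadingTerm hnoise.measurable_entry (X n) i t.ofLp).aemeasurable
  · filter_upwards [hXhat, hres] with ω hω hres hgood
    obtain ⟨hE, hrow, hrow₀⟩ := not_not.1 hgood
    -- The observed matrix takes the form `X Xᵀ + E` required by the deterministic expansion.
    rw [← (hA n).add_networkNoise ω] at hω
    exact (abs_inner_sub_leadingTerm_le hi hdet' hgram hdiag hrow.factor
      (hC _ _ _ _ hcoer hXn hE hrow hω (hres b _ fun _ => hrow₀)) t).trans hlim

end LimitLaw

theorem theorem2 {d : ℕ} {Ω : ℕ → Type*} [∀ n, MeasurableSpace (Ω n)]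
    (μ : ∀ n, Measure (Ω n)) [∀ n, IsProbabilityMeasure (μ n)]
    -- parameters of the network model with `n` nodes
    (α : ∀ n : ℕ, Fin n → ℝ) (Z X : ∀ n : ℕ, Matrix (Fin n) (Fin d) ℝ)
    (h_prob : ∀ n i j, 0 ≤ linkProb (α n) (Z n) i j ∧ linkProb (α n) (Z n) i j ≤ 1)
    -- the observed network
    (A : ∀ n, Ω n → Matrix (Fin n) (Fin n) ℝ)
    (hA : ∀ n, IsBernoulliNetwork (μ n) (linkProb (α n) (Z n)) (A n))
    -- positive semidefiniteness and the lower bound on the largest expected degree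
    (h_psd : ∀ n, (linkProb (α n) (Z n)).PosSemidef)
    (h_deg : ∃ a : ℝ, 0 < a ∧ ∀ᶠ n : ℕ in atTop,
      ∃ i, Real.log n ^ (4 + a) < ∑ j, linkProb (α n) (Z n) i j)
    -- the latent factors are centered
    (h_centered : ∀ n a, ∑ i, Z n i a = 0)
    -- the latent positions: `P = X Xᵀ`, oriented so that the centered `X` is `Z`
    (hX : ∀ n, X n * (X n)ᵀ = linkProb (α n) (Z n))
    (hXZ : ∀ n, centering n * X n = Z n)
    -- existence of the limits
    (MX : Matrix (Fin d) (Fin d) ℝ) (hMX : Tendsto (fun n => secondMoment (X n)) atTop (𝓝 MX))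
    (hMX_inv : IsUnit MX.det)
    (i : ℕ) (Q : Matrix (Fin d) (Fin d) ℝ)
    (hQ : Tendsto (fun n => scoreCov (X n) i) atTop (𝓝 Q))
    -- the spectral embedding, up to an orthogonal transformation that is fixed below
    (Xhat : ∀ n, Ω n → Matrix (Fin n) (Fin d) ℝ)
    (hXhat_meas : ∀ n j a, AEMeasurable (fun ω => Xhat n ω j a) (μ n))
    (hXhat : ∀ᶠ n in atTop, ∀ᵐ ω ∂(μ n), IsRotatedASE (A n ω) (Xhat n ω))
    (h_rot :
      -- either it is the one that best aligns the embedding with the latent positions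
      (∀ᶠ n in atTop, ∀ᵐ ω ∂(μ n), IsNearestRotation (Xhat n ω) (X n)) ∨
      -- or it makes the estimated factors satisfy the same identifiability condition as `Z`:
      -- a diagonal Gram matrix with distinct elements, and a convention for the column signs
      (HasSeparatedDiagonalGram Z ∧
        (∀ᶠ n in atTop, ∀ᵐ ω ∂(μ n),
          HasMatchingDiagonalGram (centering n * Xhat n ω) (Z n)) ∧
        ((∀ᶠ n in atTop, ∀ᵐ ω ∂(μ n), ∀ a, 0 ≤ ∑ j, Xhat n ω j a * X n j a) ∨
          ((∃ c : ℝ, 0 < c ∧ ∀ᶠ n in atTop, ∀ a, c ≤ rowVec (Z n) 0 a) ∧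
            ∀ᶠ n in atTop, ∀ᵐ ω ∂(μ n), ∀ a, 0 ≤ rowVec (centering n * Xhat n ω) 0 a)))) :
    TendstoInDistribution
      (fun (n : ℕ) ω => √(n : ℝ) • (rowVec (centering n * Xhat n ω) i - rowVec (Z n) i))
      atTop id μ (multivariateGaussian 0 (MX⁻¹ * Q * MX⁻¹)) := by
  simp only [← hX] at h_prob hA
  simp only [← hXZ]
  have hsymm : (MX⁻¹)ᴴ = MX⁻¹ := by
    rw [Matrix.conjTranspose_eq_transpose_of_trivial, Matrix.transpose_nonsing_inv,
      transpose_eq_of_tendsto_secondMoment hMX]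
  have hpsd : (MX⁻¹ * Q * MX⁻¹).PosSemidef := by
    have h := (posSemidef_of_tendsto_scoreCov h_prob hQ).mul_mul_conjTranspose_same MX⁻¹
    rwa [hsymm] at h
  have hmeas : ∀ n : ℕ, AEMeasurable (fun ω => √(n : ℝ) •
      (rowVec (centering n * Xhat n ω) i - rowVec (centering n * X n) i)) (μ n) := fun n =>
    aemeasurable_rowVec_error (hXhat_meas n) (X n) i
  obtain ⟨c, hc, hres⟩ := exists_eventually_isResolved hXZ h_rot
  -- Lévy's continuity theorem: it suffices that characteristic functions converge pointwise.
  refine ⟨hmeas, aemeasurable_id, ProbabilityMeasure.tendsto_iff_tendsto_charFun.2 fun t => ?_⟩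
  have hlead := tendsto_charFun_leadingTerm h_prob hA hMX hMX_inv hQ t.ofLp
  have hlimit : charFun (Measure.map id (multivariateGaussian 0 (MX⁻¹ * Q * MX⁻¹))) t =
      Complex.exp (-((t.ofLp ⬝ᵥ (MX⁻¹ * Q * MX⁻¹) *ᵥ t.ofLp) / 2 : ℝ)) := by
    rw [Measure.map_id, charFun_multivariateGaussian hpsd]
    simp
  have hseq : ∀ n : ℕ, charFun (Measure.map (fun ω => √(n : ℝ) •
      (rowVec (centering n * Xhat n ω) i - rowVec (centering n * X n) i)) (μ n)) t =
      ∫ ω, Complex.exp ((inner ℝ (√(n : ℝ) •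
        (rowVec (centering n * Xhat n ω) i - rowVec (centering n * X n) i)) t : ℝ) *
          Complex.I) ∂(μ n) := fun n => by
    rw [charFun_apply, integral_map (hmeas n)]
    exact Continuous.aestronglyMeasurable (by fun_prop)
  simp only [ProbabilityMeasure.coe_mk, hlimit, hseq]
  refine tendsto_of_tendsto_of_dist hlead (Metric.tendsto_atTop'.2 fun ε hε => ?_)
  -- With `ε / 4` the total error is `ε / 4 + 2 * (ε / 4) < ε`.
  obtain ⟨N, hN⟩ := eventually_atTop.1 (eventually_norm_integral_exp_sub_leadingTerm_le h_prob hA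
    hMX hMX_inv hXhat_meas hXhat hc hres i t (show 0 < ε / 4 by positivity))
  refine ⟨N, fun n hn => ?_⟩
  rw [dist_zero_right, Real.norm_of_nonneg dist_nonneg, dist_comm, dist_eq_norm]
  have := hN n hn.le
  linarith
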